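/- Let $M$ be a $C^1$-manifold of dimension $n\ge 1$ (without boundary), $x\in M$, and $\kappa\ge 1$ an integer. Let $F$ be the germ at $x$ of a $C^1$-map of $M$ with $F(x)=x$. *Notation.* The index $I(G,z)$ of an isolated fixed point $z$ of a $C^1$-map $G$ is the degree of the map $S^{n-1}\to S^{n-1}$, $w\mapsto (w-G(w))/\|w-G(w)\|$, where, in a local chart, $w$ runs through a small sphere centered at $z$. A $\kappa$-periodic point $z$ of $G$, i.e. $G^\kappa(z)=z$, is non-degenerate if $1$ is not an eigenvalue of $D(G^\kappa)_z$. A periodic point with minimal period $\tau$ is odd if the number of real eigenvalues of $D(G^\tau)_z$ in $(-\infty,-1)$, counted with algebraic multiplicity, is odd. A $\kappa$-periodic point with minimal period $\tau$ is bad if it is odd and $\kappa/\tau$ is even, and good otherwise; a $\kappa$-periodic orbit $\mathcal O$ (of any minimal period dividing $\kappa$) is good if its points are good, and $I(G^\kappa,\mathcal O)$ denotes the index $I(G^\kappa,z)$ of any $z\in\mathcal O$. A non-degenerate perturbation $\tilde F$ of $F$ on a small ball $B$ around $x$ in a chart is a $C^1$-map $\tilde F$ on $B$, close to $F$ on $B$,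 such that all $\kappa$-periodic points of $\tilde F$ whose orbits lie in $B$ are non-degenerate. **1 (the iterated index is well defined).** Assume that $x$ is an isolated fixed point of $F^\kappa$. Then, in every chart around $x$ and on every sufficiently small ball $B$ around $x$, there are non-degenerate perturbations arbitrarily $C^1$-close to $F$. Moreover there is exactly one integer $I_\kappa(F,x)$, the *iterated index*, such that for every chart around $x$ and every sufficiently small ball $B$ around $x$ in it there is $\varepsilon>0$ with the following property: every non-degenerate perturbation $\tilde F$ of $F$ on $B$ that is $\varepsilon$-close to $F$ in the uniform norm has only finitely many $\kappa$-periodic points with orbit in $B$, and $$\sum_{\mathcal O\subset B\ \text{good}} I(\tilde F^\kappa,\mathcal O)=I_\kappa(F,x),$$ the sum being over all good $\kappa$-periodic orbits of $\tilde F$ contained in $B$. In particular, $I_\kappa(F,x)$ does not depend on the chosen perturbation, ball or chart. **2 (homotopy invariance).** Let $F_s$, $s\in[0,1]$, be a family of maps, each of them $C^1$ near $x$ with $F_s(x)=x$. Assume that there is a neighborhood $U$ of $x$ such that $(s,y)\mapsto F_s(y)$ is continuous on $[0,1]\times U$ and, for every $s$, $x$ is the only fixed point of $F_s^\kappa$ in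 $U$ (that is, $x$ is uniformly isolated). Then $I_\kappa(F_s,x)$ does not depend on $s$. -/

import Mathlib

open Set Filter Topology
open scoped Manifold ContDiff

/-- The model space `ℝⁿ` with its Euclidean norm. -/
abbrev Eu (n : ℕ) : Type := EuclideanSpace ℝ (Fin n)

namespace IteratedIndex

noncomputable section

/-! ### The degree of a `C¹` map of the unit sphere `S^{n-1}`

A map of the unit sphere is given by a function `g : ℝⁿ → ℝⁿ` of which only the values on the unit
sphere are used. -/

/-- The positively homogeneous extension `u ↦ ‖u‖ g(u / ‖u‖)` of a map `g` of the unit sphere.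
At a point `u` of the sphere its differential sends `u` to `g u` and restricts to the differential
`T_u S^{n-1} → T_{g u} S^{n-1}` of `g`. Hence it is invertible exactly when the latter is, and the
sign of its determinant says whether `g` preserves or reverses the orientation at `u`
(the sphere being oriented as the boundary of the ball). -/
def radialExt {n : ℕ} (g : Eu n → Eu n) (u : Eu n) : Eu n :=
  ‖u‖ • g (‖u‖⁻¹ • u)

/-- The points of the unit sphere sent to `y` by `g`. -/
def spherePreimage {n : ℕ} (g : Eu n → Eu n) (y : Eu n) : Set (Eu n) :=
  {u | ‖u‖ = 1 ∧ g u = y}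

/-- `y` is a point of the unit sphere and a regular value of the sphere map `g`. -/
def IsRegularValue {n : ℕ} (g : Eu n → Eu n) (y : Eu n) : Prop :=
  ‖y‖ = 1 ∧ ∀ u ∈ spherePreimage g y, (fderiv ℝ (radialExt g) u).det ≠ 0

/-- `g` restricts to a `C¹` map of the unit sphere to itself. -/
def IsC1SphereMap {n : ℕ} (g : Eu n → Eu n) : Prop :=
  ∀ u : Eu n, ‖u‖ = 1 → ‖g u‖ = 1 ∧ ContDiffAt ℝ 1 (radialExt g) u

/-- The `C¹` map `g` of the unit sphere has degree `d`: regular values exist, and the number of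
preimages of each of them, counted with orientation signs, is `d`. -/
def HasSphereDegree {n : ℕ} (g : Eu n → Eu n) (d : ℤ) : Prop :=
  IsC1SphereMap g ∧ (∃ y, IsRegularValue g y) ∧
    ∀ y, IsRegularValue g y →
      (spherePreimage g y).Finite ∧
        ∑ᶠ u ∈ spherePreimage g y, (SignType.sign (fderiv ℝ (radialExt g) u).det : ℤ) = d

/-! ### The index of an isolated fixed point -/

/-- The map `z ↦ (z - f z) / ‖z - f z‖` on the sphere of radius `r` centered at `p`; this sphere is
identified with the unit sphere by `z = p + r u`. -/
def indexMap {n : ℕ} (f : Eu n → Eu n) (p : Eu n) (r : ℝ) (u : Eu n) : Eu n :=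
  ‖(p + r • u) - f (p + r • u)‖⁻¹ • ((p + r • u) - f (p + r • u))

/-- The integer `d` is the index of the fixed point `p` of `f`: the degree of `indexMap f p r` for
all small `r > 0`. -/
def HasIndex {n : ℕ} (f : Eu n → Eu n) (p : Eu n) (d : ℤ) : Prop :=
  ∀ᶠ r in 𝓝[>] (0 : ℝ), HasSphereDegree (indexMap f p r) d

open Classical in
/-- The index `I(f, p)` of an isolated fixed point `p` of a map `f` which is `C¹` near `p`. -/
def fixedPointIndex {n : ℕ} (f : Eu n → Eu n) (p : Eu n) : ℤ :=
  if h : ∃ d, HasIndex f p d then h.choose else 0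

/-! ### Periodic points and periodic orbits in an open set -/

/-- The `κ`-periodic points of `g` whose whole orbit lies in `U`. -/
def periodicPts {n : ℕ} (g : Eu n → Eu n) (U : Set (Eu n)) (κ : ℕ) : Set (Eu n) :=
  {z | g^[κ] z = z ∧ ∀ i, g^[i] z ∈ U}

/-- All `κ`-periodic points of `g` with orbit in `U` are non-degenerate: `1` is not an eigenvalue
of the differential of `g^κ` there. -/
def IsNondegenerateOn {n : ℕ} (g : Eu n → Eu n) (U : Set (Eu n)) (κ : ℕ) : Prop :=
  ∀ z ∈ periodicPts g U κ,
    ¬ Module.End.HasEigenvalue (fderiv ℝ (g^[κ]) z).toLinearMap 1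

/-- A periodic point `z` with minimal period `τ` is odd: the number of real eigenvalues of the
differential of `g^τ` at `z` in the interval `(-∞, -1)`, counted with algebraic multiplicity, is
odd. -/
def IsOddPt {n : ℕ} (g : Eu n → Eu n) (z : Eu n) : Prop :=
  Odd (((fderiv ℝ (g^[Function.minimalPeriod g z]) z).toLinearMap.charpoly.roots).countP
    (fun a => a < -1))

/-- A `κ`-periodic point with minimal period `τ` is bad if it is odd and `κ / τ` is even. -/
def IsBadPt {n : ℕ} (g : Eu n → Eu n) (κ : ℕ) (z : Eu n) : Prop :=
  IsOddPt g z ∧ Even (κ / Function.minimalPeriod g z)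

/-- The orbit of `z` under `g`, as a set. -/
def orbit {n : ℕ} (g : Eu n → Eu n) (z : Eu n) : Set (Eu n) :=
  Set.range fun i : ℕ => g^[i] z

/-- The good `κ`-periodic orbits of `g` contained in `U`, of any minimal period dividing `κ`. -/
def goodOrbits {n : ℕ} (g : Eu n → Eu n) (U : Set (Eu n)) (κ : ℕ) : Set (Set (Eu n)) :=
  {O | ∃ z ∈ periodicPts g U κ, ¬ IsBadPt g κ z ∧ O = orbit g z}

open Classical in
/-- The index `I(g^κ, O)` of a `κ`-periodic orbit `O`, i.e. the index of any of its points as a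
fixed point of `g^κ`. -/
def orbitIndex {n : ℕ} (g : Eu n → Eu n) (κ : ℕ) (O : Set (Eu n)) : ℤ :=
  if h : O.Nonempty then fixedPointIndex (g^[κ]) h.some else 0

/-- The sum of the indices of all good `κ`-periodic orbits of `g` contained in `U`. -/
def goodOrbitSum {n : ℕ} (g : Eu n → Eu n) (U : Set (Eu n)) (κ : ℕ) : ℤ :=
  ∑ᶠ O ∈ goodOrbits g U κ, orbitIndex g κ O

/-! ### The iterated index -/

/-- On the ball of radius `r` around `p`, the map `g` is a `C¹` perturbation of `f` which is
`ε`-small in the uniform norm and has only non-degenerate `κ`-periodic points. -/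
def IsNondegPerturbation {n : ℕ} (f : Eu n → Eu n) (p : Eu n) (κ : ℕ) (r ε : ℝ)
    (g : Eu n → Eu n) : Prop :=
  ContDiffOn ℝ 1 g (Metric.ball p r) ∧
    (∀ z ∈ Metric.ball p r, ‖g z - f z‖ < ε) ∧
    IsNondegenerateOn g (Metric.ball p r) κ

/-- The perturbation is moreover `ε`-small in the `C¹` norm. -/
def IsC1NondegPerturbation {n : ℕ} (f : Eu n → Eu n) (p : Eu n) (κ : ℕ) (r ε : ℝ)
    (g : Eu n → Eu n) : Prop :=
  IsNondegPerturbation f p κ r ε g ∧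
    ∀ z ∈ Metric.ball p r, ‖fderiv ℝ g z - fderiv ℝ f z‖ < ε

/-- The integer `m` is the iterated index `I_κ(f, p)` of a germ in `ℝⁿ`: on each small ball around
`p`, every sufficiently small non-degenerate perturbation of `f` has finitely many `κ`-periodic
points, and the indices of its good `κ`-periodic orbits add up to `m`. -/
def IsIteratedIndexAt {n : ℕ} (f : Eu n → Eu n) (p : Eu n) (κ : ℕ) (m : ℤ) : Prop :=
  ∀ᶠ r in 𝓝[>] (0 : ℝ), ∃ ε > 0, ∀ g : Eu n → Eu n, IsNondegPerturbation f p κ r ε g →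
    (periodicPts g (Metric.ball p r) κ).Finite ∧ goodOrbitSum g (Metric.ball p r) κ = m

/-- The map `F` read in the chart `φ`. -/
def inChart {n : ℕ} {M : Type*} [TopologicalSpace M] (φ : OpenPartialHomeomorph M (Eu n))
    (F : M → M) : Eu n → Eu n :=
  fun z => φ (F (φ.symm z))

/-- `φ` is a chart of the `C¹` manifold `M` around `x`. -/
def IsChartAround {n : ℕ} {M : Type*} [TopologicalSpace M] [ChartedSpace (Eu n) M]
    (φ : OpenPartialHomeomorph M (Eu n)) (x : M) : Prop :=
  φ ∈ IsManifold.maximalAtlas 𝓘(ℝ, Eu n) 1 M ∧ x ∈ φ.source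

/-- The integer `m` is the iterated index `I_κ(F, x)` of the germ of `F` at its fixed point `x`,
computed in any chart around `x`. -/
def IsIteratedIndex {n : ℕ} {M : Type*} [TopologicalSpace M] [ChartedSpace (Eu n) M]
    (F : M → M) (x : M) (κ : ℕ) (m : ℤ) : Prop :=
  ∀ φ : OpenPartialHomeomorph M (Eu n), IsChartAround φ x →
    IsIteratedIndexAt (inChart φ F) (φ x) κ m

/-- `F` (of which only the germ at `x` matters) is `C¹` near `x` and fixes `x`. -/
def IsC1Germ (n : ℕ) {M : Type*} [TopologicalSpace M] [ChartedSpace (Eu n) M]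
    (F : M → M) (x : M) : Prop :=
  F x = x ∧ ContMDiffAt 𝓘(ℝ, Eu n) 𝓘(ℝ, Eu n) 1 F x

end

end IteratedIndex

/-! The sum of the indices of the good orbits is not visibly stable under perturbation, but `κ`
times it is a combination of fixed point counts of iterates. For a non-degenerate `g`, `κ * (good
sum) = ∑_{d ∣ κ} φ(κ/d) * ∑_{g^d z = z} sign det (1 - D(g^d)_z)`, with `φ` the totient
(`mul_goodOrbitSum`). Each inner sum is the local degree of `1 - f^d` at the isolated fixed point as
soon as `g` is uniformly close to `f`. So the right side depends on `f` alone, and cancelling `κ`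
gives the index.

The formula is checked point by point (`sum_totient_mul_fixedSign`). Let `z` have minimal period
`τ`, and put `M = κ/τ` and `A = D(g^τ)_z`. Factoring `X^m - 1` over `ℂ` shows that `sign det (1 -
A^m)` depends only on the parity of `m`. It is `e₁ = sign det (1 - A)` for odd `m` and `e₁ e₂` for
even `m`, where `e₂ = sign det (1 + A)` is `-1` exactly at odd points. The weights `φ(M/m)`, `m ∣
M`, add up to `M`, and for even `M` the even `m` carry half of this. Hence the weighted sum is `M`
times the index at a good point and cancels at a bad one. Summing over the `τ` points of an orbit
turns `M` into `κ`.

The degree theory is built from signed counts of zeros. The integral of a Jacobian determinant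
depends only on boundary values (`integral_det_fderiv_eq`). Composing with a map whose Jacobian is a
bump at `0` makes such an integral count zeros, whence homotopy invariance
(`signedCount_eq_of_segment`). Sard's theorem then gives a local degree for continuous maps, which
is stable under uniform perturbation, satisfies excision and does not depend on coordinates
(`IsLocalDegree.conj`). The sphere degree in the definition of the index is needed only at
non-degenerate points, where it is the sign of a determinant (`hasIndex_of_det_ne_zero`).

Non-degenerate perturbations exist by a Kupka-Smale argument, by induction on the period
(`exists_perturbation_forall_isStronglyNondegenerate`). They also show that the totient-weighted sum
of local degrees is divisible by `κ`. Homotopy invariance follows because each local degree is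
locally constant in the parameter, which uses only continuity of the family in the parameter. -/

/-! ### Linear algebra: the signs of `det (1 - A^m)` and `det (1 + A)`. -/

open Polynomial in
-- Over `ℂ`, `A^m - 1` is the product of the `A - ζ` over the `m`-th roots of unity. The real roots
-- are `1` and, for even `m`, `-1`. The others come in conjugate pairs, whose determinants multiply
-- to some `|P|²`; this is the factor `c`.
theorem Matrix.exists_det_pow_sub_one_eq {ι : Type*} [Fintype ι] [DecidableEq ι]
    (A : Matrix ι ι ℝ) {m : ℕ} (hm : 0 < m) :
    ∃ c : ℝ, 0 ≤ c ∧ (A ^ m - 1).det =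
      (A - 1).det * (if Even m then (A + 1).det else 1) * c := by
  classical
  set B : Matrix ι ι ℂ := A.map (algebraMap ℝ ℂ) with hB
  let D : ℂ[X] →* ℂ := Matrix.detMonoidHom.comp (aeval B : ℂ[X] →ₐ[ℂ] _).toMonoidHom
  have hD : ∀ q, D q = (aeval B q).det := fun q => rfl
  have hfac : (X ^ m - 1 : ℂ[X]) = ∏ ζ ∈ nthRootsFinset m (1 : ℂ), (X - C ζ) :=
    X_pow_sub_one_eq_prod hm (Complex.isPrimitiveRoot_exp m hm.ne')
  have hmap : ∀ M : Matrix ι ι ℝ, ((M.map (algebraMap ℝ ℂ)).det) = ((M.det : ℝ) : ℂ) := by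
    intro M
    have := (RingHom.map_det (algebraMap ℝ ℂ) M).symm
    simpa using this
  have hconj : ∀ ζ : ℂ, D (X - C (starRingEnd ℂ ζ)) = starRingEnd ℂ (D (X - C ζ)) := by
    intro ζ
    rw [hD, hD, RingHom.map_det]
    congr 1
    ext i j
    simp [hB, Matrix.algebraMap_matrix_apply, apply_ite (starRingEnd ℂ)]
  have hreal : ∀ a : ℝ, D (X - C (a : ℂ)) = (((A - algebraMap ℝ _ a).det : ℝ) : ℂ) := by
    intro a
    rw [hD, ← hmap]
    congr 1
    ext i j
    simp [hB, Matrix.algebraMap_matrix_apply, apply_ite ((↑) : ℝ → ℂ)]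
  set S := nthRootsFinset m (1 : ℂ) with hS
  have hmem : ∀ ζ, ζ ∈ S ↔ ζ ^ m = 1 := fun ζ => mem_nthRootsFinset hm (1 : ℂ)
  have hlow : ∏ ζ ∈ S with ζ.im < 0, D (X - C ζ) =
      starRingEnd ℂ (∏ ζ ∈ S with 0 < ζ.im, D (X - C ζ)) := by
    rw [map_prod]
    refine Finset.prod_bij' (fun ζ _ => starRingEnd ℂ ζ) (fun ζ _ => starRingEnd ℂ ζ) ?_ ?_ ?_ ?_ ?_
    · intro ζ hζ
      simp only [Finset.mem_filter, hmem, Complex.conj_im] at hζ ⊢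
      refine ⟨by rw [← map_pow, hζ.1, map_one], by linarith [hζ.2]⟩
    · intro ζ hζ
      simp only [Finset.mem_filter, hmem, Complex.conj_im] at hζ ⊢
      refine ⟨by rw [← map_pow, hζ.1, map_one], by linarith [hζ.2]⟩
    · simp
    · simp
    · intro ζ _
      rw [hconj]
      simp
  set P := ∏ ζ ∈ S with 0 < ζ.im, D (X - C ζ) with hP
  have hsplit : D (X ^ m - 1) = (∏ ζ ∈ S with ζ.im = 0, D (X - C ζ)) * (P * starRingEnd ℂ P) := by
    rw [hfac, map_prod, ← hlow, ← Finset.prod_filter_mul_prod_filter_not S (fun ζ => ζ.im = 0)]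
    congr 1
    rw [← Finset.prod_filter_mul_prod_filter_not (S.filter fun ζ => ¬ ζ.im = 0)
      (fun ζ => 0 < ζ.im), Finset.filter_filter, Finset.filter_filter]
    congr 1
    · refine Finset.prod_congr (Finset.filter_congr fun ζ _ => ?_) fun _ _ => rfl
      constructor
      · exact fun h => h.2
      · exact fun h => ⟨h.ne', h⟩
    · refine Finset.prod_congr (Finset.filter_congr fun ζ _ => ?_) fun _ _ => rfl
      constructor
      · exact fun h => lt_of_le_of_ne (not_lt.1 h.2) h.1
      · exact fun h => ⟨h.ne, h.not_gt⟩
  have hr : ∏ ζ ∈ S with ζ.im = 0, D (X - C ζ) =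
      (((A - 1).det * (if Even m then (A + 1).det else 1) : ℝ) : ℂ) := by
    have h1 : D (X - C 1) = (((A - 1).det : ℝ) : ℂ) := by
      have := hreal 1
      simpa using this
    have h2 : D (X - C (-1)) = (((A + 1).det : ℝ) : ℂ) := by
      have := hreal (-1)
      simpa using this
    have hre : ∀ ζ : ℂ, ζ.im = 0 → ζ ^ m = 1 → ζ = 1 ∨ ζ = -1 := by
      intro ζ h0 h
      lift ζ to ℝ using h0
      have h' : ζ ^ m = 1 := by exact_mod_cast h
      have : |ζ| = 1 := by
        have h3 : |ζ| ^ m = 1 := by rw [← abs_pow, h', abs_one]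
        exact (pow_eq_one_iff_of_nonneg (abs_nonneg _) hm.ne').1 h3
      rcases (abs_eq zero_le_one).1 this with h | h <;> [left; right] <;> simp [h]
    split_ifs with he
    · have : S.filter (fun ζ => ζ.im = 0) = {1, -1} := by
        ext ζ
        simp only [Finset.mem_filter, hmem, Finset.mem_insert, Finset.mem_singleton]
        constructor
        · exact fun h => hre ζ h.2 h.1
        · rintro (rfl | rfl)
          · simp
          · simp [he.neg_one_pow]
      rw [this, Finset.prod_pair (by norm_num), h1, h2]
      push_cast; ring
    · have : S.filter (fun ζ => ζ.im = 0) = {1} := by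
        ext ζ
        simp only [Finset.mem_filter, hmem, Finset.mem_singleton]
        constructor
        · intro h
          rcases hre ζ h.2 h.1 with h3 | h3
          · exact h3
          · rw [h3, (Nat.not_even_iff_odd.1 he).neg_one_pow] at h
            norm_num at h
        · rintro rfl
          simp
      rw [this, Finset.prod_singleton, h1]
      simp
  refine ⟨Complex.normSq P, Complex.normSq_nonneg _, ?_⟩
  have hfin : (((A ^ m - 1).det : ℝ) : ℂ) = D (X ^ m - 1) := by
    rw [hD, ← hmap]
    congr 1
    have h4 : B ^ m = (A ^ m).map (algebraMap ℝ ℂ) := (Matrix.map_pow A (algebraMap ℝ ℂ) m).symm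
    simp only [map_sub, map_pow, aeval_X, map_one, h4]
    ext i j
    simp [Matrix.one_apply, apply_ite ((↑) : ℝ → ℂ)]
  rw [hsplit, hr, Complex.mul_conj] at hfin
  exact_mod_cast hfin

namespace LinearMap

variable {V : Type*} [AddCommGroup V] [Module ℝ V] [FiniteDimensional ℝ V]

theorem exists_det_one_sub_pow_eq (A : Module.End ℝ V) {m : ℕ} (hm : 0 < m) :
    ∃ c : ℝ, 0 ≤ c ∧ LinearMap.det (1 - A ^ m) =
      LinearMap.det (1 - A) * (if Even m then LinearMap.det (1 + A) else 1) * c := by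
  classical
  let b := Module.finBasis ℝ V
  obtain ⟨c, hc, h⟩ := Matrix.exists_det_pow_sub_one_eq (LinearMap.toMatrixAlgEquiv b A) hm
  have key : ∀ B : Module.End ℝ V, (LinearMap.toMatrixAlgEquiv b B).det = LinearMap.det B :=
    fun B => LinearMap.det_toMatrix b B
  refine ⟨c, hc, ?_⟩
  rw [← map_pow, ← map_one (LinearMap.toMatrixAlgEquiv b), ← map_sub, ← map_sub, ← map_add, key,
    key, key] at h
  have hneg : ∀ B C : Module.End ℝ V, LinearMap.det (B - C) =
      (-1) ^ Module.finrank ℝ V * LinearMap.det (C - B) := by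
    intro B C
    rw [← neg_sub C B, ← LinearMap.det_smul, neg_one_smul]
  rw [hneg, h, hneg 1 A, add_comm A 1]
  ring

theorem sign_det_one_sub_pow_of_odd (A : Module.End ℝ V) {m : ℕ} (hm : Odd m)
    (h : LinearMap.det (1 - A ^ m) ≠ 0) :
    SignType.sign (LinearMap.det (1 - A ^ m)) = SignType.sign (LinearMap.det (1 - A)) := by
  obtain ⟨c, hc, he⟩ := exists_det_one_sub_pow_eq A hm.pos
  rw [if_neg (Nat.not_even_iff_odd.2 hm), mul_one] at he
  have hc' : 0 < c := hc.lt_of_ne (by rintro rfl; simp [he] at h)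
  rw [he, sign_mul, sign_pos hc', mul_one]

theorem sign_det_one_sub_pow_of_even (A : Module.End ℝ V) {m : ℕ} (hm : Even m) (hm0 : m ≠ 0)
    (h : LinearMap.det (1 - A ^ m) ≠ 0) :
    LinearMap.det (1 + A) ≠ 0 ∧ SignType.sign (LinearMap.det (1 - A ^ m)) =
      SignType.sign (LinearMap.det (1 - A)) * SignType.sign (LinearMap.det (1 + A)) := by
  obtain ⟨c, hc, he⟩ := exists_det_one_sub_pow_eq A (Nat.pos_of_ne_zero hm0)
  rw [if_pos hm] at he
  have hc' : 0 < c := hc.lt_of_ne (by rintro rfl; simp [he] at h)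
  refine ⟨fun h0 => h (by rw [he, h0]; ring), ?_⟩
  rw [he, sign_mul, sign_mul, sign_pos hc', mul_one]

end LinearMap

open Polynomial in
/-- A monic real polynomial without roots is positive. -/
theorem Polynomial.Monic.eval_pos_of_roots_eq_zero {q : ℝ[X]} (hq : q.Monic) (h : q.roots = 0)
    (x : ℝ) : 0 < q.eval x := by
  have hne : ∀ y, q.eval y ≠ 0 := by
    intro y hy
    have : y ∈ q.roots := (mem_roots hq.ne_zero).2 hy
    simp [h] at this
  by_contra! hx
  have hdeg : 0 < q.degree := by
    by_contra! h0
    have := hq.degree_le_zero_iff_eq_one.1 h0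
    simp [this] at hx
    linarith
  have ht : Tendsto (fun x => q.eval x) atTop atTop :=
    q.tendsto_atTop_of_leadingCoeff_nonneg hdeg (by rw [hq.leadingCoeff]; norm_num)
  obtain ⟨y, hxy, hy⟩ := ((eventually_ge_atTop x).and (ht.eventually_ge_atTop 0)).exists
  obtain ⟨z, -, hz⟩ := intermediate_value_Icc hxy (q.continuous.continuousOn) ⟨hx, hy⟩
  exact hne z hz

open Polynomial in
-- Each real root `a` contributes a factor `1 + a`, negative exactly when `a < -1`. The cofactor `q`
-- has no real root, so the monic polynomial `(-1)^deg q * q(-X)` is positive at `1`.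
theorem Polynomial.sign_neg_one_pow_mul_eval_neg_one {p : ℝ[X]} (hp : p.Monic)
    (h : p.eval (-1) ≠ 0) :
    SignType.sign ((-1) ^ p.natDegree * p.eval (-1)) =
      (-1) ^ (p.roots.countP fun a => a < -1) := by
  obtain ⟨q, hpq, hcard, hqr⟩ := exists_prod_multiset_X_sub_C_mul p
  have hmon : ((p.roots.map fun a => X - C a).prod).Monic := monic_multiset_prod_of_monic _ _
    fun a _ => monic_X_sub_C a
  have hq : q.Monic := by
    have : ((p.roots.map fun a => X - C a).prod * q).Monic := by rw [hpq]; exact hp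
    exact hmon.of_mul_monic_left this
  have hq' : ((-1 : ℝ[X]) ^ q.natDegree * q.comp (-X)).Monic := hq.neg_one_pow_natDegree_mul_comp_neg_X
  have hpos : 0 < (-1) ^ q.natDegree * q.eval (-1) := by
    have := hq'.eval_pos_of_roots_eq_zero ?_ 1
    · simpa using this
    · refine Multiset.eq_zero_of_forall_notMem fun y hy => ?_
      rw [mem_roots hq'.ne_zero] at hy
      have h1 : q.eval (-y) = 0 := by
        have : (-1) ^ q.natDegree * q.eval (-y) = 0 := by simpa using hy
        exact (mul_eq_zero.1 this).resolve_left (by simp)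
      have : -y ∈ q.roots := (mem_roots hq.ne_zero).2 h1
      simp [hqr] at this
  have hne : ∀ a ∈ p.roots, a ≠ -1 := by
    rintro a ha rfl
    exact h ((mem_roots hp.ne_zero).1 ha)
  have hprod : ∀ s : Multiset ℝ, (∀ a ∈ s, a ≠ -1) →
      SignType.sign ((-1) ^ s.card * ((s.map fun a => X - C a).prod).eval (-1)) =
        (-1) ^ (s.countP fun a => a < -1) := by
    intro s
    induction s using Multiset.induction_on with
    | empty => simp
    | cons a s ih =>
      intro hs
      have ih' := ih fun b hb => hs b (Multiset.mem_cons_of_mem hb)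
      have ha : a ≠ -1 := hs a (Multiset.mem_cons_self a s)
      rw [Multiset.card_cons, Multiset.map_cons, Multiset.prod_cons, eval_mul]
      have e : (-1 : ℝ) ^ (s.card + 1) * (eval (-1) (X - C a) *
          eval (-1) (s.map fun a => X - C a).prod) =
          (1 + a) * ((-1) ^ s.card * eval (-1) (s.map fun a => X - C a).prod) := by
        simp only [eval_sub, eval_X, eval_C]; ring
      rw [e, sign_mul, ih']
      by_cases hlt : a < -1
      · rw [Multiset.countP_cons_of_pos (p := fun a => a < -1) s hlt, sign_neg (by linarith), pow_succ, mul_comm]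
      · rw [Multiset.countP_cons_of_neg (p := fun a => a < -1) s hlt, sign_pos, one_mul]
        have := lt_of_le_of_ne (not_lt.1 hlt) ha.symm
        linarith
  have e2 : (-1) ^ p.natDegree * p.eval (-1) = ((-1) ^ p.roots.card *
      ((p.roots.map fun a => X - C a).prod).eval (-1)) * ((-1) ^ q.natDegree * q.eval (-1)) := by
    have e3 : p.eval (-1) =
        ((p.roots.map fun a => X - C a).prod).eval (-1) * q.eval (-1) := by
      rw [← eval_mul, hpq]
    rw [← hcard, e3]
    ring
  rw [e2, sign_mul, sign_pos hpos, mul_one, hprod _ hne]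

theorem LinearMap.sign_det_one_add {V : Type*} [AddCommGroup V] [Module ℝ V]
    [FiniteDimensional ℝ V] (A : Module.End ℝ V) (h : LinearMap.det (1 + A) ≠ 0) :
    SignType.sign (LinearMap.det (1 + A)) =
      (-1) ^ ((LinearMap.charpoly A).roots.countP fun a => a < -1) := by
  have e : LinearMap.det (1 + A) =
      (-1) ^ (LinearMap.charpoly A).natDegree * (LinearMap.charpoly A).eval (-1) := by
    rw [LinearMap.charpoly_natDegree, LinearMap.eval_charpoly, ← LinearMap.det_smul]
    congr 1
    ext x
    simp [add_comm]
  rw [e] at h ⊢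
  exact Polynomial.sign_neg_one_pow_mul_eval_neg_one A.charpoly_monic
    fun h0 => h (by rw [h0, mul_zero])

/-! ### The index of a non-degenerate fixed point as the sign of a determinant. -/

section Radial

variable {E : Type*} [NormedAddCommGroup E] [InnerProductSpace ℝ E]

theorem hasFDerivAt_norm_of_ne_zero {a : E} (ha : a ≠ 0) :
    HasFDerivAt (fun x : E => ‖x‖) (‖a‖⁻¹ • innerSL ℝ a) a := by
  have h := ((hasStrictFDerivAt_norm_sq a).hasFDerivAt).sqrt
    (by simpa using ha)
  simp only [Real.sqrt_sq (norm_nonneg _)] at h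
  refine h.congr_fderiv ?_
  ext w
  simp
  field_simp

theorem hasFDerivAt_normalize {a : E} (ha : a ≠ 0) :
    HasFDerivAt (fun x : E => ‖x‖⁻¹ • x)
      (‖a‖⁻¹ • ContinuousLinearMap.id ℝ E - (‖a‖⁻¹ ^ 3 • innerSL ℝ a).smulRight a) a := by
  have hna : ‖a‖ ≠ 0 := norm_ne_zero_iff.2 ha
  have h1 : HasFDerivAt (fun x : E => ‖x‖⁻¹) (-(‖a‖ ^ 2)⁻¹ • (‖a‖⁻¹ • innerSL ℝ a)) a :=
    (hasDerivAt_inv hna).comp_hasFDerivAt a (hasFDerivAt_norm_of_ne_zero ha)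
  refine (h1.fun_smul (hasFDerivAt_id a)).congr_fderiv ?_
  ext w
  simp only [_root_.sub_apply, _root_.smul_apply,
    _root_.add_apply, ContinuousLinearMap.smulRight_apply, id,
    ContinuousLinearMap.id_apply, smul_eq_mul]
  module

/-- The differential at `u` of the radial extension of `u ↦ H u / ‖H u‖` is that of `H`, corrected
by a rank one operator and a shear. -/
theorem hasFDerivAt_radial {H : E → E} {T : E →L[ℝ] E} {u : E} (hu : ‖u‖ = 1)
    (hH : HasFDerivAt H T u) (ha : H u ≠ 0) :
    HasFDerivAt (fun v : E => ‖v‖ • (‖H (‖v‖⁻¹ • v)‖⁻¹ • H (‖v‖⁻¹ • v)))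
      (‖H u‖⁻¹ • ((T + (innerSL ℝ u).smulRight (H u - T u)) ∘L
        (ContinuousLinearMap.id ℝ E + (-(‖H u‖⁻¹ ^ 2 • (innerSL ℝ (H u) ∘L T ∘L
          (ContinuousLinearMap.id ℝ E - (innerSL ℝ u).smulRight u)))).smulRight u))) u := by
  have hu0 : u ≠ 0 := by rintro rfl; simp at hu
  have hna : ‖H u‖ ≠ 0 := norm_ne_zero_iff.2 ha
  have h1 := hasFDerivAt_normalize hu0
  have huu : ‖u‖⁻¹ • u = u := by simp [hu]
  have hH' : HasFDerivAt H T ((fun x : E => ‖x‖⁻¹ • x) u) := by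
    simpa only [huu] using hH
  have h2 := HasFDerivAt.comp (f := fun x : E => ‖x‖⁻¹ • x) u hH' h1
  have hn : HasFDerivAt (fun x : E => ‖x‖⁻¹ • x) _ ((H ∘ fun x : E => ‖x‖⁻¹ • x) u) :=
    hasFDerivAt_normalize (a := (H ∘ fun x : E => ‖x‖⁻¹ • x) u) (by simpa [huu] using ha)
  refine ((hasFDerivAt_norm_of_ne_zero hu0).fun_smul (hn.comp u h2)).congr_fderiv ?_
  ext w
  have hiu : inner ℝ u u = (1 : ℝ) := by rw [real_inner_self_eq_norm_sq, hu]; norm_num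
  have hia : inner ℝ (H u) (H u) = ‖H u‖ ^ 2 := real_inner_self_eq_norm_sq _
  simp only [Function.comp_apply, hu, inv_one, one_pow, one_smul, innerSL_apply_apply,
    _root_.add_apply, _root_.smul_apply, _root_.sub_apply,
    ContinuousLinearMap.smulRight_apply, ContinuousLinearMap.comp_apply, smul_eq_mul,
    ContinuousLinearMap.id_apply, _root_.neg_apply, map_add, map_smul, map_sub, hiu]
  module

/-- A map close to the identity sends distinct points of the sphere to distinct directions. -/
theorem ApproximatesLinearOn.eq_of_map_eq_smul {ψ : E → E} {c : NNReal} (hc : 3 * (c : ℝ) < 1)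
    (h : ApproximatesLinearOn ψ (ContinuousLinearMap.id ℝ E) (Metric.ball 0 2) c)
    (h0 : ψ 0 = 0) {u v : E} (hu : ‖u‖ = 1) (hv : ‖v‖ = 1) {t : ℝ} (ht : 0 < t)
    (he : ψ u = t • ψ v) : u = v := by
  -- Exchanging `u` and `v` inverts `t`. With `t ≤ 1`, the point `t • v` stays in the ball where the
  -- estimate holds.
  wlog ht1 : t ≤ 1 generalizing u v t
  · refine (this hv hu (inv_pos.2 ht) ?_ (inv_le_one_of_one_le₀ (not_le.1 ht1).le)).symm
    rw [he, smul_smul, inv_mul_cancel₀ ht.ne', one_smul]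
  have hmem : ∀ w : E, ‖w‖ ≤ 1 → w ∈ Metric.ball (0 : E) 2 := by
    intro w hw
    rw [mem_ball_zero_iff]; linarith
  have htv : ‖t • v‖ = t := by rw [norm_smul, hv, mul_one, Real.norm_of_nonneg ht.le]
  have e1 := h u (hmem u hu.le) (t • v) (hmem _ (by rw [htv]; exact ht1))
  have e2 := h v (hmem v hv.le) (t • v) (hmem _ (by rw [htv]; exact ht1))
  have e3 := h v (hmem v hv.le) 0 (hmem _ (by simp))
  simp only [ContinuousLinearMap.id_apply, h0, sub_zero, hv, mul_one] at e1 e2 e3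
  have hvt : ‖v - t • v‖ = 1 - t := by
    have : v - t • v = (1 - t) • v := by module
    rw [this, norm_smul, hv, mul_one, Real.norm_of_nonneg (by linarith)]
  have hle : 1 - t ≤ ‖u - t • v‖ := by
    have := norm_sub_norm_le u (t • v)
    rwa [hu, htv] at this
  rw [hvt] at e2
  -- Each of the three terms is an error of `ψ` against the identity. As `1 - t ≤ ‖u - t • v‖`,
  -- together they are at most `3c ‖u - t • v‖`, which forces this norm to vanish.
  have key : u - t • v = -(ψ u - ψ (t • v) - (u - t • v)) +
      (-(1 - t)) • (ψ v - v) + (ψ v - ψ (t • v) - (v - t • v)) := by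
    rw [he]; module
  have hb : ‖u - t • v‖ ≤ c * ‖u - t • v‖ + (1 - t) * c + c * (1 - t) := by
    conv_lhs => rw [key]
    refine (norm_add_le _ _).trans (add_le_add ((norm_add_le _ _).trans (add_le_add ?_ ?_)) e2)
    · rw [norm_neg]; exact e1
    · rw [norm_smul, norm_neg, Real.norm_of_nonneg (by linarith)]
      gcongr
  have hc0 : (0 : ℝ) ≤ c := c.2
  have hz : ‖u - t • v‖ = 0 := by
    have h5 : ‖u - t • v‖ ≤ 3 * c * ‖u - t • v‖ := by nlinarith
    nlinarith [norm_nonneg (u - t • v)]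
  have ht' : t = 1 := by linarith
  rw [norm_eq_zero, sub_eq_zero, ht', one_smul] at hz
  exact hz

/-- A map close to the identity attains every direction on the sphere. -/
theorem ApproximatesLinearOn.exists_map_eq_smul [CompleteSpace E] {ψ : E → E} {c : NNReal}
    (hc : 5 * (c : ℝ) < 1)
    (h : ApproximatesLinearOn ψ (ContinuousLinearMap.id ℝ E) (Metric.ball 0 2) c)
    (h0 : ψ 0 = 0) {e : E} (he : e ≠ 0) :
    ∃ u, ‖u‖ = 1 ∧ ∃ t : ℝ, 0 < t ∧ ψ u = t • e := by
  have hnt : Nontrivial E := ⟨e, 0, he⟩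
  have hc0 : (0 : ℝ) ≤ c := c.2
  have h' : ApproximatesLinearOn ψ ((ContinuousLinearEquiv.refl ℝ E : E ≃L[ℝ] E) : E →L[ℝ] E)
      (Metric.ball 0 2) c := h
  have hN : ‖(((ContinuousLinearEquiv.refl ℝ E : E ≃L[ℝ] E).symm : E →L[ℝ] E))‖₊ = 1 := by
    have : (((ContinuousLinearEquiv.refl ℝ E : E ≃L[ℝ] E).symm : E →L[ℝ] E)) =
      ContinuousLinearMap.id ℝ E := rfl
    rw [this, ContinuousLinearMap.nnnorm_id]
  have hlt : c < ‖(((ContinuousLinearEquiv.refl ℝ E : E ≃L[ℝ] E).symm : E →L[ℝ] E))‖₊⁻¹ := by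
    rw [hN, inv_one, ← NNReal.coe_lt_coe]
    push_cast
    linarith
  let G := h'.toOpenPartialHomeomorph ψ (Metric.ball 0 2) (Or.inr hlt) Metric.isOpen_ball
  have htar : Metric.closedBall (0 : E) ((1 - c) * (3 / 2)) ⊆ G.target := by
    have := h'.closedBall_subset_target (Or.inr hlt) Metric.isOpen_ball (b := (0 : E))
      (ε := 3 / 2) (by norm_num) (Metric.closedBall_subset_ball (by norm_num))
    simpa only [h0, hN, inv_one, NNReal.coe_one] using this
  set T : ℝ := (1 - c) * (3 / 2) with hT
  have hTpos : 0 ≤ T := by rw [hT]; nlinarith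
  set e' : E := ‖e‖⁻¹ • e with he'
  have hne : ‖e‖ ≠ 0 := norm_ne_zero_iff.2 he
  have hn' : ‖e'‖ = 1 := by
    rw [he', norm_smul, norm_inv, norm_norm, inv_mul_cancel₀ hne]
  have hin : ∀ t ∈ Icc 0 T, t • e' ∈ G.target := by
    intro t ht
    apply htar
    rw [mem_closedBall_zero_iff, norm_smul, hn', mul_one, Real.norm_of_nonneg ht.1]
    exact ht.2
  have hcont : ContinuousOn (fun t : ℝ => ‖G.symm (t • e')‖) (Icc 0 T) := by
    refine ContinuousOn.norm ?_
    exact G.continuousOn_symm.comp (by fun_prop) hin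
  have hsrc : ∀ t ∈ Icc 0 T, G.symm (t • e') ∈ Metric.ball (0 : E) 2 := fun t ht =>
    G.map_target (hin t ht)
  have hψ : ∀ t ∈ Icc 0 T, ψ (G.symm (t • e')) = t • e' := fun t ht => G.right_inv (hin t ht)
  have hz : G.symm ((0 : ℝ) • e') = 0 := by
    have : G.symm (ψ 0) = 0 := G.left_inv (show (0 : E) ∈ Metric.ball (0 : E) 2 by simp)
    rw [h0] at this
    rwa [zero_smul]
  -- A preimage of norm below `1` would give `T < 1 + c`, whereas `T = (1 - c) * 3/2` exceeds `1 +
  -- c` precisely when `5c < 1`.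
  have hb : 1 ≤ ‖G.symm (T • e')‖ := by
    have e1 := h _ (hsrc T ⟨hTpos, le_rfl⟩) 0 (by simp)
    rw [hψ T ⟨hTpos, le_rfl⟩, h0] at e1
    simp only [sub_zero, ContinuousLinearMap.id_apply] at e1
    have e2 := norm_sub_norm_le (T • e') (G.symm (T • e'))
    rw [norm_smul, hn', mul_one, Real.norm_of_nonneg hTpos] at e2
    by_contra! hlt1
    have : T ≤ (1 + c) * ‖G.symm (T • e')‖ := by linarith
    nlinarith [norm_nonneg (G.symm (T • e'))]
  -- The preimage of the ray in direction `e` starts at `0` and ends at norm at least `1`, so it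
  -- crosses the unit sphere.
  obtain ⟨t, ht, hte⟩ := intermediate_value_Icc hTpos hcont
    (show (1 : ℝ) ∈ Icc _ _ from ⟨by simp only [hz, norm_zero]; norm_num, hb⟩)
  have ht0 : 0 < t := by
    refine ht.1.lt_of_ne ?_
    rintro rfl
    simp only [hz, norm_zero] at hte
    norm_num at hte
  refine ⟨G.symm (t • e'), hte, t * ‖e‖⁻¹, by positivity, ?_⟩
  rw [hψ t ht, he', smul_smul]

end Radial

section Det

variable {E : Type*} [NormedAddCommGroup E] [NormedSpace ℝ E]

theorem ContinuousLinearMap.eventually_sign_det_eq (A : E →L[ℝ] E) (hA : A.det ≠ 0) :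
    ∀ᶠ Q in 𝓝 A, Q.det ≠ 0 ∧ SignType.sign Q.det = SignType.sign A.det := by
  have hc := (ContinuousLinearMap.continuous_det (𝕜 := ℝ) (E := E)).tendsto A
  rcases lt_or_gt_of_ne hA with h | h
  · filter_upwards [hc.eventually (gt_mem_nhds h)] with Q hQ
    exact ⟨hQ.ne, by rw [sign_neg hQ, sign_neg h]⟩
  · filter_upwards [hc.eventually (lt_mem_nhds h)] with Q hQ
    exact ⟨hQ.ne', by rw [sign_pos hQ, sign_pos h]⟩

variable [FiniteDimensional ℝ E]

/-- The last factor is a transvection, of determinant `1`. It is the shear occurring in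
`hasFDerivAt_radial`, where `ℓ` kills `u` because it factors through the projection off `u`. -/
theorem ContinuousLinearMap.det_smul_comp_shear (a : ℝ) (Q : E →L[ℝ] E)
    (ℓ : E →L[ℝ] ℝ) (u : E) (h : ℓ u = 0) :
    (a • (Q ∘L (ContinuousLinearMap.id ℝ E + ℓ.smulRight u))).det =
      a ^ Module.finrank ℝ E * Q.det := by
  have e : ((a • (Q ∘L (ContinuousLinearMap.id ℝ E + ℓ.smulRight u)) : E →L[ℝ] E) : E →ₗ[ℝ] E) =
      a • ((Q : E →ₗ[ℝ] E) * LinearMap.transvection (ℓ : E →ₗ[ℝ] ℝ) u) := by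
    ext x
    simp [LinearMap.transvection]
  rw [ContinuousLinearMap.det, e, LinearMap.det_smul, map_mul, LinearMap.transvection.det]
  simp [h, ContinuousLinearMap.det]

end Det

namespace IteratedIndex

theorem HasSphereDegree.unique {n : ℕ} {g : Eu n → Eu n} {d d' : ℤ} (h : HasSphereDegree g d)
    (h' : HasSphereDegree g d') : d = d' := by
  obtain ⟨-, ⟨y, hy⟩, h1⟩ := h
  rw [← (h1 y hy).2, (h'.2.2 y hy).2]

theorem HasIndex.unique {n : ℕ} {f : Eu n → Eu n} {p : Eu n} {d d' : ℤ} (h : HasIndex f p d)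
    (h' : HasIndex f p d') : d = d' := by
  obtain ⟨r, hr, hr'⟩ := (Filter.Eventually.and h h').exists
  exact hr.unique hr'

theorem HasIndex.fixedPointIndex_eq {n : ℕ} {f : Eu n → Eu n} {p : Eu n} {d : ℤ}
    (h : HasIndex f p d) : fixedPointIndex f p = d := by
  have hex : ∃ d, HasIndex f p d := ⟨d, h⟩
  rw [fixedPointIndex, dif_pos hex]
  exact hex.choose_spec.unique h

/-- A map of the ball of radius `2` that is `C¹`-close to a linear isomorphism `A` induces a
sphere map whose degree is the sign of `det A`. -/
theorem hasSphereDegree_of_approximatesLinearOn {n : ℕ} (hn : 1 ≤ n) {H : Eu n → Eu n}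
    (A : Eu n ≃L[ℝ] Eu n) {c : NNReal}
    (hc : 5 * (‖(A.symm : Eu n →L[ℝ] Eu n)‖ * c) < 1)
    (hA : ∀ Q : Eu n →L[ℝ] Eu n, ‖Q - A‖ ≤ 3 * c → Q.det ≠ 0 ∧
      SignType.sign Q.det = SignType.sign (A : Eu n →L[ℝ] Eu n).det)
    (h : ApproximatesLinearOn H (A : Eu n →L[ℝ] Eu n) (Metric.ball 0 2) c) (h0 : H 0 = 0)
    (hd : ∀ u : Eu n, ‖u‖ = 1 → ContDiffAt ℝ 1 H u ∧ ‖fderiv ℝ H u - A‖ ≤ c) :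
    HasSphereDegree (fun u => ‖H u‖⁻¹ • H u)
      (SignType.sign (A : Eu n →L[ℝ] Eu n).det : ℤ) := by
  set K : NNReal := ‖(A.symm : Eu n →L[ℝ] Eu n)‖₊ with hK
  have hKc : ((K * c : NNReal) : ℝ) = ‖(A.symm : Eu n →L[ℝ] Eu n)‖ * c := by
    push_cast; rw [hK, coe_nnnorm]
  have hc0 : (0 : ℝ) ≤ c := c.2
  have hψ : ApproximatesLinearOn (fun u => A.symm (H u)) (ContinuousLinearMap.id ℝ (Eu n))
      (Metric.ball 0 2) (K * c) := by
    intro u hu v hv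
    have h1 := h u hu v hv
    have e : A.symm (H u) - A.symm (H v) - ContinuousLinearMap.id ℝ (Eu n) (u - v) =
        (A.symm : Eu n →L[ℝ] Eu n) (H u - H v - (A : Eu n →L[ℝ] Eu n) (u - v)) := by
      simp
    rw [e, NNReal.coe_mul, mul_assoc]
    refine ((A.symm : Eu n →L[ℝ] Eu n).le_opNorm _).trans ?_
    rw [hK, coe_nnnorm]
    gcongr
  have hψ0 : A.symm (H 0) = 0 := by rw [h0, map_zero]
  have h5 : 5 * ((K * c : NNReal) : ℝ) < 1 := by rw [hKc]; exact hc
  have h3 : 3 * ((K * c : NNReal) : ℝ) < 1 := by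
    have : (0 : ℝ) ≤ (K * c : NNReal) := (K * c).2
    linarith
  have hne : ∀ u : Eu n, ‖u‖ = 1 → H u ≠ 0 := by
    intro u hu hz
    have h1 := hψ u (by rw [mem_ball_zero_iff]; linarith) 0 (by simp)
    simp only [hz, h0, map_zero, sub_zero, ContinuousLinearMap.id_apply, zero_sub, norm_neg,
      hu] at h1
    linarith
  have hfd : ∀ u : Eu n, ‖u‖ = 1 →
      (fderiv ℝ (radialExt fun u => ‖H u‖⁻¹ • H u) u).det ≠ 0 ∧
        SignType.sign (fderiv ℝ (radialExt fun u => ‖H u‖⁻¹ • H u) u).det =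
          SignType.sign (A : Eu n →L[ℝ] Eu n).det := by
    intro u hu
    have hdiff : HasFDerivAt H (fderiv ℝ H u) u :=
      ((hd u hu).1.differentiableAt (by norm_num)).hasFDerivAt
    have hfd := (hasFDerivAt_radial hu hdiff (hne u hu)).fderiv
    have hpos : 0 < ‖H u‖⁻¹ := inv_pos.2 (norm_pos_iff.2 (hne u hu))
    unfold radialExt
    rw [hfd, ContinuousLinearMap.det_smul_comp_shear _ _ _ _ (by simp [hu])]
    -- This operator agrees with `D H_u` orthogonally to `u` and sends `u` to `H u`. Its distance to
    -- `A` is at most `c` from the differential plus `2c` from the rank one term, hence the `3 * c`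
    -- in `hA`.
    have hQ := hA (fderiv ℝ H u + (innerSL ℝ u).smulRight (H u - fderiv ℝ H u u)) (by
      have e : fderiv ℝ H u + (innerSL ℝ u).smulRight (H u - fderiv ℝ H u u) - A =
          (fderiv ℝ H u - A) + (innerSL ℝ u).smulRight (H u - fderiv ℝ H u u) := by abel
      rw [e]
      refine (norm_add_le _ _).trans ?_
      have h1 : ‖H u - fderiv ℝ H u u‖ ≤ c + c := by
        have e2 : H u - fderiv ℝ H u u =
            (H u - H 0 - (A : Eu n →L[ℝ] Eu n) (u - 0)) - (fderiv ℝ H u - A) u := by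
          rw [h0]; simp
        rw [e2]
        refine (norm_sub_le _ _).trans (add_le_add ?_ ?_)
        · have := h u (by rw [mem_ball_zero_iff]; linarith) 0 (by simp)
          simpa [hu] using this
        · have := (fderiv ℝ H u - A).le_opNorm u
          rw [hu, mul_one] at this
          exact this.trans (hd u hu).2
      have h2 : ‖(innerSL ℝ u).smulRight (H u - fderiv ℝ H u u)‖ ≤ c + c := by
        rw [ContinuousLinearMap.norm_smulRight_apply, innerSL_apply_norm, hu, one_mul]
        exact h1
      linarith [(hd u hu).2])
    refine ⟨mul_ne_zero (pow_ne_zero _ hpos.ne') hQ.1, ?_⟩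
    rw [sign_mul, sign_pos (pow_pos hpos _), one_mul, hQ.2]
  have hreg : ∀ y : Eu n, ‖y‖ = 1 → IsRegularValue (fun u => ‖H u‖⁻¹ • H u) y :=
    fun y hy => ⟨hy, fun u hu => (hfd u hu.1).1⟩
  refine ⟨fun u hu => ⟨?_, ?_⟩, ?_, ?_⟩
  · rw [norm_smul, norm_inv, norm_norm, inv_mul_cancel₀ (norm_ne_zero_iff.2 (hne u hu))]
  · unfold radialExt
    have hu0 : u ≠ 0 := by rintro rfl; simp at hu
    have huu : ‖u‖⁻¹ • u = u := by simp [hu]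
    have hnorm : ContDiffAt ℝ 1 (fun v : Eu n => ‖v‖) u := contDiffAt_norm ℝ hu0
    have hs : ContDiffAt ℝ 1 (fun v : Eu n => ‖v‖⁻¹ • v) u :=
      (hnorm.inv (norm_ne_zero_iff.2 hu0)).smul contDiffAt_id
    have hHs : ContDiffAt ℝ 1 (fun v : Eu n => H (‖v‖⁻¹ • v)) u :=
      ContDiffAt.comp u (by rw [huu]; exact (hd u hu).1) hs
    have hne' : H (‖u‖⁻¹ • u) ≠ 0 := by rw [huu]; exact hne u hu
    exact hnorm.smul (((hHs.norm ℝ hne').inv (norm_ne_zero_iff.2 hne')).smul hHs)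
  · have : Nontrivial (Eu n) := by
      have : NeZero n := ⟨by omega⟩
      infer_instance
    obtain ⟨y, hy⟩ := exists_norm_eq (Eu n) zero_le_one
    exact ⟨y, hreg y hy⟩
  · intro y hy
    have hy0 : y ≠ 0 := by
      rintro rfl
      have := hy.1
      simp at this
    have hAy : A.symm y ≠ 0 := by simpa using hy0
    obtain ⟨u, hu, t, ht, hut⟩ := hψ.exists_map_eq_smul h5 hψ0 hAy
    have hHu : H u = t • y := by
      apply A.symm.injective
      rw [map_smul]
      exact hut
    have hpre : spherePreimage (fun u => ‖H u‖⁻¹ • H u) y = {u} := by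
      ext v
      simp only [spherePreimage, mem_ofPred_eq, mem_singleton_iff]
      constructor
      · rintro ⟨hv, hvy⟩
        have hpos : 0 < ‖H v‖ := norm_pos_iff.2 (hne v hv)
        refine hψ.eq_of_map_eq_smul h3 hψ0 hv hu (t := ‖H v‖ * t⁻¹) (by positivity) ?_
        rw [hHu, ← hvy, map_smul, map_smul, smul_smul, smul_smul]
        field_simp
        simp
      · rintro rfl
        refine ⟨hu, ?_⟩
        rw [hHu, norm_smul, hy.1, mul_one, Real.norm_of_nonneg ht.le, smul_smul,
          inv_mul_cancel₀ ht.ne', one_smul]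
    rw [hpre]
    refine ⟨finite_singleton u, ?_⟩
    rw [finsum_mem_singleton, (hfd u hu).2]

/-- The index of a non-degenerate fixed point. -/
theorem hasIndex_of_det_ne_zero {n : ℕ} (hn : 1 ≤ n) {f : Eu n → Eu n} {p : Eu n} (hp : f p = p)
    (hf : ContDiffAt ℝ 1 f p)
    (hdet : (ContinuousLinearMap.id ℝ (Eu n) - fderiv ℝ f p).det ≠ 0) :
    HasIndex f p
      (SignType.sign (ContinuousLinearMap.id ℝ (Eu n) - fderiv ℝ f p).det : ℤ) := by
  set h : Eu n → Eu n := fun z => z - f z with hh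
  have hhc : ContDiffAt ℝ 1 h p := contDiffAt_id.sub hf
  have hfd : fderiv ℝ h p = ContinuousLinearMap.id ℝ (Eu n) - fderiv ℝ f p := by
    rw [hh, fderiv_fun_sub differentiableAt_fun_id (hf.differentiableAt (by norm_num)),
      fderiv_fun_id]
  rw [← hfd] at hdet ⊢
  let A : Eu n ≃L[ℝ] Eu n := (fderiv ℝ h p).toContinuousLinearEquivOfDetNeZero hdet
  have hAe : (A : Eu n →L[ℝ] Eu n) = fderiv ℝ h p :=
    ContinuousLinearMap.coe_toContinuousLinearEquivOfDetNeZero _ hdet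
  obtain ⟨δ, hδ, hδA⟩ := Metric.eventually_nhds_iff.1
    ((A : Eu n →L[ℝ] Eu n).eventually_sign_det_eq (by rwa [hAe]))
  set N := ‖(A.symm : Eu n →L[ℝ] Eu n)‖ with hN
  have hN0 : 0 ≤ N := norm_nonneg _
  -- The first bound makes the sphere map bijective, the second keeps the sign of the determinant.
  obtain ⟨c, hc0, hc1, hc2⟩ : ∃ c : NNReal, 0 < c ∧ 5 * (N * c) < 1 ∧ 3 * (c : ℝ) < δ := by
    have hpos : 0 < min (1 / (10 * (N + 1))) (δ / 4) := by positivity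
    refine ⟨(min (1 / (10 * (N + 1))) (δ / 4)).toNNReal, Real.toNNReal_pos.2 hpos, ?_, ?_⟩
    · rw [Real.coe_toNNReal _ hpos.le]
      have h1 : N * min (1 / (10 * (N + 1))) (δ / 4) ≤ N * (1 / (10 * (N + 1))) := by
        gcongr; exact min_le_left _ _
      have h2 : N * (1 / (10 * (N + 1))) ≤ 1 / 10 := by
        rw [mul_one_div, div_le_div_iff₀ (by positivity) (by norm_num)]
        nlinarith
      linarith
    · rw [Real.coe_toNNReal _ hpos.le]
      have := min_le_right (1 / (10 * (N + 1))) (δ / 4)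
      linarith
  have hstrict : HasStrictFDerivAt h (A : Eu n →L[ℝ] Eu n) p := by
    rw [hAe]; exact hhc.hasStrictFDerivAt (by norm_num)
  obtain ⟨s, hs, happ⟩ := hstrict.approximates_deriv_on_nhds (c := c) (Or.inr hc0)
  have hcont : ContinuousAt (fderiv ℝ h) p := hhc.continuousAt_fderiv (by norm_num)
  have hev : ∀ᶠ z in 𝓝 p, z ∈ s ∧ ContDiffAt ℝ 1 h z ∧ ‖fderiv ℝ h z - A‖ ≤ c := by
    refine (eventually_mem_set.2 hs).and ((hhc.eventually (by simp)).and ?_)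
    rw [hAe]
    have := hcont.eventually (Metric.closedBall_mem_nhds _ (NNReal.coe_pos.2 hc0))
    filter_upwards [this] with z hz
    rwa [dist_eq_norm] at hz
  obtain ⟨ρ, hρ, hball⟩ := Metric.eventually_nhds_iff.1 hev
  rw [HasIndex, eventually_nhdsWithin_iff]
  filter_upwards [gt_mem_nhds (half_pos hρ)] with r hr hr0
  have hr0 : 0 < r := hr0
  have hin : ∀ u ∈ Metric.ball (0 : Eu n) 2, dist (p + r • u) p < ρ := by
    intro u hu
    rw [mem_ball_zero_iff] at hu
    rw [dist_eq_norm, add_sub_cancel_left, norm_smul, Real.norm_of_nonneg hr0.le]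
    nlinarith
  -- Blowing up the sphere of radius `r` to the unit sphere leaves differentials, and hence the
  -- constant `c`, unchanged.
  set H : Eu n → Eu n := fun u => r⁻¹ • h (p + r • u) with hH
  have hmap : indexMap f p r = fun u => ‖H u‖⁻¹ • H u := by
    funext u
    simp only [indexMap, hH, hh, norm_smul, norm_inv, Real.norm_of_nonneg hr0.le, mul_inv,
      inv_inv, smul_smul]
    rw [mul_comm r, mul_assoc, mul_inv_cancel₀ hr0.ne', mul_one]
  rw [hmap, ← hAe]
  refine hasSphereDegree_of_approximatesLinearOn hn A (c := c) hc1 ?_ ?_ ?_ ?_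
  · intro Q hQ
    exact hδA (by rw [dist_eq_norm]; linarith)
  · intro u hu v hv
    have h1 := happ _ (hball (hin u hu)).1 _ (hball (hin v hv)).1
    have e1 : p + r • u - (p + r • v) = r • (u - v) := by module
    have e2 : H u - H v - (A : Eu n →L[ℝ] Eu n) (u - v) = r⁻¹ •
        (h (p + r • u) - h (p + r • v) - (A : Eu n →L[ℝ] Eu n) (p + r • u - (p + r • v))) := by
      rw [e1, map_smul, smul_sub, smul_sub, smul_smul, inv_mul_cancel₀ hr0.ne', one_smul]
    rw [e2, norm_smul, norm_inv, Real.norm_of_nonneg hr0.le]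
    rw [e1, norm_smul, Real.norm_of_nonneg hr0.le, ← e1] at h1
    calc _ ≤ r⁻¹ * (c * (r * ‖u - v‖)) := by gcongr
      _ = c * ‖u - v‖ := by field_simp
  · simp [hH, hh, hp]
  · intro u hu
    have hu2 : u ∈ Metric.ball (0 : Eu n) 2 := by rw [mem_ball_zero_iff]; linarith
    obtain ⟨-, hd1, hd2⟩ := hball (hin u hu2)
    have haff : ContDiffAt ℝ 1 (fun u : Eu n => p + r • u) u := by fun_prop
    refine ⟨(hd1.comp u haff).const_smul r⁻¹, ?_⟩
    have hdf : HasFDerivAt (fun u : Eu n => p + r • u) (r • ContinuousLinearMap.id ℝ (Eu n)) u :=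
      ((hasFDerivAt_id u).const_smul r).const_add p
    have hfH : fderiv ℝ H u = fderiv ℝ h (p + r • u) := by
      have h6 := (((hd1.differentiableAt (by norm_num)).hasFDerivAt).comp u hdf).const_smul r⁻¹
      refine (HasFDerivAt.fderiv h6).trans ?_
      ext1 w
      simp [smul_smul, inv_mul_cancel₀ hr0.ne']
    rw [hfH]
    exact hd2

end IteratedIndex

/-! ### The Jacobian determinant as a null Lagrangian. -/

section NullLagrangian

open MeasureTheory

variable {E : Type*} [NormedAddCommGroup E] [NormedSpace ℝ E] [FiniteDimensional ℝ E]

/-- The determinant is a fixed linear combination of the determinants of finitely many shifts. -/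
theorem ContinuousLinearMap.det_eq_sum_det_one_add_smul (E : Type*) [NormedAddCommGroup E]
    [NormedSpace ℝ E] [FiniteDimensional ℝ E] {b : ℝ} (hb : 0 < b) :
    ∃ (N : ℕ) (s c : Fin N → ℝ), (∀ i, 0 < s i ∧ s i < b) ∧ ∀ A : E →L[ℝ] E,
      A.det = ∑ i, c i * (ContinuousLinearMap.id ℝ E + s i • A).det := by
  set n := Module.finrank ℝ E with hn
  -- The polynomial `t ↦ det (t + A)` has degree `n`, so its value at `0` is interpolated from the
  -- `n + 1` nodes `v i = l + i`. Since `det (v + A) = v^n det (1 + v⁻¹ A)`, the shifts are `s i =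
  -- (v i)⁻¹`, and `l > 1/b` makes them smaller than `b`.
  obtain ⟨l, hl⟩ := exists_nat_gt (1 / b)
  have hl0 : (0 : ℝ) < l := lt_trans (by positivity) hl
  let v : Fin (n + 1) → ℝ := fun i => l + i
  have hv0 : ∀ i, 0 < v i := fun i => by positivity
  have hvinj : Function.Injective v := by
    intro i j hij
    have : (i : ℝ) = j := by simpa [v] using hij
    exact Fin.ext (by exact_mod_cast this)
  refine ⟨n + 1, fun i => (v i)⁻¹,
    fun i => v i ^ n * (Lagrange.basis Finset.univ v i).eval 0, fun i => ⟨inv_pos.2 (hv0 i), ?_⟩, ?_⟩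
  · rw [inv_lt_comm₀ (hv0 i) hb, ← one_div]
    exact hl.trans_le (by simp [v])
  · intro A
    set p := LinearMap.charpoly (-(A : E →ₗ[ℝ] E)) with hp
    have hdeg : p.degree < (Finset.univ : Finset (Fin (n + 1))).card := by
      refine Polynomial.degree_le_natDegree.trans_lt ?_
      rw [hp, LinearMap.charpoly_natDegree]
      simp only [← hn, Finset.card_univ, Fintype.card_fin]
      exact_mod_cast Nat.lt_succ_self n
    have heval : ∀ t, p.eval t = LinearMap.det (t • LinearMap.id + (A : E →ₗ[ℝ] E)) := by
      intro t
      rw [hp, LinearMap.eval_charpoly]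
      congr 1
      ext x
      simp
    have h := Lagrange.eq_interpolate (s := Finset.univ) (v := v) hvinj.injOn hdeg
    have h0 : p.eval 0 = A.det := by
      rw [heval]
      simp [ContinuousLinearMap.det]
    rw [← h0, h, Lagrange.interpolate_apply, Polynomial.eval_finsetSum]
    refine Finset.sum_congr rfl fun i _ => ?_
    rw [Polynomial.eval_mul, Polynomial.eval_C, heval]
    have : v i • LinearMap.id + (A : E →ₗ[ℝ] E) =
        v i • ((ContinuousLinearMap.id ℝ E + (v i)⁻¹ • A : E →L[ℝ] E) : E →ₗ[ℝ] E) := by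
      ext x
      simp [smul_smul, (hv0 i).ne']
    rw [this, LinearMap.det_smul, ContinuousLinearMap.det]
    ring

variable [MeasurableSpace E] [BorelSpace E] (μ : Measure E) [μ.IsAddHaarMeasure]

/-- For small `s > 0` the map `x ↦ x + s u(x)` is a bijection of `E` with positive Jacobian, so the
integral of `det (1 + s Du)` over `V` is the volume of the image of `V`. The bijections from `u` and
`v` agree off `V`, hence have the same image of `V`. Interpolation in `s` recovers `det Du` itself.
-/
theorem integral_det_fderiv_eq_of_hasCompactSupport {u v : E → E} (hu : ContDiff ℝ 1 u)
    (hv : ContDiff ℝ 1 v) (hus : HasCompactSupport u) (hvs : HasCompactSupport v) {V : Set E}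
    (hVm : MeasurableSet V) (hVb : Bornology.IsBounded V) (huv : ∀ x ∉ V, u x = v x) :
    ∫ x in V, (fderiv ℝ u x).det ∂μ = ∫ x in V, (fderiv ℝ v x).det ∂μ := by
  obtain ⟨K, hKu⟩ := hu.lipschitzWith_of_hasCompactSupport hus (by norm_num)
  obtain ⟨K', hKv⟩ := hv.lipschitzWith_of_hasCompactSupport hvs (by norm_num)
  obtain ⟨δ, hδ, hδdet⟩ : ∃ δ > 0, ∀ Q : E →L[ℝ] E, ‖Q‖ < δ →
      0 < (ContinuousLinearMap.id ℝ E + Q).det := by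
    have hc : Continuous fun Q : E →L[ℝ] E => (ContinuousLinearMap.id ℝ E + Q).det :=
      ContinuousLinearMap.continuous_det.comp (continuous_const.add continuous_id)
    have h1 : (0 : ℝ) < (ContinuousLinearMap.id ℝ E + 0).det := by
      rw [add_zero, ContinuousLinearMap.det, ContinuousLinearMap.coe_id, LinearMap.det_id]
      exact one_pos
    obtain ⟨δ, hδ, h⟩ := Metric.eventually_nhds_iff.1 (hc.tendsto 0 |>.eventually (lt_mem_nhds h1))
    exact ⟨δ, hδ, fun Q hQ => h (by simpa using hQ)⟩
  set M : ℝ := K + K' + 1 with hM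
  have hM0 : 0 < M := by positivity
  have hKM : (K : ℝ) ≤ M := by rw [hM]; linarith [K'.2, K'.coe_nonneg]
  have hKM' : (K' : ℝ) ≤ M := by rw [hM]; linarith [K.coe_nonneg]
  have hint : ∀ (s : ℝ) {w : E → E}, ContDiff ℝ 1 w → IntegrableOn
      (fun x => (ContinuousLinearMap.id ℝ E + s • fderiv ℝ w x).det) V μ := by
    intro s w hw
    have hc : Continuous fun x => (ContinuousLinearMap.id ℝ E + s • fderiv ℝ w x).det :=
      ContinuousLinearMap.continuous_det.comp
        (continuous_const.add ((hw.continuous_fderiv (by norm_num)).const_smul s))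
    obtain ⟨R, hR⟩ := hVb.subset_closedBall 0
    exact (hc.continuousOn.integrableOn_compact (isCompact_closedBall 0 R)).mono_set hR
  have hbij : ∀ (s : ℝ) {w : E → E} {k : NNReal}, 0 < s → s * M < 1 → (k : ℝ) ≤ M →
      LipschitzWith k w → Function.Bijective fun x => x + s • w x := by
    intro s w k hs0 hs hk hw
    have happ : ApproximatesLinearOn (fun x => x + s • w x)
        ((ContinuousLinearEquiv.refl ℝ E : E ≃L[ℝ] E) : E →L[ℝ] E) univ (s.toNNReal * k) := by
      intro x _ y _
      have e : x + s • w x - (y + s • w y) -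
          ((ContinuousLinearEquiv.refl ℝ E : E ≃L[ℝ] E) : E →L[ℝ] E) (x - y) =
          s • (w x - w y) := by
        simp only [ContinuousLinearEquiv.coe_coe, ContinuousLinearEquiv.coe_refl', id]
        module
      rw [e, norm_smul, Real.norm_of_nonneg hs0.le, NNReal.coe_mul, Real.coe_toNNReal _ hs0.le,
        mul_assoc]
      gcongr
      simpa [dist_eq_norm] using hw.dist_le_mul x y
    have hlt : Subsingleton E ∨ s.toNNReal * k <
        ‖(((ContinuousLinearEquiv.refl ℝ E : E ≃L[ℝ] E).symm : E →L[ℝ] E))‖₊⁻¹ := by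
      rcases subsingleton_or_nontrivial E with h | h
      · exact Or.inl h
      · right
        have : (((ContinuousLinearEquiv.refl ℝ E : E ≃L[ℝ] E).symm : E →L[ℝ] E)) =
          ContinuousLinearMap.id ℝ E := rfl
        rw [this, ContinuousLinearMap.nnnorm_id, inv_one, ← NNReal.coe_lt_coe, NNReal.coe_mul,
          Real.coe_toNNReal _ hs0.le, NNReal.coe_one]
        nlinarith
    exact ⟨injOn_univ.1 (happ.injOn hlt), happ.surjective hlt⟩
  have hvol : ∀ (s : ℝ) {w : E → E} {k : NNReal}, 0 < s → s * M < 1 → s * M < δ → (k : ℝ) ≤ M →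
      ContDiff ℝ 1 w → LipschitzWith k w →
      ∫ x in V, (ContinuousLinearMap.id ℝ E + s • fderiv ℝ w x).det ∂μ =
        μ.real ((fun x => x + s • w x) '' V) := by
    intro s w k hs0 hs hsδ hk hwc hw
    have hd : ∀ x ∈ V, HasFDerivWithinAt (fun x => x + s • w x)
        (ContinuousLinearMap.id ℝ E + s • fderiv ℝ w x) V x := fun x _ =>
      ((hasFDerivAt_id x).add
        (((hwc.differentiable (by norm_num)) x).hasFDerivAt.const_smul s)).hasFDerivWithinAt
    have h := integral_image_eq_integral_abs_det_fderiv_smul μ hVm hd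
      (hbij s hs0 hs hk hw).injective.injOn (fun _ => (1 : ℝ))
    rw [setIntegral_const, smul_eq_mul, mul_one] at h
    rw [h]
    refine setIntegral_congr_fun hVm fun x _ => ?_
    have hpos : 0 < (ContinuousLinearMap.id ℝ E + s • fderiv ℝ w x).det := by
      apply hδdet
      rw [norm_smul, Real.norm_of_nonneg hs0.le]
      have : ‖fderiv ℝ w x‖ ≤ k := norm_fderiv_le_of_lipschitz ℝ hw
      nlinarith
    simp [abs_of_pos hpos]
  have himg : ∀ s : ℝ, 0 < s → s * M < 1 →
      (fun x => x + s • u x) '' V = (fun x => x + s • v x) '' V := by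
    intro s hs0 hs
    have h1 := hbij s hs0 hs hKM hKu
    have h2 := hbij s hs0 hs hKM' hKv
    have e : (fun x => x + s • u x) '' Vᶜ = (fun x => x + s • v x) '' Vᶜ :=
      image_congr fun x hx => by rw [huv x hx]
    rw [image_compl_eq h1, image_compl_eq h2] at e
    exact compl_injective e
  -- Below `1/M` the shifted maps are bijective, as `M` bounds both Lipschitz constants; below `δ/M`
  -- their Jacobians are positive.
  obtain ⟨N, s, c, hs, hA⟩ := ContinuousLinearMap.det_eq_sum_det_one_add_smul E
    (b := min (1 / M) (δ / M)) (by positivity)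
  have hexp : ∀ {w : E → E}, ContDiff ℝ 1 w → ∫ x in V, (fderiv ℝ w x).det ∂μ =
      ∑ i, c i * ∫ x in V, (ContinuousLinearMap.id ℝ E + s i • fderiv ℝ w x).det ∂μ := by
    intro w hw
    rw [setIntegral_congr_fun hVm fun x _ => hA (fderiv ℝ w x),
      integral_finsetSum _ fun i _ => (hint (s i) hw).const_mul (c i)]
    exact Finset.sum_congr rfl fun i _ => integral_const_mul _ _
  rw [hexp hu, hexp hv]
  refine Finset.sum_congr rfl fun i _ => ?_
  have h1 : s i * M < 1 := by
    have := (hs i).2.trans_le (min_le_left _ _)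
    rwa [lt_div_iff₀ hM0] at this
  have h2 : s i * M < δ := by
    have := (hs i).2.trans_le (min_le_right _ _)
    rwa [lt_div_iff₀ hM0] at this
  rw [hvol (s i) (hs i).1 h1 h2 hKM hu hKu, hvol (s i) (hs i).1 h1 h2 hKM' hv hKv,
    himg (s i) (hs i).1 h1]

/-- The determinant is a null Lagrangian: its integral only depends on the boundary values. -/
theorem integral_det_fderiv_eq {u v : E → E} (hu : ContDiff ℝ 1 u) (hv : ContDiff ℝ 1 v)
    {V : Set E} (hVo : IsOpen V) (hVb : Bornology.IsBounded V) (huv : ∀ x ∉ V, u x = v x) :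
    ∫ x in V, (fderiv ℝ u x).det ∂μ = ∫ x in V, (fderiv ℝ v x).det ∂μ := by
  obtain ⟨R, hR0, hR⟩ := hVb.subset_closedBall_lt 0 (0 : E)
  let χ : ContDiffBump (0 : E) := ⟨R, R + 1, hR0, by linarith⟩
  have hχ : ∀ x ∈ V, (χ : E → ℝ) =ᶠ[𝓝 x] 1 := by
    intro x hx
    filter_upwards [hVo.mem_nhds hx] with y hy
    exact χ.one_of_mem_closedBall (hR hy)
  have hfd : ∀ w : E → E, ∀ x ∈ V, fderiv ℝ (fun x => χ x • w x) x = fderiv ℝ w x := by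
    intro w x hx
    refine Filter.EventuallyEq.fderiv_eq ?_
    filter_upwards [hχ x hx] with y hy
    simp [hy]
  have hcd : ∀ {w : E → E}, ContDiff ℝ 1 w → ContDiff ℝ 1 fun x => χ x • w x :=
    fun hw => χ.contDiff.smul hw
  have h := integral_det_fderiv_eq_of_hasCompactSupport μ (hcd hu) (hcd hv)
    χ.hasCompactSupport.smul_right χ.hasCompactSupport.smul_right hVo.measurableSet hVb
    fun x hx => by rw [huv x hx]
  have hI : ∀ w : E → E, ∫ x in V, (fderiv ℝ (fun x => χ x • w x) x).det ∂μ =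
      ∫ x in V, (fderiv ℝ w x).det ∂μ := fun w =>
    setIntegral_congr_fun hVo.measurableSet fun x hx => by simp only [hfd w x hx]
  rwa [hI, hI] at h

end NullLagrangian

/-! ### Isolated zeros and their signed count as an integral. -/

section Isolated

/-- In a compact set, isolated zeros are finitely many. -/
theorem IsCompact.finite_zeros {X Y : Type*} [TopologicalSpace X] [TopologicalSpace Y] [T1Space Y]
    {K : Set X} (hK : IsCompact K) {h : X → Y} {y : Y} (hc : ContinuousOn h K)
    (hi : ∀ x ∈ K, h x = y → ∀ᶠ z in 𝓝[≠] x, z ∈ K → h z ≠ y) : {x ∈ K | h x = y}.Finite := by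
  by_contra hinf
  obtain ⟨x, hxK, hx⟩ := Set.Infinite.exists_accPt_of_subset_isCompact hinf hK (sep_subset _ _)
  rw [accPt_iff_frequently_nhdsNE] at hx
  by_cases h0 : h x = y
  · obtain ⟨z, hz, hz'⟩ := (hx.and_eventually (hi x hxK h0)).exists
    exact hz' hz.1 hz.2
  · have h1 := (hc x hxK).eventually (isOpen_ne.mem_nhds h0)
    rw [eventually_nhdsWithin_iff] at h1
    obtain ⟨z, hz, hz'⟩ := (hx.and_eventually (h1.filter_mono nhdsWithin_le_nhds)).exists
    exact hz' hz.1 hz.2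

variable {E : Type*} [NormedAddCommGroup E] [NormedSpace ℝ E] [FiniteDimensional ℝ E]

theorem ContDiffAt.exists_isOpen_injOn_of_det_ne_zero {h : E → E} {z : E}
    (hh : ContDiffAt ℝ 1 h z) (hd : (fderiv ℝ h z).det ≠ 0) :
    ∃ W : Set E, IsOpen W ∧ z ∈ W ∧ InjOn h W ∧
      ∀ U ⊆ W, IsOpen U → IsOpen (h '' U) := by
  have hs := hh.hasStrictFDerivAt (by norm_num)
  rw [← ContinuousLinearMap.coe_toContinuousLinearEquivOfDetNeZero (fderiv ℝ h z) hd] at hs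
  refine ⟨(hs.toOpenPartialHomeomorph h).source, (hs.toOpenPartialHomeomorph h).open_source,
    hs.mem_toOpenPartialHomeomorph_source, (hs.toOpenPartialHomeomorph h).injOn, fun U hU hUo => ?_⟩
  exact (hs.toOpenPartialHomeomorph h).isOpen_image_of_subset_source hUo hU

theorem ContDiffAt.eventually_ne_of_det_ne_zero {h : E → E} {z : E}
    (hh : ContDiffAt ℝ 1 h z) (hd : (fderiv ℝ h z).det ≠ 0) :
    ∀ᶠ x in 𝓝[≠] z, h x ≠ h z := by
  obtain ⟨W, hWo, hzW, hinj, -⟩ := hh.exists_isOpen_injOn_of_det_ne_zero hd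
  rw [eventually_nhdsWithin_iff]
  filter_upwards [hWo.mem_nhds hzW] with x hx hxz he
  exact hxz (hinj hx hzW he)

end Isolated

/-- The number of zeros of `h` in `V`, counted with the signs of the Jacobian determinants. -/
noncomputable def signedCount {E : Type*} [NormedAddCommGroup E] [NormedSpace ℝ E] (h : E → E)
    (V : Set E) : ℤ :=
  ∑ᶠ z ∈ {z ∈ V | h z = 0}, (SignType.sign (fderiv ℝ h z).det : ℤ)

theorem signedCount_congr {E : Type*} [NormedAddCommGroup E] [NormedSpace ℝ E] {h k : E → E}
    {V : Set E} (hk : ∀ z ∈ V, h =ᶠ[𝓝 z] k) : signedCount h V = signedCount k V := by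
  have e : {z ∈ V | h z = 0} = {z ∈ V | k z = 0} := by
    ext z
    exact and_congr_right fun hz => by rw [(hk z hz).self_of_nhds]
  unfold signedCount
  rw [e]
  exact finsum_mem_congr rfl fun z hz => by rw [(hk z hz.1).fderiv_eq]

section Count

open MeasureTheory

variable {E : Type*} [NormedAddCommGroup E] [NormedSpace ℝ E] [FiniteDimensional ℝ E]
  [MeasurableSpace E] [BorelSpace E] (μ : Measure E) [μ.IsAddHaarMeasure]

/-- Around each zero, `h` is injective on a neighbourhood on which the sign of its Jacobian is
constant, and the change of variables there yields that sign times `∫ ρ`. Outside these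
neighbourhoods `‖h‖` is bounded below, so nothing is left once `ρ` lives close to `0`. -/
theorem exists_integral_comp_mul_det_eq_signedCount {h : E → E} (hh : ContDiff ℝ 1 h) {V : Set E}
    (hVo : IsOpen V) (hVb : Bornology.IsBounded V)
    (hnd : ∀ z ∈ V, h z = 0 → (fderiv ℝ h z).det ≠ 0) (hfr : ∀ z ∈ closure V, h z = 0 → z ∈ V) :
    ∃ δ > 0, ∀ ρ : E → ℝ, Continuous ρ → (∀ y, ρ y ≠ 0 → ‖y‖ < δ) →
      ∫ x in V, ρ (h x) * (fderiv ℝ h x).det ∂μ = signedCount h V * ∫ y, ρ y ∂μ := by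
  classical
  have hK : IsCompact (closure V) := hVb.isCompact_closure
  have hcd : Continuous fun x => (fderiv ℝ h x).det :=
    ContinuousLinearMap.continuous_det.comp (hh.continuous_fderiv (by norm_num))
  have hZfin : {z ∈ V | h z = 0}.Finite := by
    refine (hK.finite_zeros (y := 0) hh.continuous.continuousOn ?_).subset
      fun z hz => ⟨subset_closure hz.1, hz.2⟩
    intro z hz h0
    have := (hh.contDiffAt (x := z)).eventually_ne_of_det_ne_zero (hnd z (hfr z hz h0) h0)
    filter_upwards [this] with x hx _
    rwa [h0] at hx
  obtain ⟨U, hU, hUd⟩ := hZfin.t2_separation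
  have hloc : ∀ z : E, ∃ W : Set E, IsOpen W ∧ W ⊆ U z ∧ (z ∈ {z ∈ V | h z = 0} →
      z ∈ W ∧ W ⊆ V ∧ InjOn h W ∧ IsOpen (h '' W) ∧
      ∀ x ∈ W, SignType.sign (fderiv ℝ h x).det = SignType.sign (fderiv ℝ h z).det) := by
    intro z
    by_cases hz : z ∈ {z ∈ V | h z = 0}
    · obtain ⟨W, hWo, hzW, hinj, himg⟩ :=
        (hh.contDiffAt (x := z)).exists_isOpen_injOn_of_det_ne_zero (hnd z hz.1 hz.2)
      have hev := ((hh.continuous_fderiv (by norm_num)).tendsto z).eventually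
        ((fderiv ℝ h z).eventually_sign_det_eq (hnd z hz.1 hz.2))
      obtain ⟨S, hS, hSo, hzS⟩ := eventually_nhds_iff.1 hev
      have hsub : U z ∩ (V ∩ (W ∩ S)) ⊆ W := fun x hx => hx.2.2.1
      have ho : IsOpen (U z ∩ (V ∩ (W ∩ S))) := (hU z).2.inter (hVo.inter (hWo.inter hSo))
      exact ⟨U z ∩ (V ∩ (W ∩ S)), ho, inter_subset_left, fun _ =>
        ⟨⟨(hU z).1, hz.1, hzW, hzS⟩, fun x hx => hx.2.1, hinj.mono hsub, himg _ hsub ho,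
          fun x hx => (hS x hx.2.2.2).2⟩⟩
    · exact ⟨∅, isOpen_empty, empty_subset _, fun h => absurd h hz⟩
  choose W hWo hWU hW using hloc
  have hδz : ∀ z : E, ∃ δ > 0, z ∈ {z ∈ V | h z = 0} → Metric.ball 0 δ ⊆ h '' W z := by
    intro z
    by_cases hz : z ∈ {z ∈ V | h z = 0}
    · obtain ⟨δ, hδ, hb⟩ := Metric.isOpen_iff.1 (hW z hz).2.2.2.1 0 ⟨z, (hW z hz).1, hz.2⟩
      exact ⟨δ, hδ, fun _ => hb⟩
    · exact ⟨1, one_pos, fun h => absurd h hz⟩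
  choose δz hδz hδb using hδz
  have hrest : ∃ δ > 0, ∀ x ∈ closure V \ ⋃ z ∈ hZfin.toFinset, W z, δ ≤ ‖h x‖ := by
    have hcomp : IsCompact (closure V \ ⋃ z ∈ hZfin.toFinset, W z) :=
      hK.diff (isOpen_biUnion fun z _ => hWo z)
    rcases (closure V \ ⋃ z ∈ hZfin.toFinset, W z).eq_empty_or_nonempty with he | hne
    · exact ⟨1, one_pos, fun x hx => by rw [he] at hx; exact absurd hx (notMem_empty x)⟩
    · obtain ⟨x₀, hx₀, hmin⟩ := hcomp.exists_isMinOn hne (hh.continuous.norm.continuousOn)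
      refine ⟨‖h x₀‖, norm_pos_iff.2 fun h0 => hx₀.2 ?_, fun x hx => hmin hx⟩
      have hz : x₀ ∈ {z ∈ V | h z = 0} := ⟨hfr x₀ hx₀.1 h0, h0⟩
      exact mem_biUnion (hZfin.mem_toFinset.2 hz) (hW x₀ hz).1
  obtain ⟨δ', hδ', hrest⟩ := hrest
  obtain ⟨δ, hδ, hδle⟩ : ∃ δ > 0, δ ≤ δ' ∧ ∀ z ∈ hZfin.toFinset, δ ≤ δz z := by
    rcases hZfin.toFinset.eq_empty_or_nonempty with he | hne
    · exact ⟨δ', hδ', le_rfl, by simp [he]⟩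
    · obtain ⟨z₀, hz₀, hmin⟩ := hZfin.toFinset.exists_min_image δz hne
      exact ⟨min δ' (δz z₀), lt_min hδ' (hδz z₀), min_le_left _ _,
        fun z hz => (min_le_right _ _).trans (hmin z hz)⟩
  refine ⟨δ, hδ, fun ρ hρ hsupp => ?_⟩
  set F : E → ℝ := fun x => ρ (h x) * (fderiv ℝ h x).det with hF
  have hFc : Continuous F := (hρ.comp hh.continuous).mul hcd
  have hFint : IntegrableOn F V μ :=
    (hFc.continuousOn.integrableOn_compact hK).mono_set subset_closure
  have hsubV : (⋃ z ∈ hZfin.toFinset, W z) ⊆ V :=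
    iUnion₂_subset fun z hz => (hW z (hZfin.mem_toFinset.1 hz)).2.1
  have h1 : ∫ x in V, F x ∂μ = ∫ x in ⋃ z ∈ hZfin.toFinset, W z, F x ∂μ := by
    refine setIntegral_eq_of_subset_of_forall_sdiff_eq_zero hVo.measurableSet hsubV ?_
    intro x hx
    have h2 := hrest x ⟨subset_closure hx.1, hx.2⟩
    have : ρ (h x) = 0 := by
      by_contra hne
      have := hsupp _ hne
      linarith [hδle.1]
    simp [hF, this]
  have hdisj : Set.Pairwise (hZfin.toFinset : Set E) (Function.onFun Disjoint W) := by
    intro z hz w hw hne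
    exact (hUd (by simpa using hz) (by simpa using hw) hne).mono (hWU z) (hWU w)
  rw [h1, integral_biUnion_finset _ (fun z _ => (hWo z).measurableSet) hdisj
    fun z hz => hFint.mono_set (hW z (hZfin.mem_toFinset.1 hz)).2.1]
  have hsum : signedCount h V = ∑ z ∈ hZfin.toFinset, (SignType.sign (fderiv ℝ h z).det : ℤ) :=
    finsum_mem_eq_finite_toFinset_sum _ hZfin
  rw [hsum]
  push_cast
  rw [Finset.sum_mul]
  refine Finset.sum_congr rfl fun z hz => ?_
  have hzZ := hZfin.mem_toFinset.1 hz
  obtain ⟨hzW, hWV, hinj, himg, hsign⟩ := hW z hzZ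
  have h3 := integral_image_eq_integral_abs_det_fderiv_smul μ (hWo z).measurableSet
    (fun x _ => (((hh.differentiable (by norm_num)) x).hasFDerivAt).hasFDerivWithinAt) hinj ρ
  have h4 : ∫ y in h '' W z, ρ y ∂μ = ∫ y, ρ y ∂μ := by
    refine setIntegral_eq_integral_of_forall_compl_eq_zero fun y hy => ?_
    by_contra hne
    refine hy (hδb z hzZ ?_)
    rw [mem_ball_zero_iff]
    exact (hsupp y hne).trans_le (hδle.2 z hz)
  rw [← h4, h3, ← integral_const_mul]
  refine setIntegral_congr_fun (hWo z).measurableSet fun x hx => ?_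
  simp only [hF, smul_eq_mul]
  rw [← hsign x hx, mul_comm (ρ (h x)), ← mul_assoc]
  congr 1
  rcases lt_trichotomy (fderiv ℝ h x).det 0 with hd | hd | hd
  · simp [sign_neg hd, abs_of_neg hd]
  · simp [hd]
  · simp [sign_pos hd, abs_of_pos hd]

end Count

/-! ### Homotopy invariance of the signed count. -/

section Degree

open MeasureTheory

/-- There are maps `Φ` of `ℝⁿ` whose Jacobian determinant is a bump function with arbitrarily small
support. -/
theorem exists_contDiff_det_fderiv_bump (n : ℕ) {δ : ℝ} (hδ : 0 < δ) :
    ∃ Φ : Eu n → Eu n, ContDiff ℝ 1 Φ ∧ Continuous (fun y => (fderiv ℝ Φ y).det) ∧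
      (∀ y, (fderiv ℝ Φ y).det ≠ 0 → ‖y‖ < δ) ∧ 0 < ∫ y, (fderiv ℝ Φ y).det := by
  -- `Φ` applies one smooth step of width `η` in every coordinate, so its Jacobian is a product
  -- supported in `[0, η]^n`. This cube lies in the ball of radius `δ` because `n η² < δ²`.
  set η : ℝ := δ / (n + 1) with hη
  have hη0 : 0 < η := by positivity
  set R : ℝ → ℝ := fun s => Real.smoothTransition (s / η) with hR
  have hRc : ContDiff ℝ 1 R := Real.smoothTransition.contDiff.comp (contDiff_id.div_const η)
  have hRm : ∀ s, 0 ≤ deriv R s := by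
    intro s
    refine Monotone.deriv_nonneg fun a b hab => ?_
    exact Real.smoothTransition.monotone (by gcongr)
  have hRs : ∀ s, deriv R s ≠ 0 → 0 ≤ s ∧ s ≤ η := by
    intro s hs
    by_contra hcon
    rw [not_and_or, not_le, not_le] at hcon
    apply hs
    rcases hcon with h | h
    · have : R =ᶠ[𝓝 s] fun _ => 0 := by
        filter_upwards [gt_mem_nhds h] with t ht
        exact Real.smoothTransition.zero_of_nonpos (div_nonpos_of_nonpos_of_nonneg ht.le hη0.le)
      rw [this.deriv_eq, deriv_const]
    · have : R =ᶠ[𝓝 s] fun _ => 1 := by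
        filter_upwards [lt_mem_nhds h] with t ht
        exact Real.smoothTransition.one_of_one_le ((one_le_div hη0).2 ht.le)
      rw [this.deriv_eq, deriv_const]
  obtain ⟨s₀, hs₀⟩ : ∃ s, 0 < deriv R s := by
    obtain ⟨s, -, hs⟩ := exists_deriv_eq_slope R hη0 hRc.continuous.continuousOn
      (hRc.differentiable (by norm_num)).differentiableOn
    refine ⟨s, ?_⟩
    have h1 : R η = 1 := Real.smoothTransition.one_of_one_le (by rw [div_self hη0.ne'])
    have h0 : R 0 = 0 := Real.smoothTransition.zero_of_nonpos (by simp)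
    rw [hs, h1, h0]
    simpa using hη0
  let Φ : Eu n → Eu n := fun y => WithLp.toLp 2 fun i => R (y i)
  have hΦc : ContDiff ℝ 1 Φ := by
    rw [contDiff_euclidean]
    intro i
    exact hRc.comp (contDiff_euclidean.1 contDiff_id i)
  have hdet : ∀ y, (fderiv ℝ Φ y).det = ∏ i, deriv R (y i) := by
    intro y
    let b := (EuclideanSpace.basisFun (Fin n) ℝ).toBasis
    have hentry : ∀ i j, LinearMap.toMatrix b b (fderiv ℝ Φ y : Eu n →ₗ[ℝ] Eu n) i j =
        Matrix.diagonal (fun i => deriv R (y i)) i j := by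
      intro i j
      have hi : HasFDerivAt (fun z : Eu n => Φ z i)
          ((EuclideanSpace.proj i : Eu n →L[ℝ] ℝ) ∘L fderiv ℝ Φ y) y :=
        (EuclideanSpace.proj i : Eu n →L[ℝ] ℝ).hasFDerivAt.comp y
          ((hΦc.differentiable (by norm_num)) y).hasFDerivAt
      have hi' : HasFDerivAt (fun z : Eu n => Φ z i)
          (deriv R (y i) • (EuclideanSpace.proj i : Eu n →L[ℝ] ℝ)) y :=
        HasDerivAt.comp_hasFDerivAt (f := fun z : Eu n => z i) y
          ((hRc.differentiable (by norm_num)) (y i)).hasDerivAt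
          ((EuclideanSpace.proj i : Eu n →L[ℝ] ℝ).hasFDerivAt)
      have he := congrArg (fun L : Eu n →L[ℝ] ℝ => L (b j)) (hi.unique hi')
      rw [LinearMap.toMatrix_apply]
      simp only [b, OrthonormalBasis.coe_toBasis, EuclideanSpace.basisFun_apply,
        ContinuousLinearMap.comp_apply, _root_.smul_apply, smul_eq_mul] at he
      have he' : (fderiv ℝ Φ y (EuclideanSpace.single j 1)) i =
        deriv R (y i) * (EuclideanSpace.single j (1 : ℝ) : Eu n) i := he
      simp only [b, OrthonormalBasis.coe_toBasis, EuclideanSpace.basisFun_apply,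
        OrthonormalBasis.coe_toBasis_repr_apply, EuclideanSpace.basisFun_repr,
        ContinuousLinearMap.coe_coe]
      refine he'.trans ?_
      rw [Matrix.diagonal_apply]
      by_cases hij : i = j <;> simp [hij]
    rw [ContinuousLinearMap.det, ← LinearMap.det_toMatrix b, Matrix.ext hentry,
      Matrix.det_diagonal]
  have hcont : Continuous fun y => (fderiv ℝ Φ y).det :=
    ContinuousLinearMap.continuous_det.comp (hΦc.continuous_fderiv (by norm_num))
  have hsupp : ∀ y, (fderiv ℝ Φ y).det ≠ 0 → ‖y‖ < δ := by
    intro y hy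
    rw [hdet, Finset.prod_ne_zero_iff] at hy
    rw [EuclideanSpace.norm_eq, Real.sqrt_lt' hδ]
    calc ∑ i, ‖y i‖ ^ 2 ≤ ∑ _i : Fin n, η ^ 2 := by
          refine Finset.sum_le_sum fun i hi => ?_
          have := hRs _ (hy i hi)
          rw [Real.norm_of_nonneg this.1]
          exact pow_le_pow_left₀ this.1 this.2 2
      _ = n * η ^ 2 := by simp
      _ < (n + 1) ^ 2 * η ^ 2 := by
          have : (n : ℝ) < (n + 1) ^ 2 := by
            have : (0 : ℝ) ≤ n := Nat.cast_nonneg n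
            nlinarith
          gcongr
      _ = δ ^ 2 := by rw [hη]; field_simp
  refine ⟨Φ, hΦc, hcont, hsupp, ?_⟩
  have hcs : HasCompactSupport fun y => (fderiv ℝ Φ y).det := by
    refine HasCompactSupport.of_support_subset_isCompact (isCompact_closedBall (0 : Eu n) δ) ?_
    intro y hy
    rw [mem_closedBall_zero_iff]
    exact (hsupp y hy).le
  refine hcont.integral_pos_of_hasCompactSupport_nonneg_nonzero hcs (fun y => ?_)
    (x := WithLp.toLp 2 fun _ => s₀) ?_
  · rw [Pi.zero_apply, hdet]
    exact Finset.prod_nonneg fun i _ => hRm _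
  · rw [hdet]
    exact Finset.prod_ne_zero_iff.2 fun i _ => hs₀.ne'

/-- Two maps that agree outside a compact part of an open set have the same signed count of
zeros. -/
theorem signedCount_eq_of_eq_off {n : ℕ} {u v : Eu n → Eu n} (hu : ContDiff ℝ 1 u)
    (hv : ContDiff ℝ 1 v) {V : Set (Eu n)} (hVo : IsOpen V) (hVb : Bornology.IsBounded V)
    (hund : ∀ z ∈ V, u z = 0 → (fderiv ℝ u z).det ≠ 0)
    (hvnd : ∀ z ∈ V, v z = 0 → (fderiv ℝ v z).det ≠ 0)
    (hufr : ∀ z ∈ closure V, u z = 0 → z ∈ V) (hvfr : ∀ z ∈ closure V, v z = 0 → z ∈ V)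
    (huv : ∀ x ∉ V, u x = v x) : signedCount u V = signedCount v V := by
  obtain ⟨δ₁, hδ₁, h₁⟩ := exists_integral_comp_mul_det_eq_signedCount volume hu hVo hVb hund hufr
  obtain ⟨δ₂, hδ₂, h₂⟩ := exists_integral_comp_mul_det_eq_signedCount volume hv hVo hVb hvnd hvfr
  obtain ⟨Φ, hΦ, hΦc, hΦs, hΦi⟩ := exists_contDiff_det_fderiv_bump n (lt_min hδ₁ hδ₂)
  have e₁ := h₁ _ hΦc fun y hy => (hΦs y hy).trans_le (min_le_left _ _)
  have e₂ := h₂ _ hΦc fun y hy => (hΦs y hy).trans_le (min_le_right _ _)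
  have hcomp : ∀ {w : Eu n → Eu n}, ContDiff ℝ 1 w → ∀ x,
      (fderiv ℝ (Φ ∘ w) x).det = (fderiv ℝ Φ (w x)).det * (fderiv ℝ w x).det := by
    intro w hw x
    rw [fderiv_comp x ((hΦ.differentiable (by norm_num)) _) ((hw.differentiable (by norm_num)) _)]
    exact LinearMap.det_comp _ _
  -- With `ρ = det DΦ`, the integrand `ρ(w) det Dw` of the counting formula is the Jacobian of `Φ ∘
  -- w`, whose integral depends only on the values off `V`.
  have hNL := integral_det_fderiv_eq volume (hΦ.comp hu) (hΦ.comp hv) hVo hVb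
    fun x hx => by simp [huv x hx]
  simp only [hcomp hu, hcomp hv] at hNL
  rw [hNL, e₂] at e₁
  have := mul_right_cancel₀ hΦi.ne' e₁
  exact_mod_cast this.symm

/-- Homotopy invariance of the signed count of zeros in a ball. -/
theorem signedCount_eq_of_segment {n : ℕ} {h₀ h₁ : Eu n → Eu n} (hh₀ : ContDiff ℝ 1 h₀)
    (hh₁ : ContDiff ℝ 1 h₁) {p : Eu n} {r : ℝ} (hr : 0 < r)
    (hnd₀ : ∀ z ∈ Metric.ball p r, h₀ z = 0 → (fderiv ℝ h₀ z).det ≠ 0)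
    (hnd₁ : ∀ z ∈ Metric.ball p r, h₁ z = 0 → (fderiv ℝ h₁ z).det ≠ 0)
    (hfr : ∀ z ∈ Metric.closedBall p r, ∀ t ∈ Icc (0 : ℝ) 1, h₁ z + t • (h₀ z - h₁ z) = 0 →
      z ∈ Metric.ball p r) :
    signedCount h₀ (Metric.ball p r) = signedCount h₁ (Metric.ball p r) := by
  have hcomp : IsCompact {q : Eu n × ℝ | q ∈ Metric.closedBall p r ×ˢ Icc (0 : ℝ) 1 ∧
      h₁ q.1 + q.2 • (h₀ q.1 - h₁ q.1) = 0} := by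
    refine ((isCompact_closedBall p r).prod isCompact_Icc).inter_right
      (isClosed_eq ?_ continuous_const)
    have h0 := hh₀.continuous
    have h1 := hh₁.continuous
    fun_prop
  -- By compactness, the zeros of all maps on the segment lie in one smaller ball. This leaves a
  -- collar in which to interpolate.
  obtain ⟨r', hr', hsub⟩ := exists_pos_lt_subset_ball hr (hcomp.image continuous_fst).isClosed
    (s := Prod.fst '' {q : Eu n × ℝ | q ∈ Metric.closedBall p r ×ˢ Icc (0 : ℝ) 1 ∧
      h₁ q.1 + q.2 • (h₀ q.1 - h₁ q.1) = 0}) (x := p) (by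
    rintro _ ⟨q, ⟨⟨hq1, hq2⟩, hq3⟩, rfl⟩
    exact hfr q.1 hq1 q.2 hq2 hq3)
  have hin : ∀ z ∈ Metric.closedBall p r, ∀ t ∈ Icc (0 : ℝ) 1,
      h₁ z + t • (h₀ z - h₁ z) = 0 → z ∈ Metric.ball p r' := fun z hz t ht h =>
    hsub ⟨(z, t), ⟨⟨hz, ht⟩, h⟩, rfl⟩
  let χ : ContDiffBump p := ⟨r', (r' + r) / 2, hr'.1, by linarith [hr'.2]⟩
  -- `u` is `h₀` on the smaller ball and `h₁` off the large one. At each point its value lies on the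
  -- segment, so it has no zeros in the collar: it has the count of `h₀` and can be compared with
  -- `h₁`.
  set u : Eu n → Eu n := fun z => h₁ z + χ z • (h₀ z - h₁ z) with hu
  have huc : ContDiff ℝ 1 u := hh₁.add (χ.contDiff.smul (hh₀.sub hh₁))
  have hloc : ∀ z ∈ Metric.ball p r', u =ᶠ[𝓝 z] h₀ := by
    intro z hz
    filter_upwards [Metric.isOpen_ball.mem_nhds hz] with y hy
    rw [hu]
    simp only [χ.one_of_mem_closedBall (Metric.ball_subset_closedBall hy), one_smul]
    abel
  have huz : ∀ z ∈ Metric.closedBall p r, u z = 0 → z ∈ Metric.ball p r' := fun z hz h =>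
    hin z hz (χ z) ⟨χ.nonneg, χ.le_one⟩ h
  have hh₀z : ∀ z ∈ Metric.closedBall p r, h₀ z = 0 → z ∈ Metric.ball p r' := fun z hz h =>
    hin z hz 1 ⟨zero_le_one, le_rfl⟩ (by rw [one_smul, add_sub_cancel, h])
  have hh₁z : ∀ z ∈ Metric.closedBall p r, h₁ z = 0 → z ∈ Metric.ball p r' := fun z hz h =>
    hin z hz 0 ⟨le_rfl, zero_le_one⟩ (by rw [zero_smul, add_zero, h])
  have hcl : closure (Metric.ball p r) ⊆ Metric.closedBall p r := Metric.closure_ball_subset_closedBall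
  have hrr : Metric.ball p r' ⊆ Metric.ball p r := Metric.ball_subset_ball hr'.2.le
  have hbc : Metric.ball p r ⊆ Metric.closedBall p r := Metric.ball_subset_closedBall
  have e1 : signedCount u (Metric.ball p r) = signedCount h₁ (Metric.ball p r) := by
    refine signedCount_eq_of_eq_off huc hh₁ Metric.isOpen_ball Metric.isBounded_ball ?_ hnd₁
      (fun z hz h => hrr (huz z (hcl hz) h)) (fun z hz h => hrr (hh₁z z (hcl hz) h)) ?_
    · intro z hz h
      have hz' := huz z (hbc hz) h
      rw [(hloc z hz').fderiv_eq]
      exact hnd₀ z hz (by rw [← (hloc z hz').self_of_nhds, h])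
    · intro x hx
      have : χ x = 0 := χ.zero_of_le_dist (by
        rw [Metric.mem_ball, not_lt] at hx
        show (r' + r) / 2 ≤ dist x p
        linarith [hr'.2])
      rw [hu]
      simp only [this, zero_smul, add_zero]
  rw [← e1]
  have e : {z ∈ Metric.ball p r | h₀ z = 0} = {z ∈ Metric.ball p r | u z = 0} := by
    ext z
    refine and_congr_right fun hz => ⟨fun h => ?_, fun h => ?_⟩
    · rw [(hloc z (hh₀z z (hbc hz) h)).self_of_nhds, h]
    · rw [← (hloc z (huz z (hbc hz) h)).self_of_nhds, h]
  unfold signedCount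
  rw [e]
  exact finsum_mem_congr rfl fun z hz => by rw [(hloc z (huz z (hbc hz.1) hz.2)).fderiv_eq]

end Degree

/-! ### The local degree of a continuous map on a ball. -/

section LocalDegree

open MeasureTheory

/-- A map that is `C¹` at the points of a closed ball has a global `C¹` modification. -/
theorem exists_contDiff_eventuallyEq_of_closedBall {E F : Type*} [NormedAddCommGroup E]
    [InnerProductSpace ℝ E] [FiniteDimensional ℝ E] [NormedAddCommGroup F] [NormedSpace ℝ F]
    {h : E → F} {p : E} {r : ℝ} (hr : 0 ≤ r)
    (hh : ∀ z ∈ Metric.closedBall p r, ContDiffAt ℝ 1 h z) :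
    ∃ H : E → F, ContDiff ℝ 1 H ∧ ∀ z ∈ Metric.closedBall p r, H =ᶠ[𝓝 z] h := by
  have hO : IsOpen {z | ContDiffAt ℝ 1 h z} :=
    isOpen_iff_mem_nhds.2 fun z hz => ContDiffAt.eventually hz (by simp)
  obtain ⟨δ, hδ, hsub⟩ := (isCompact_closedBall p r).exists_cthickening_subset_open hO hh
  rw [cthickening_closedBall hδ.le hr] at hsub
  let χ : ContDiffBump p := ⟨r + δ / 3, r + δ / 2, by positivity, by linarith⟩
  refine ⟨fun z => χ z • h z, ?_, ?_⟩
  · rw [contDiff_iff_contDiffAt]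
    intro z
    by_cases hz : z ∈ Metric.closedBall p (δ + r)
    · exact χ.contDiff.contDiffAt.smul (hsub hz)
    · have : (fun z => χ z • h z) =ᶠ[𝓝 z] fun _ => 0 := by
        filter_upwards [Metric.isClosed_closedBall.isOpen_compl.mem_nhds hz] with y hy
        rw [mem_compl_iff, Metric.mem_closedBall, not_le] at hy
        rw [χ.zero_of_le_dist (by show r + δ / 2 ≤ dist y p; linarith), zero_smul]
      exact contDiffAt_const.congr_of_eventuallyEq this
  · intro z hz
    have : z ∈ Metric.ball p (r + δ / 3) := Metric.closedBall_subset_ball (by linarith) hz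
    filter_upwards [Metric.isOpen_ball.mem_nhds this] with y hy
    rw [χ.one_of_mem_closedBall (Metric.ball_subset_closedBall hy), one_smul]

/-- By Sard's theorem, regular values are dense. -/
theorem exists_norm_lt_forall_det_ne_zero {E : Type*} [NormedAddCommGroup E] [NormedSpace ℝ E]
    [FiniteDimensional ℝ E] {h : E → E} {S : Set E} (hh : ∀ z ∈ S, DifferentiableAt ℝ h z)
    {ε : ℝ} (hε : 0 < ε) (a : E) :
    ∃ c, ‖c - a‖ < ε ∧ ∀ z ∈ S, h z = c → (fderiv ℝ h z).det ≠ 0 := by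
  borelize E
  have hnull : (Measure.addHaar : Measure E) (h '' {z ∈ S | (fderiv ℝ h z).det = 0}) = 0 :=
    addHaar_image_eq_zero_of_det_fderivWithin_eq_zero _ (f' := fderiv ℝ h)
      (fun z hz => (hh z hz.1).hasFDerivAt.hasFDerivWithinAt) fun z hz => hz.2
  obtain ⟨c, hc, hc'⟩ := (Measure.dense_of_ae (measure_eq_zero_iff_ae_notMem.1 hnull)).exists_dist_lt
    a hε
  refine ⟨c, by rwa [dist_comm, dist_eq_norm] at hc', fun z hz hzc h0 => hc ⟨z, ⟨hz, h0⟩, hzc⟩⟩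

variable {n : ℕ}

/-- `L` is the local degree at `0` of the continuous map `h` on the ball of radius `r` around `p`:
the signed count of zeros of each small `C¹` approximation with non-degenerate zeros. -/
def IsLocalDegree (h : Eu n → Eu n) (p : Eu n) (r : ℝ) (L : ℤ) : Prop :=
  ∃ δ > 0, ∀ k : Eu n → Eu n, (∀ z ∈ Metric.closedBall p r, ContDiffAt ℝ 1 k z) →
    (∀ z ∈ Metric.closedBall p r, ‖k z - h z‖ < δ) →
    (∀ z ∈ Metric.ball p r, k z = 0 → (fderiv ℝ k z).det ≠ 0) →
    signedCount k (Metric.ball p r) = L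

/-- Tietze extension and smoothing give a `C¹` map within `δ/2`. Subtracting a regular value of norm
below `δ/2`, supplied by Sard, makes all zeros non-degenerate. -/
theorem exists_contDiff_approx_nondegenerate {h : Eu n → Eu n} {p : Eu n} {r : ℝ}
    (hc : ContinuousOn h (Metric.closedBall p r)) {δ : ℝ} (hδ : 0 < δ) :
    ∃ k : Eu n → Eu n, ContDiff ℝ 1 k ∧ (∀ z ∈ Metric.closedBall p r, ‖k z - h z‖ < δ) ∧
      ∀ z, k z = 0 → (fderiv ℝ k z).det ≠ 0 := by
  obtain ⟨H, hH⟩ := ContinuousMap.exists_restrict_eq Metric.isClosed_closedBall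
    (⟨(Metric.closedBall p r).domRestrict h, continuousOn_iff_continuous_domRestrict.1 hc⟩ :
      C(Metric.closedBall p r, Eu n))
  have hH' : ∀ z ∈ Metric.closedBall p r, H z = h z := fun z hz =>
    congrArg (fun F : C(Metric.closedBall p r, Eu n) => F ⟨z, hz⟩) hH
  obtain ⟨g, hg, hgH, -⟩ := H.continuous.exists_contDiff_approx 1
    (ε := fun _ => δ / 2) continuous_const fun _ => half_pos hδ
  obtain ⟨c, hc0, hcd⟩ := exists_norm_lt_forall_det_ne_zero (S := univ)
    (fun z _ => (hg.differentiable (by norm_num)) z) (half_pos hδ) 0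
  refine ⟨fun z => g z - c, hg.sub contDiff_const, fun z hz => ?_, fun z hz => ?_⟩
  · have h1 := hgH z
    rw [hH' z hz, dist_eq_norm] at h1
    rw [sub_zero] at hc0
    calc ‖g z - c - h z‖ = ‖(g z - h z) - c‖ := by congr 1; abel
      _ ≤ ‖g z - h z‖ + ‖c‖ := norm_sub_le _ _
      _ < δ := by linarith
  · rw [fderiv_sub_const]
    exact hcd z (mem_univ z) (sub_eq_zero.1 hz)

/-- If `m` is a positive lower bound of `‖h‖` on the sphere, two approximations closer than `m` are
joined by a segment of maps without zeros on the sphere, so their counts agree. -/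
theorem exists_isLocalDegree {h : Eu n → Eu n} {p : Eu n} {r : ℝ} (hr : 0 < r)
    (hc : ContinuousOn h (Metric.closedBall p r))
    (h0 : ∀ z ∈ Metric.closedBall p r, h z = 0 → z ∈ Metric.ball p r) :
    ∃ L, IsLocalDegree h p r L := by
  obtain ⟨m, hm, hmin⟩ : ∃ m > 0, ∀ z ∈ Metric.sphere p r, m ≤ ‖h z‖ := by
    have hcs : ContinuousOn h (Metric.sphere p r) := hc.mono Metric.sphere_subset_closedBall
    rcases (Metric.sphere p r).eq_empty_or_nonempty with he | hne
    · exact ⟨1, one_pos, fun z hz => by rw [he] at hz; exact absurd hz (notMem_empty z)⟩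
    · obtain ⟨z₀, hz₀, hmin⟩ := (isCompact_sphere p r).exists_isMinOn hne hcs.norm
      refine ⟨‖h z₀‖, norm_pos_iff.2 fun hz => ?_, fun z hz => hmin hz⟩
      have := h0 z₀ (Metric.sphere_subset_closedBall hz₀) hz
      rw [Metric.mem_ball, Metric.mem_sphere.1 hz₀] at this
      exact lt_irrefl _ this
  by_cases hex : ∃ k : Eu n → Eu n, (∀ z ∈ Metric.closedBall p r, ContDiffAt ℝ 1 k z) ∧
    (∀ z ∈ Metric.closedBall p r, ‖k z - h z‖ < m) ∧
    (∀ z ∈ Metric.ball p r, k z = 0 → (fderiv ℝ k z).det ≠ 0)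
  · obtain ⟨k₁, hk₁, hk₁h, hk₁d⟩ := hex
    refine ⟨signedCount k₁ (Metric.ball p r), m, hm, fun k₀ hk₀ hk₀h hk₀d => ?_⟩
    obtain ⟨K₀, hK₀, hKk₀⟩ := exists_contDiff_eventuallyEq_of_closedBall hr.le hk₀
    obtain ⟨K₁, hK₁, hKk₁⟩ := exists_contDiff_eventuallyEq_of_closedBall hr.le hk₁
    have hbc : Metric.ball p r ⊆ Metric.closedBall p r := Metric.ball_subset_closedBall
    rw [← signedCount_congr fun z hz => hKk₀ z (hbc hz),
      ← signedCount_congr fun z hz => hKk₁ z (hbc hz)]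
    refine signedCount_eq_of_segment hK₀ hK₁ hr ?_ ?_ ?_
    · intro z hz hz0
      rw [(hKk₀ z (hbc hz)).fderiv_eq]
      exact hk₀d z hz (by rw [← (hKk₀ z (hbc hz)).self_of_nhds, hz0])
    · intro z hz hz0
      rw [(hKk₁ z (hbc hz)).fderiv_eq]
      exact hk₁d z hz (by rw [← (hKk₁ z (hbc hz)).self_of_nhds, hz0])
    · intro z hz t ht hzt
      by_contra hcon
      have hzs : z ∈ Metric.sphere p r := by
        rw [Metric.mem_sphere]
        rw [Metric.mem_ball, not_lt] at hcon
        exact le_antisymm hz hcon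
      rw [(hKk₀ z hz).self_of_nhds, (hKk₁ z hz).self_of_nhds] at hzt
      have e : h z = -((1 - t) • (k₁ z - h z) + t • (k₀ z - h z)) := by
        have : h z + ((1 - t) • (k₁ z - h z) + t • (k₀ z - h z)) =
          k₁ z + t • (k₀ z - k₁ z) := by module
        exact eq_neg_of_add_eq_zero_left (this.trans hzt)
      have h1 : ‖h z‖ ≤ (1 - t) * ‖k₁ z - h z‖ + t * ‖k₀ z - h z‖ := by
        conv_lhs => rw [e, norm_neg]
        refine (norm_add_le _ _).trans ?_
        rw [norm_smul, norm_smul, Real.norm_of_nonneg ht.1,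
          Real.norm_of_nonneg (sub_nonneg.2 ht.2)]
      have h2 := hmin z hzs
      have h3 := hk₁h z hz
      have h4 := hk₀h z hz
      rcases ht.1.eq_or_lt with h5 | h5
      · rw [← h5] at h1
        linarith
      · nlinarith [ht.2]
  -- Without any admissible approximation every integer would do. The case is vacuous in view of
  -- `exists_contDiff_approx_nondegenerate`.
  · refine ⟨0, m, hm, fun k hk hkh hkd => absurd ⟨k, hk, hkh, hkd⟩ hex⟩

theorem IsLocalDegree.unique {h : Eu n → Eu n} {p : Eu n} {r : ℝ} {L L' : ℤ}
    (hc : ContinuousOn h (Metric.closedBall p r)) (hL : IsLocalDegree h p r L)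
    (hL' : IsLocalDegree h p r L') : L = L' := by
  obtain ⟨δ, hδ, H⟩ := hL
  obtain ⟨δ', hδ', H'⟩ := hL'
  obtain ⟨k, hk, hkh, hkd⟩ := exists_contDiff_approx_nondegenerate hc (lt_min hδ hδ')
  rw [← H k (fun z _ => hk.contDiffAt) (fun z hz => (hkh z hz).trans_le (min_le_left _ _))
    fun z _ => hkd z, ← H' k (fun z _ => hk.contDiffAt)
    (fun z hz => (hkh z hz).trans_le (min_le_right _ _)) fun z _ => hkd z]

theorem IsLocalDegree.exists_forall_of_close {h : Eu n → Eu n} {p : Eu n} {r : ℝ} {L : ℤ}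
    (hL : IsLocalDegree h p r L) : ∃ δ > 0, ∀ h' : Eu n → Eu n,
      (∀ z ∈ Metric.closedBall p r, ‖h' z - h z‖ < δ) → IsLocalDegree h' p r L := by
  obtain ⟨δ, hδ, H⟩ := hL
  refine ⟨δ / 2, half_pos hδ, fun h' hh' => ⟨δ / 2, half_pos hδ, fun k hk hkh hkd =>
    H k hk (fun z hz => ?_) hkd⟩⟩
  calc ‖k z - h z‖ = ‖(k z - h' z) + (h' z - h z)‖ := by congr 1; abel
    _ ≤ ‖k z - h' z‖ + ‖h' z - h z‖ := norm_add_le _ _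
    _ < δ := by linarith [hkh z hz, hh' z hz]

theorem signedCount_eq_of_subset {E : Type*} [NormedAddCommGroup E] [NormedSpace ℝ E] {h : E → E}
    {V W : Set E} (hVW : V ⊆ W) (hz : ∀ z ∈ W, h z = 0 → z ∈ V) :
    signedCount h V = signedCount h W := by
  have e : {z ∈ V | h z = 0} = {z ∈ W | h z = 0} := by
    ext z
    exact ⟨fun h => ⟨hVW h.1, h.2⟩, fun h => ⟨hz z h.1 h.2, h.2⟩⟩
  unfold signedCount
  rw [e]

theorem exists_pos_forall_le_norm {h : Eu n → Eu n} {K : Set (Eu n)} (hK : IsCompact K)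
    (hc : ContinuousOn h K) (h0 : ∀ z ∈ K, h z ≠ 0) : ∃ m > 0, ∀ z ∈ K, m ≤ ‖h z‖ := by
  rcases K.eq_empty_or_nonempty with he | hne
  · exact ⟨1, one_pos, fun z hz => by rw [he] at hz; exact absurd hz (notMem_empty z)⟩
  · obtain ⟨z₀, hz₀, hmin⟩ := hK.exists_isMinOn hne hc.norm
    exact ⟨‖h z₀‖, norm_pos_iff.2 (h0 z₀ hz₀), fun z hz => hmin hz⟩

/-- Excision: an approximation closer to `h` than the minimum of `‖h‖` outside the small ball has no
zeros there, so it has the same count on both balls. -/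
theorem IsLocalDegree.of_subset_ball {h : Eu n → Eu n} {p : Eu n} {r s : ℝ} {L : ℤ}
    (hs : 0 < s) (hsr : s ≤ r) (hc : ContinuousOn h (Metric.closedBall p r))
    (h0 : ∀ z ∈ Metric.closedBall p r, h z = 0 → z ∈ Metric.ball p s)
    (hL : IsLocalDegree h p r L) : IsLocalDegree h p s L := by
  have hsub : Metric.closedBall p s ⊆ Metric.closedBall p r := Metric.closedBall_subset_closedBall hsr
  obtain ⟨L', hL'⟩ := exists_isLocalDegree hs (hc.mono hsub) fun z hz => h0 z (hsub hz)
  obtain ⟨δ, hδ, H⟩ := hL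
  obtain ⟨δ', hδ', H'⟩ := hL'
  obtain ⟨m, hm, hmin⟩ := exists_pos_forall_le_norm
    ((isCompact_closedBall p r).diff (Metric.isOpen_ball (x := p) (ε := s)))
    (hc.mono sdiff_subset) fun z hz hz0 => hz.2 (h0 z hz.1 hz0)
  obtain ⟨k, hk, hkh, hkd⟩ := exists_contDiff_approx_nondegenerate hc (lt_min hm (lt_min hδ hδ'))
  have e : L' = L := by
    rw [← H k (fun z _ => hk.contDiffAt)
      (fun z hz => (hkh z hz).trans_le ((min_le_right _ _).trans (min_le_left _ _)))
      fun z _ => hkd z, ← H' k (fun z _ => hk.contDiffAt)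
      (fun z hz => (hkh z (hsub hz)).trans_le ((min_le_right _ _).trans (min_le_right _ _)))
      fun z _ => hkd z]
    refine signedCount_eq_of_subset (Metric.ball_subset_ball hsr) fun z hz hz0 => ?_
    by_contra hcon
    have hzc := Metric.ball_subset_closedBall hz
    have h1 := hmin z ⟨hzc, hcon⟩
    have h2 := (hkh z hzc).trans_le (min_le_left _ _)
    rw [hz0, zero_sub, norm_neg] at h2
    linarith
  rw [← e]
  exact ⟨δ', hδ', H'⟩

end LocalDegree

/-! ### Invariance of the local degree under changes of coordinates. -/

section Conjugation

variable {n : ℕ}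

theorem ContinuousLinearMap.det_id_sub_conj {E : Type*} [NormedAddCommGroup E] [NormedSpace ℝ E]
    [FiniteDimensional ℝ E] (A P Q : E →L[ℝ] E) (hPQ : P ∘L Q = ContinuousLinearMap.id ℝ E) :
    (ContinuousLinearMap.id ℝ E - P ∘L A ∘L Q).det = (ContinuousLinearMap.id ℝ E - A).det := by
  have e : ContinuousLinearMap.id ℝ E - P ∘L A ∘L Q =
      P ∘L ((ContinuousLinearMap.id ℝ E - A) ∘L Q) := by
    rw [ContinuousLinearMap.sub_comp, ContinuousLinearMap.comp_sub, ContinuousLinearMap.id_comp, hPQ]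
  have hmul : ∀ S T : E →L[ℝ] E, (S ∘L T).det = S.det * T.det := fun S T => LinearMap.det_comp _ _
  have h1 : P.det * Q.det = 1 := by
    rw [← hmul, hPQ]
    exact LinearMap.det_id
  rw [e, hmul, hmul, mul_left_comm, h1, mul_one]

/-- The local degree of `id - a` at an isolated fixed point of `a` does not depend on the
coordinates. -/
theorem IsLocalDegree.conj {a b : Eu n → Eu n} {p : Eu n} {r r' : ℝ} (hr : 0 < r) (hr' : 0 < r')
    (ha : ContinuousOn a (Metric.closedBall p r)) (hap : a p = p)
    (ha0 : ∀ z ∈ Metric.closedBall p r, a z = z → z = p) (θ : OpenPartialHomeomorph (Eu n) (Eu n))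
    (hpθ : p ∈ θ.source) (hθ : ∀ z ∈ θ.source, ContDiffAt ℝ 1 θ z)
    (hθs : ∀ z ∈ θ.target, ContDiffAt ℝ 1 θ.symm z)
    (hb : ContinuousOn b (Metric.closedBall (θ p) r'))
    (hb0 : ∀ w ∈ Metric.closedBall (θ p) r', b w = w → w = θ p)
    (hab : ∀ᶠ w in 𝓝 (θ p), b w = θ (a (θ.symm w))) {L : ℤ}
    (hL : IsLocalDegree (fun z => z - a z) p r L) :
    IsLocalDegree (fun w => w - b w) (θ p) r' L := by
  have hbc : ContinuousOn (fun w => w - b w) (Metric.closedBall (θ p) r') := continuousOn_id.sub hb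
  have hac : ContinuousOn (fun z => z - a z) (Metric.closedBall p r) := continuousOn_id.sub ha
  obtain ⟨L', hL'⟩ := exists_isLocalDegree hr' hbc fun w hw h0 => by
    rw [hb0 w hw (sub_eq_zero.1 h0).symm]; exact Metric.mem_ball_self hr'
  have hθp : θ.symm (θ p) = p := θ.left_inv hpθ
  obtain ⟨σ, hσ, hσs⟩ := Metric.nhds_basis_closedBall.mem_iff.1 (θ.open_source.mem_nhds hpθ)
  -- a small radius in the new coordinates
  have hsymm : ContinuousAt θ.symm (θ p) := θ.continuousAt_symm (θ.map_source hpθ)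
  have hac' : ContinuousAt a p :=
    ha.continuousAt (Metric.closedBall_mem_nhds p hr)
  have hcomp : ContinuousAt (fun w => a (θ.symm w)) (θ p) :=
    ContinuousAt.comp (by rwa [hθp]) hsymm
  have hev : ∀ᶠ w in 𝓝 (θ p), w ∈ θ.target ∧ θ.symm w ∈ Metric.ball p r ∧
      a (θ.symm w) ∈ Metric.ball p (σ / 2) ∧ b w = θ (a (θ.symm w)) := by
    refine Filter.Eventually.and (θ.open_target.mem_nhds (θ.map_source hpθ))
      (Filter.Eventually.and ?_ (Filter.Eventually.and ?_ hab))
    · exact hsymm.eventually (Metric.isOpen_ball.mem_nhds (by rw [hθp]; exact Metric.mem_ball_self hr))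
    · exact hcomp.eventually (Metric.isOpen_ball.mem_nhds
        (by simp only [hθp, hap]; exact Metric.mem_ball_self (half_pos hσ)))
  obtain ⟨s₀, hs₀, hs₀w⟩ := Metric.nhds_basis_closedBall.eventually_iff.1 hev
  set s' := min s₀ r' with hs'
  have hs'0 : 0 < s' := lt_min hs₀ hr'
  have hw : ∀ w ∈ Metric.closedBall (θ p) s', w ∈ θ.target ∧ θ.symm w ∈ Metric.ball p r ∧
      a (θ.symm w) ∈ Metric.ball p (σ / 2) ∧ b w = θ (a (θ.symm w)) := fun w hw =>
    hs₀w (Metric.closedBall_subset_closedBall (min_le_left _ _) hw)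
  have hs'r : s' ≤ r' := min_le_right _ _
  obtain ⟨δ', hδ', H'⟩ := hL'.of_subset_ball hs'0 hs'r hbc fun w hw h0 => by
    rw [hb0 w hw (sub_eq_zero.1 h0).symm]; exact Metric.mem_ball_self hs'0
  obtain ⟨δ, hδ, H⟩ := hL
  -- a small radius in the old coordinates
  have hθc : ContinuousAt θ p := θ.continuousAt hpθ
  obtain ⟨s, hs, hsw⟩ := Metric.nhds_basis_ball.eventually_iff.1
    (Filter.Eventually.and (θ.open_source.mem_nhds hpθ) (hθc.eventually
      (Metric.isOpen_ball.mem_nhds (Metric.mem_ball_self hs'0))))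
  obtain ⟨m, hm, hmin⟩ := exists_pos_forall_le_norm
    ((isCompact_closedBall p r).diff (Metric.isOpen_ball (x := p) (ε := s)))
    (hac.mono sdiff_subset) fun z hz hz0 => hz.2 (by
      rw [ha0 z hz.1 (sub_eq_zero.1 hz0).symm]; exact Metric.mem_ball_self hs)
  have huc : UniformContinuousOn θ (Metric.closedBall p σ) :=
    (isCompact_closedBall p σ).uniformContinuousOn_of_continuous (θ.continuousOn.mono hσs)
  -- If `A` is `η`-close to `a`, then `θ A θ⁻¹` is `δ'`-close to `θ a θ⁻¹`, which is `b` near `θ p`.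
  -- So one approximation `A` serves in both coordinates.
  obtain ⟨η, hη, hηθ⟩ := Metric.uniformContinuousOn_iff.1 huc δ' hδ'
  obtain ⟨k, hk, hkh, hkd⟩ := exists_contDiff_approx_nondegenerate hac
    (lt_min hm (lt_min hδ (lt_min hη (half_pos hσ))))
  set A : Eu n → Eu n := fun z => z - k z with hA
  have hAc : ContDiff ℝ 1 A := contDiff_id.sub hk
  have hkA : k = fun z => z - A z := by funext z; simp [hA]
  have hAa : ∀ z ∈ Metric.closedBall p r, ‖A z - a z‖ < min m (min δ (min η (σ / 2))) := by
    intro z hz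
    have e : A z - a z = -(k z - (z - a z)) := by rw [hA]; simp only; abel
    rw [e, norm_neg]
    exact hkh z hz
  have hAz : ∀ z ∈ Metric.closedBall p r, A z = z → z ∈ Metric.ball p s := by
    intro z hz hz0
    by_contra hcon
    have h1 := hmin z ⟨hz, hcon⟩
    have h2 := (hAa z hz).trans_le (min_le_left _ _)
    rw [hz0] at h2
    linarith
  have hAσ : ∀ w ∈ Metric.closedBall (θ p) s', A (θ.symm w) ∈ Metric.closedBall p σ := by
    intro w hw'
    obtain ⟨-, h2, h3, -⟩ := hw w hw'
    have h4 := (hAa _ (Metric.ball_subset_closedBall h2)).trans_le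
      ((min_le_right _ _).trans ((min_le_right _ _).trans (min_le_right _ _)))
    rw [Metric.mem_closedBall, dist_eq_norm]
    rw [Metric.mem_ball, dist_eq_norm] at h3
    calc ‖A (θ.symm w) - p‖ = ‖(A (θ.symm w) - a (θ.symm w)) + (a (θ.symm w) - p)‖ := by
          congr 1; abel
      _ ≤ _ := norm_add_le _ _
      _ ≤ σ := by linarith
  set B : Eu n → Eu n := fun w => θ (A (θ.symm w)) with hB
  have hfix : ∀ w ∈ Metric.closedBall (θ p) s', B w = w ↔ A (θ.symm w) = θ.symm w := by
    intro w hw'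
    constructor
    · intro h
      have := congrArg θ.symm h
      rwa [hB, θ.left_inv (hσs (hAσ w hw'))] at this
    · intro h
      rw [hB]
      simp only
      rw [h, θ.right_inv (hw w hw').1]
  have hBd : ∀ w ∈ Metric.closedBall (θ p) s', ContDiffAt ℝ 1 B w := by
    intro w hw'
    exact (hθ _ (hσs (hAσ w hw'))).comp w (hAc.contDiffAt.comp w (hθs w (hw w hw').1))
  have hdet : ∀ w ∈ Metric.closedBall (θ p) s', B w = w →
      (fderiv ℝ (fun w => w - B w) w).det = (fderiv ℝ k (θ.symm w)).det := by
    intro w hw' hBw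
    have hfx := (hfix w hw').1 hBw
    have hwt := (hw w hw').1
    have h1 : HasFDerivAt θ.symm (fderiv ℝ θ.symm w) w :=
      ((hθs w hwt).differentiableAt (by norm_num)).hasFDerivAt
    have h2 : HasFDerivAt A (fderiv ℝ A (θ.symm w)) (θ.symm w) :=
      ((hAc.differentiable (by norm_num)) _).hasFDerivAt
    have h3 : HasFDerivAt θ (fderiv ℝ θ (θ.symm w)) (θ.symm w) :=
      ((hθ _ (θ.map_target hwt)).differentiableAt (by norm_num)).hasFDerivAt
    have h3' : HasFDerivAt θ (fderiv ℝ θ (θ.symm w)) ((A ∘ θ.symm) w) := by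
      simpa only [Function.comp_apply, hfx] using h3
    have h4 : HasFDerivAt B (fderiv ℝ θ (θ.symm w) ∘L (fderiv ℝ A (θ.symm w) ∘L
        fderiv ℝ θ.symm w)) w := h3'.comp w (h2.comp w h1)
    have hPQ : fderiv ℝ θ (θ.symm w) ∘L fderiv ℝ θ.symm w = ContinuousLinearMap.id ℝ (Eu n) := by
      have h5 : HasFDerivAt (θ ∘ θ.symm) _ w := h3.comp w h1
      have h6 : (θ ∘ θ.symm) =ᶠ[𝓝 w] id := by
        filter_upwards [θ.open_target.mem_nhds hwt] with y hy using θ.right_inv hy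
      exact h5.unique ((hasFDerivAt_id w).congr_of_eventuallyEq h6)
    have h7 : fderiv ℝ k (θ.symm w) = ContinuousLinearMap.id ℝ (Eu n) - fderiv ℝ A (θ.symm w) := by
      rw [hkA]
      exact ((hasFDerivAt_id _).sub h2).fderiv
    have h8 : fderiv ℝ (fun w => w - B w) w = ContinuousLinearMap.id ℝ (Eu n) - _ :=
      ((hasFDerivAt_id _).sub h4).fderiv
    rw [h7, h8, ContinuousLinearMap.det_id_sub_conj _ _ _ hPQ]
  -- Surjectivity is where `m` and `s` matter: the fixed points of `A` in the ball of radius `r` lie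
  -- in the ball of radius `s`, which `θ` maps into the ball of radius `s'`.
  have hbij : BijOn θ.symm {w ∈ Metric.ball (θ p) s' | w - B w = 0}
      {z ∈ Metric.ball p r | k z = 0} := by
    have hk0 : ∀ z, k z = 0 ↔ A z = z := by
      intro z
      rw [hkA]
      exact sub_eq_zero.trans eq_comm
    refine ⟨?_, ?_, ?_⟩
    · rintro w ⟨hw1, hw2⟩
      have hw1' := Metric.ball_subset_closedBall hw1
      exact ⟨(hw w hw1').2.1, (hk0 _).2 ((hfix w hw1').1 (sub_eq_zero.1 hw2).symm)⟩
    · rintro w ⟨hw1, -⟩ v ⟨hv1, -⟩ h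
      exact θ.symm.injOn (hw w (Metric.ball_subset_closedBall hw1)).1
        (hw v (Metric.ball_subset_closedBall hv1)).1 h
    · rintro z ⟨hz1, hz2⟩
      have hz3 := hsw (hAz z (Metric.ball_subset_closedBall hz1) ((hk0 z).1 hz2))
      refine ⟨θ z, ⟨hz3.2, ?_⟩, θ.left_inv hz3.1⟩
      rw [sub_eq_zero, eq_comm, hfix _ (Metric.ball_subset_closedBall hz3.2), θ.left_inv hz3.1]
      exact (hk0 z).1 hz2
  have hcount : signedCount (fun w => w - B w) (Metric.ball (θ p) s') =
      signedCount k (Metric.ball p r) := by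
    refine finsum_mem_eq_of_bijOn θ.symm hbij fun w hw1 => ?_
    rw [hdet w (Metric.ball_subset_closedBall hw1.1) (sub_eq_zero.1 hw1.2).symm]
  have hLL : L' = L := by
    rw [← H k (fun z _ => hk.contDiffAt)
      (fun z hz => (hkh z hz).trans_le ((min_le_right _ _).trans (min_le_left _ _)))
      fun z _ => hkd z, ← hcount]
    refine (H' (fun w => w - B w) (fun w hw1 => contDiffAt_id.sub (hBd w hw1)) (fun w hw1 => ?_)
      fun w hw1 hw2 => ?_).symm
    · obtain ⟨-, h2, h3, h4⟩ := hw w hw1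
      have h5 := (hAa _ (Metric.ball_subset_closedBall h2)).trans_le
        ((min_le_right _ _).trans ((min_le_right _ _).trans (min_le_left _ _)))
      have h6 := hηθ _ (hAσ w hw1) _
        (Metric.ball_subset_closedBall (Metric.ball_subset_ball (by linarith) h3))
        (by rwa [dist_eq_norm])
      rw [dist_eq_norm] at h6
      rw [show (fun w => w - b w) w = w - θ (a (θ.symm w)) by simp only [h4]]
      have e : w - B w - (w - θ (a (θ.symm w))) = -(θ (A (θ.symm w)) - θ (a (θ.symm w))) := by
        rw [hB]; simp only; abel
      rw [e, norm_neg]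
      exact h6
    · have hw1' := Metric.ball_subset_closedBall hw1
      have hBw : B w = w := (sub_eq_zero.1 hw2).symm
      rw [hdet w hw1' hBw]
      refine hkd _ ?_
      rw [hkA]
      exact sub_eq_zero.2 ((hfix w hw1').1 hBw).symm
  rw [← hLL]
  exact hL'

end Conjugation

/-! ### Openness and persistence properties of iterates in smooth families. -/

section Families

variable {A E : Type*} [NormedAddCommGroup A] [NormedSpace ℝ A] [NormedAddCommGroup E]
  [NormedSpace ℝ E]

theorem contDiff_iterate_family {G : A × E → E} (hG : ContDiff ℝ 1 G) (j : ℕ) :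
    ContDiff ℝ 1 fun q : A × E => (fun z => G (q.1, z))^[j] q.2 := by
  induction j with
  | zero => exact contDiff_snd
  | succ j ih =>
    simp only [Function.iterate_succ_apply']
    exact hG.comp (contDiff_fst.prodMk ih)

theorem contDiff_iterate {g : E → E} (hg : ContDiff ℝ 1 g) (j : ℕ) : ContDiff ℝ 1 (g^[j]) := by
  induction j with
  | zero => exact contDiff_id
  | succ j ih =>
    rw [Function.iterate_succ']
    exact hg.comp ih

theorem continuous_fderiv_family {H : A × E → E} (hH : ContDiff ℝ 1 H) :
    Continuous fun q : A × E => fderiv ℝ (fun z => H (q.1, z)) q.2 := by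
  have e : (fun q : A × E => fderiv ℝ (fun z => H (q.1, z)) q.2) = fun q =>
      fderiv ℝ H q ∘L ContinuousLinearMap.inr ℝ A E := by
    funext q
    have h1 : HasFDerivAt H (fderiv ℝ H q) (q.1, q.2) :=
      ((hH.differentiable (by norm_num)) q).hasFDerivAt
    exact (h1.comp q.2 (hasFDerivAt_prodMk_right q.1 q.2)).fderiv
  rw [e]
  exact (hH.continuous_fderiv (by norm_num)).clm_comp continuous_const

theorem continuous_fderiv_iterate_family {G : A × E → E} (hG : ContDiff ℝ 1 G) (j : ℕ) :
    Continuous fun q : A × E => fderiv ℝ ((fun z => G (q.1, z))^[j]) q.2 :=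
  continuous_fderiv_family (H := fun q : A × E => (fun z => G (q.1, z))^[j] q.2)
    (contDiff_iterate_family hG j)

theorem continuous_det_id_sub_fderiv_iterate_family {G : A × E → E} (hG : ContDiff ℝ 1 G) (j : ℕ) :
    Continuous fun q : A × E =>
      (ContinuousLinearMap.id ℝ E - fderiv ℝ ((fun z => G (q.1, z))^[j]) q.2).det :=
  ContinuousLinearMap.continuous_det.comp
    (continuous_const.sub (continuous_fderiv_iterate_family hG j))

/-- Non-degeneracy of the fixed points of `g^j` in a compact set is an open condition. -/
theorem eventually_nondegenerate_family {G : A × E → E} (hG : ContDiff ℝ 1 G) {K : Set E}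
    (hK : IsCompact K) (a₀ : A) (j l : ℕ)
    (h : ∀ z ∈ K, (fun z => G (a₀, z))^[j] z = z →
      (ContinuousLinearMap.id ℝ E - fderiv ℝ ((fun z => G (a₀, z))^[l]) z).det ≠ 0) :
    ∀ᶠ a in 𝓝 a₀, ∀ z ∈ K, (fun z => G (a, z))^[j] z = z →
      (ContinuousLinearMap.id ℝ E - fderiv ℝ ((fun z => G (a, z))^[l]) z).det ≠ 0 := by
  refine hK.eventually_forall_of_forall_eventually fun z hz => ?_
  have h1 := (contDiff_iterate_family hG j).continuous
  have h2 := continuous_det_id_sub_fderiv_iterate_family hG l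
  by_cases he : (fun z => G (a₀, z))^[j] z = z
  · have h3 : ∀ᶠ q : A × E in 𝓝 (a₀, z),
        (ContinuousLinearMap.id ℝ E - fderiv ℝ ((fun z => G (q.1, z))^[l]) q.2).det ≠ 0 :=
      (h2.tendsto (a₀, z)).eventually (isOpen_ne.mem_nhds (h z hz he))
    filter_upwards [h3] with q hq _ using hq
  · have h3 : ∀ᶠ q : A × E in 𝓝 (a₀, z), (fun z => G (q.1, z))^[j] q.2 ≠ q.2 :=
      (isOpen_ne_fun h1 continuous_snd).mem_nhds he
    filter_upwards [h3] with q hq hq' using absurd hq' hq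

theorem eventually_close_family {G : A × E → E} (hG : ContDiff ℝ 1 G) {K : Set E}
    (hK : IsCompact K) (a₀ : A) {ε : ℝ} (hε : 0 < ε) :
    ∀ᶠ a in 𝓝 a₀, ∀ z ∈ K, ‖G (a, z) - G (a₀, z)‖ < ε ∧
      ‖fderiv ℝ (fun z => G (a, z)) z - fderiv ℝ (fun z => G (a₀, z)) z‖ < ε := by
  refine hK.eventually_forall_of_forall_eventually fun z hz => ?_
  have h1 : Continuous fun q : A × E => ‖G (q.1, q.2) - G (a₀, q.2)‖ :=
    (hG.continuous.sub (hG.continuous.comp (continuous_const.prodMk continuous_snd))).norm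
  have h2' := continuous_fderiv_family hG
  have h2 : Continuous fun q : A × E =>
      ‖fderiv ℝ (fun z => G (q.1, z)) q.2 - fderiv ℝ (fun z => G (a₀, z)) q.2‖ :=
    (h2'.sub (h2'.comp ((continuous_const (y := a₀)).prodMk continuous_snd))).norm
  refine ((h1.tendsto (a₀, z)).eventually (gt_mem_nhds ?_)).and
    ((h2.tendsto (a₀, z)).eventually (gt_mem_nhds ?_)) <;> simpa using hε

variable [FiniteDimensional ℝ E]

/-- A non-degenerate zero that persists in a family is locally the only zero. -/
theorem eventually_zero_eq_of_det_ne_zero {H : A × E → E} (hH : ContDiff ℝ 1 H) {a₀ : A} {z : E}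
    (hz : ∀ a, H (a, z) = 0) (hd : (fderiv ℝ (fun w => H (a₀, w)) z).det ≠ 0) :
    ∀ᶠ q : A × E in 𝓝 (a₀, z), H q = 0 → q.2 = z := by
  set B := (fderiv ℝ (fun w => H (a₀, w)) z).toContinuousLinearEquivOfDetNeZero hd with hB
  have hBe : ∀ v, B v = fderiv ℝ H (a₀, z) (0, v) := by
    intro v
    have h1 : HasFDerivAt H (fderiv ℝ H (a₀, z)) (a₀, z) :=
      ((hH.differentiable (by norm_num)) _).hasFDerivAt
    have h2 := (h1.comp z (hasFDerivAt_prodMk_right a₀ z)).fderiv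
    have h3 : B v = fderiv ℝ (fun w => H (a₀, w)) z v := rfl
    rw [h3]
    exact congrArg (fun L : E →L[ℝ] E => L v) h2
  set N := ‖(B.symm : E →L[ℝ] E)‖ with hN
  have hN0 : 0 ≤ N := norm_nonneg _
  have hs := (hH.contDiffAt (x := (a₀, z))).hasStrictFDerivAt (by norm_num)
  have ho := hs.isLittleO
  have hc : 0 < 1 / (2 * (N + 1)) := by positivity
  have h1 := ho.def hc
  -- The strict derivative at `(a₀, z)` is used for the pair `(a, w)` and `(a, z)`. Their difference
  -- has no parameter component, so only the invertible partial differential `B` enters.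
  have hcont : Tendsto (fun q : A × E => (q, (q.1, z))) (𝓝 (a₀, z)) (𝓝 ((a₀, z), (a₀, z))) := by
    have : Continuous fun q : A × E => (q, (q.1, z)) := by fun_prop
    exact this.tendsto (a₀, z)
  filter_upwards [hcont.eventually h1] with q hq hq0
  have e : q - (q.1, z) = (0, q.2 - z) := by ext <;> simp
  rw [hq0, hz, e, sub_self, zero_sub, norm_neg, ← hBe, Prod.norm_mk, norm_zero,
    max_eq_right (norm_nonneg _)] at hq
  have h4 : ‖q.2 - z‖ ≤ N * ‖B (q.2 - z)‖ := by
    have := (B.symm : E →L[ℝ] E).le_opNorm (B (q.2 - z))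
    simpa using this
  have h5 : ‖q.2 - z‖ ≤ N * (1 / (2 * (N + 1)) * ‖q.2 - z‖) :=
    h4.trans (mul_le_mul_of_nonneg_left hq hN0)
  have h6 : N * (1 / (2 * (N + 1)) * ‖q.2 - z‖) ≤ 1 / 2 * ‖q.2 - z‖ := by
    rw [← mul_assoc]
    refine mul_le_mul_of_nonneg_right ?_ (norm_nonneg _)
    rw [mul_one_div, div_le_div_iff₀ (by positivity) (by norm_num)]
    linarith
  have h7 : ‖q.2 - z‖ = 0 := le_antisymm (by linarith) (norm_nonneg _)
  exact sub_eq_zero.1 (norm_eq_zero.1 h7)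

/-- All small dilations of a linear map have no eigenvalue that is a root of unity of given
orders. -/
theorem eventually_det_id_sub_pow_smul_ne_zero (B : E →L[ℝ] E) {N : ℕ} (hN : 0 < N) :
    ∀ᶠ s : ℝ in 𝓝[>] 0, (ContinuousLinearMap.id ℝ E - (1 + s) ^ N • B).det ≠ 0 := by
  have hfin : ∀ᶠ s : ℝ in 𝓝[>] 0,
      ∀ c ∈ (LinearMap.charpoly (B : E →ₗ[ℝ] E)).roots.toFinset, ((1 + s) ^ N)⁻¹ ≠ c := by
    rw [Filter.eventually_all_finset]
    intro c _
    -- The root `1` is the limit of `((1 + s)^N)⁻¹` as `s → 0`, but for `s > 0` that value is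
    -- strictly below `1`. Any other root is avoided by continuity.
    by_cases hc : c = 1
    · filter_upwards [self_mem_nhdsWithin] with s hs
      have hs' : (0 : ℝ) < s := hs
      have : 1 < (1 + s) ^ N := one_lt_pow₀ (by linarith) hN.ne'
      rw [hc]
      exact (inv_lt_one_of_one_lt₀ this).ne
    · have hcont : ContinuousAt (fun s : ℝ => ((1 + s) ^ N)⁻¹) 0 := by
        refine ContinuousAt.inv₀ (by fun_prop) (by simp)
      have : ∀ᶠ s : ℝ in 𝓝 0, ((1 + s) ^ N)⁻¹ ≠ c :=
        hcont.eventually (isOpen_ne.mem_nhds (by simpa using (Ne.symm hc)))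
      exact this.filter_mono nhdsWithin_le_nhds
  filter_upwards [hfin, self_mem_nhdsWithin] with s hs hs0 h0
  have hs' : (0 : ℝ) < s := hs0
  set t := (1 + s) ^ N with ht
  have ht0 : t ≠ 0 := by positivity
  refine hs t⁻¹ ?_ rfl
  rw [Multiset.mem_toFinset, Polynomial.mem_roots (LinearMap.charpoly_monic _).ne_zero,
    Polynomial.IsRoot.def, LinearMap.eval_charpoly]
  have e : algebraMap ℝ (Module.End ℝ E) t⁻¹ - (B : E →ₗ[ℝ] E) =
      t⁻¹ • ((ContinuousLinearMap.id ℝ E - t • B : E →L[ℝ] E) : E →ₗ[ℝ] E) := by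
    ext x
    simp [smul_sub, smul_smul, inv_mul_cancel₀ ht0]
  rw [e, LinearMap.det_smul]
  have h0' : LinearMap.det ((ContinuousLinearMap.id ℝ E - t • B : E →L[ℝ] E) : E →ₗ[ℝ] E) = 0 := h0
  rw [h0', mul_zero]

end Families

/-! ### Kupka-Smale: perturbing to non-degenerate periodic points. -/

section KupkaSmale

variable {E : Type*} [NormedAddCommGroup E] [InnerProductSpace ℝ E]

/-- No root of unity of order at most `l` is an eigenvalue of the differential of `g^j` at the
fixed points of `g^j` in `K`. -/
def IsStronglyNondegenerate (g : E → E) (K : Set E) (l j : ℕ) : Prop :=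
  ∀ m ∈ Finset.Icc 1 l, ∀ z ∈ K, g^[j] z = z →
    (ContinuousLinearMap.id ℝ E - fderiv ℝ (g^[j * m]) z).det ≠ 0

theorem IsStronglyNondegenerate.eventually {A : Type*} [NormedAddCommGroup A] [NormedSpace ℝ A]
    {G : A × E → E} (hG : ContDiff ℝ 1 G) {K : Set E} (hK : IsCompact K) {a₀ : A} {l j : ℕ}
    (h : IsStronglyNondegenerate (fun z => G (a₀, z)) K l j) :
    ∀ᶠ a in 𝓝 a₀, IsStronglyNondegenerate (fun z => G (a, z)) K l j :=
  (Filter.eventually_all_finset _).2 fun m hm =>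
    eventually_nondegenerate_family hG hK a₀ j (j * m) (h m hm)

/-- A translation localized near the last point of a periodic orbit translates the iterate. -/
theorem iterate_add_bump_eq {g : E → E} {χ : E → ℝ} {c : E} {z : E} :
    ∀ {l : ℕ}, (∀ i < l, χ (g^[i] z) = 0) → (fun w => g w + χ w • c)^[l] z = g^[l] z := by
  intro l
  induction l with
  | zero => intro _; rfl
  | succ l ih =>
    intro h
    rw [Function.iterate_succ_apply', ih fun i hi => h i (hi.trans l.lt_succ_self),
      Function.iterate_succ_apply', h l l.lt_succ_self, zero_smul, add_zero]

/-- If all lower periods are non-degenerate, then a degenerate fixed point of `g^j` has minimal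
period `j`. -/
theorem IsStronglyNondegenerate.minimalPeriod_eq {g : E → E} {K : Set E} {l k : ℕ} (hkl : k + 1 ≤ l)
    (h : ∀ j ∈ Finset.Icc 1 k, IsStronglyNondegenerate g K l j) {z : E} (hz : z ∈ K)
    (hp : g^[k + 1] z = z)
    (hd : (ContinuousLinearMap.id ℝ E - fderiv ℝ (g^[k + 1]) z).det = 0) :
    Function.minimalPeriod g z = k + 1 := by
  have hper : Function.IsPeriodicPt g (k + 1) z := hp
  obtain ⟨m, hm⟩ := hper.minimalPeriod_dvd
  have hpos : 0 < Function.minimalPeriod g z := hper.minimalPeriod_pos k.succ_pos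
  by_contra hne
  have hle : Function.minimalPeriod g z ≤ k + 1 := hper.minimalPeriod_le k.succ_pos
  have hm0 : m ≠ 0 := by rintro rfl; omega
  have hml : m ≤ k + 1 := by
    rw [hm]; exact Nat.le_mul_of_pos_left m hpos
  refine h _ (Finset.mem_Icc.2 ⟨hpos, by omega⟩) m (Finset.mem_Icc.2 ⟨by omega, by omega⟩) z hz
    (Function.isPeriodicPt_minimalPeriod g z) ?_
  rw [← hm]
  exact hd

variable [FiniteDimensional ℝ E]

/-- The points `z, …, g^k z` are distinct, so a bump around the last one can avoid the others.
Adding `χ • c` to `g` then turns `g^(k+1)` into `g^(k+1) + c` near `z`. -/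
theorem exists_bump_at_last_point {g : E → E} (hg : ContDiff ℝ 1 g) {k : ℕ} {z : E}
    (hz : Function.minimalPeriod g z = k + 1) :
    ∃ χ : E → ℝ, ContDiff ℝ 1 χ ∧ ∃ u > 0, ∀ w ∈ Metric.closedBall z u,
      (∀ i < k, g^[i] w ∉ tsupport χ) ∧ g^[k] w ∈ interior {y | χ y = 1} := by
  classical
  have hne : ∀ i < k, g^[i] z ≠ g^[k] z := by
    intro i hi he
    have := Function.iterate_injOn_Iio_minimalPeriod (f := g) (x := z)
      (show i ∈ Set.Iio _ by rw [hz]; exact hi.trans k.lt_succ_self)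
      (show k ∈ Set.Iio _ by rw [hz]; exact k.lt_succ_self) he
    omega
  set S : Finset E := (Finset.range k).image fun i => g^[i] z with hS
  have hSc : (S : Set E)ᶜ ∈ 𝓝 (g^[k] z) := by
    refine S.finite_toSet.isClosed.isOpen_compl.mem_nhds ?_
    simp only [hS, Finset.coe_image, Finset.coe_range, mem_compl_iff, mem_image, mem_Iio, not_exists,
      not_and]
    exact hne
  obtain ⟨ρ, hρ, hρS⟩ := Metric.nhds_basis_closedBall.mem_iff.1 hSc
  let χ : ContDiffBump (g^[k] z) := ⟨ρ / 2, ρ, half_pos hρ, by linarith⟩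
  refine ⟨χ, χ.contDiff, ?_⟩
  have hcont : ∀ i, Continuous (g^[i]) := fun i => (contDiff_iterate hg i).continuous
  have h1 : ∀ᶠ w in 𝓝 z, ∀ i ∈ Finset.range k, g^[i] w ∉ tsupport χ := by
    rw [Filter.eventually_all_finset]
    intro i hi
    refine ((hcont i).tendsto z).eventually ((isClosed_tsupport _).isOpen_compl.mem_nhds ?_)
    rw [χ.tsupport_eq]
    intro hmem
    exact hρS hmem (Finset.mem_coe.2 (Finset.mem_image_of_mem (fun i => g^[i] z) hi))
  have h2 : ∀ᶠ w in 𝓝 z, g^[k] w ∈ interior {y | χ y = 1} := by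
    refine ((hcont k).tendsto z).eventually (isOpen_interior.mem_nhds ?_)
    rw [mem_interior_iff_mem_nhds]
    exact χ.eventuallyEq_one
  obtain ⟨u, hu, hw⟩ := Metric.nhds_basis_closedBall.eventually_iff.1 (h1.and h2)
  exact ⟨u, hu, fun w hw' => ⟨fun i hi => (hw hw').1 i (Finset.mem_range.2 hi), (hw hw').2⟩⟩

/-- First step: the fixed points of `g^(k+1)` become non-degenerate. -/
theorem exists_perturbation_nondegenerate {g : E → E} (hg : ContDiff ℝ 1 g) {K : Set E}
    (hK : IsCompact K) {l k : ℕ} (hkl : k + 1 ≤ l)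
    (h : ∀ j ∈ Finset.Icc 1 k, IsStronglyNondegenerate g K l j) {ε : ℝ} (hε : 0 < ε) :
    ∃ g' : E → E, ContDiff ℝ 1 g' ∧
      (∀ z ∈ K, ‖g' z - g z‖ < ε ∧ ‖fderiv ℝ g' z - fderiv ℝ g z‖ < ε) ∧
      (∀ j ∈ Finset.Icc 1 k, IsStronglyNondegenerate g' K l j) ∧
      ∀ z ∈ K, g'^[k + 1] z = z →
        (ContinuousLinearMap.id ℝ E - fderiv ℝ (g'^[k + 1]) z).det ≠ 0 := by
  classical
  set Z : Set E := {z ∈ K | g^[k + 1] z = z ∧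
    (ContinuousLinearMap.id ℝ E - fderiv ℝ (g^[k + 1]) z).det = 0} with hZ
  have hgk := contDiff_iterate hg (k + 1)
  have hZc : IsCompact Z := by
    refine hK.inter_right ((isClosed_eq hgk.continuous continuous_id).inter
      (isClosed_eq ?_ continuous_const))
    exact ContinuousLinearMap.continuous_det.comp
      (continuous_const.sub (hgk.continuous_fderiv (by norm_num)))
  have hloc : ∀ z : E, ∃ χ : E → ℝ, ContDiff ℝ 1 χ ∧ ∃ u > 0, z ∈ Z → ∀ w ∈ Metric.closedBall z u,
      (∀ i < k, g^[i] w ∉ tsupport χ) ∧ g^[k] w ∈ interior {y | χ y = 1} := by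
    intro z
    by_cases hz : z ∈ Z
    · obtain ⟨χ, hχ, u, hu, hw⟩ := exists_bump_at_last_point hg
        (IsStronglyNondegenerate.minimalPeriod_eq hkl h hz.1 hz.2.1 hz.2.2)
      exact ⟨χ, hχ, u, hu, fun _ => hw⟩
    · exact ⟨fun _ => 0, contDiff_const, 1, one_pos, fun h => absurd h hz⟩
  choose χ hχ u hu hχu using hloc
  obtain ⟨I, hIZ, hIcov⟩ := hZc.elim_nhds_subcover (fun z => Metric.ball z (u z))
    fun z _ => Metric.ball_mem_nhds z (hu z)
  -- One independent translation parameter for each ball of a finite cover of the degenerate points.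
  set G : (I → E) × E → E := fun q => g q.2 + ∑ i : I, χ i q.2 • q.1 i with hG
  have hGc : ContDiff ℝ 1 G := by
    refine (hg.comp contDiff_snd).add (ContDiff.sum fun i _ => ?_)
    exact ((hχ i).comp contDiff_snd).smul ((contDiff_apply ℝ E i).comp contDiff_fst)
  have hG0 : (fun z => G (0, z)) = g := by
    funext z
    simp [hG]
  have hGadd : ∀ (a : I → E) (i : I) (c : E), (fun z => G (a + Pi.single i c, z)) =
      fun z => G (a, z) + χ i z • c := by
    intro a i c
    funext z
    simp only [hG, Pi.add_apply, smul_add, Finset.sum_add_distrib, ← add_assoc]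
    congr 1
    rw [Finset.sum_eq_single i]
    · rw [Pi.single_eq_same]
    · intro b _ hb
      rw [Pi.single_eq_of_ne hb, smul_zero]
    · simp
  -- conditions that hold for small parameters
  have hCi : ∀ᶠ a in 𝓝 (0 : I → E), ∀ i ∈ (Finset.univ : Finset I),
      ∀ w ∈ Metric.closedBall (i : E) (u i),
        (∀ m ∈ Finset.range k, (fun z => G (a, z))^[m] w ∉ tsupport (χ i)) ∧
          (fun z => G (a, z))^[k] w ∈ interior {y | χ i y = 1} := by
    rw [Filter.eventually_all_finset]
    intro i _
    refine (isCompact_closedBall _ _).eventually_forall_of_forall_eventually fun w hw => ?_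
    have hw' := hχu i (hIZ i i.2) w hw
    refine Filter.Eventually.and ?_ ?_
    · rw [Filter.eventually_all_finset]
      intro m hm
      refine ((contDiff_iterate_family hGc m).continuous.tendsto (0, w)).eventually
        ((isClosed_tsupport _).isOpen_compl.mem_nhds ?_)
      simp only [hG0]
      exact hw'.1 m (Finset.mem_range.1 hm)
    · refine ((contDiff_iterate_family hGc k).continuous.tendsto (0, w)).eventually
        (isOpen_interior.mem_nhds ?_)
      simp only [hG0]
      exact hw'.2
  have hrest : ∀ᶠ a in 𝓝 (0 : I → E), ∀ z ∈ K \ ⋃ i ∈ I, Metric.ball i (u i),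
      (fun z => G (a, z))^[k + 1] z = z →
      (ContinuousLinearMap.id ℝ E - fderiv ℝ ((fun z => G (a, z))^[k + 1]) z).det ≠ 0 := by
    refine eventually_nondegenerate_family hGc
      (hK.diff (isOpen_biUnion fun i _ => Metric.isOpen_ball)) 0 (k + 1) (k + 1) ?_
    intro z hz hzk h0
    rw [hG0] at hzk h0
    exact hz.2 (hIcov ⟨hz.1, hzk, h0⟩)
  have hstr : ∀ᶠ a in 𝓝 (0 : I → E), ∀ j ∈ Finset.Icc 1 k,
      IsStronglyNondegenerate (fun z => G (a, z)) K l j := by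
    rw [Filter.eventually_all_finset]
    intro j hj
    exact IsStronglyNondegenerate.eventually hGc hK (by rw [hG0]; exact h j hj)
  have hclose := eventually_close_family hGc hK (0 : I → E) hε
  have hall := hCi.and (hrest.and (hstr.and hclose))
  obtain ⟨O, hO, hOo, h0O⟩ := eventually_nhds_iff.1 hall
  -- perturb one coordinate after the other
  have key : ∀ s : Finset I, ∃ a ∈ O, ∀ i ∈ s, ∀ z ∈ Metric.closedBall (i : E) (u i),
      (fun z => G (a, z))^[k + 1] z = z →
      (ContinuousLinearMap.id ℝ E - fderiv ℝ ((fun z => G (a, z))^[k + 1]) z).det ≠ 0 := by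
    intro s
    induction s using Finset.induction_on with
    | empty => exact ⟨0, h0O, by simp⟩
    | insert i s his ih =>
      obtain ⟨a, haO, ha⟩ := ih
      -- Non-degeneracy is open, so a small enough change of the next parameter keeps what the
      -- earlier ones achieved.
      have hev : ∀ᶠ b in 𝓝 a, b ∈ O ∧ ∀ i ∈ s, ∀ z ∈ Metric.closedBall (i : E) (u i),
          (fun z => G (b, z))^[k + 1] z = z →
          (ContinuousLinearMap.id ℝ E - fderiv ℝ ((fun z => G (b, z))^[k + 1]) z).det ≠ 0 := by
        refine Filter.Eventually.and (hOo.mem_nhds haO) ?_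
        rw [Filter.eventually_all_finset]
        intro i' hi'
        exact eventually_nondegenerate_family hGc (isCompact_closedBall _ _) a _ _ (ha i' hi')
      have htend : Tendsto (fun c : E => a + Pi.single i c) (𝓝 0) (𝓝 a) := by
        have : Continuous fun c : E => a + Pi.single i c :=
          continuous_const.add (continuous_single (A := fun _ : I => E) i)
        simpa using this.tendsto 0
      obtain ⟨η, hη, hηc⟩ := Metric.eventually_nhds_iff.1 (htend.eventually hev)
      have hga : ContDiff ℝ 1 fun z => G (a, z) := hGc.comp (contDiff_const.prodMk contDiff_id)
      have hgak := contDiff_iterate hga (k + 1)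
      -- On the new ball the fixed points of the perturbed iterate solve `z - g_a^(k+1) z = c`.
      -- Taking `c` a small regular value makes them non-degenerate.
      obtain ⟨c, hc0, hc⟩ := exists_norm_lt_forall_det_ne_zero
        (h := fun z => z - (fun z => G (a, z))^[k + 1] z) (S := univ)
        (fun z _ => (differentiableAt_id).sub ((hgak.differentiable (by norm_num)) z)) hη 0
      have hb := hηc (y := c) (by rwa [dist_eq_norm])
      refine ⟨a + Pi.single i c, hb.1, fun i' hi' => ?_⟩
      rcases Finset.mem_insert.1 hi' with rfl | hi'
      · intro z hz hzk
        have hCa := fun w hw => (hO a haO).1 i' (Finset.mem_univ _) w hw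
        have hloc : ∀ᶠ w in 𝓝 z, (fun z => G (a + Pi.single i' c, z))^[k + 1] w =
            (fun z => G (a, z))^[k + 1] w + c := by
          have e1 : ∀ᶠ w in 𝓝 z, ∀ m ∈ Finset.range k,
              (fun z => G (a, z))^[m] w ∉ tsupport (χ i') := by
            rw [Filter.eventually_all_finset]
            intro m hm
            exact ((contDiff_iterate hga m).continuous.tendsto z).eventually
              ((isClosed_tsupport _).isOpen_compl.mem_nhds ((hCa z hz).1 m hm))
          have e2 : ∀ᶠ w in 𝓝 z, (fun z => G (a, z))^[k] w ∈ interior {y | χ i' y = 1} :=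
            ((contDiff_iterate hga k).continuous.tendsto z).eventually
              (isOpen_interior.mem_nhds (hCa z hz).2)
          filter_upwards [e1, e2] with w hw1 hw2
          rw [hGadd, Function.iterate_succ_apply', iterate_add_bump_eq fun m hm =>
            image_eq_zero_of_notMem_tsupport (hw1 m (Finset.mem_range.2 hm)),
            Function.iterate_succ_apply']
          have : (fun z => G (a, z))^[k] w ∈ {y | χ i' y = 1} := interior_subset hw2
          rw [mem_ofPred_eq] at this
          rw [this, one_smul]
        have hd1 : fderiv ℝ ((fun z => G (a + Pi.single i' c, z))^[k + 1]) z =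
            fderiv ℝ ((fun z => G (a, z))^[k + 1]) z := by
          have : ((fun z => G (a + Pi.single i' c, z))^[k + 1]) =ᶠ[𝓝 z]
            fun w => (fun z => G (a, z))^[k + 1] w + c := hloc
          rw [this.fderiv_eq, fderiv_add_const]
        rw [hd1]
        have hzc : z - (fun z => G (a, z))^[k + 1] z = c := by
          have := hloc.self_of_nhds
          rw [hzk] at this
          nth_rewrite 1 [this]
          abel
        have hdz := hc z (mem_univ z) hzc
        have hf : fderiv ℝ (fun z => z - (fun z => G (a, z))^[k + 1] z) z =
            ContinuousLinearMap.id ℝ E - fderiv ℝ ((fun z => G (a, z))^[k + 1]) z :=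
          ((hasFDerivAt_id z).sub ((hgak.differentiable (by norm_num)) z).hasFDerivAt).fderiv
        rwa [hf] at hdz
      · exact hb.2 i' hi'
  obtain ⟨a, haO, ha⟩ := key Finset.univ
  obtain ⟨-, hr, hs, hcl⟩ := hO a haO
  rw [hG0] at hcl
  have hcl' : ∀ z ∈ K, ‖G (a, z) - g z‖ < ε ∧
      ‖fderiv ℝ (fun z => G (a, z)) z - fderiv ℝ g z‖ < ε := by
    intro z hz
    have := hcl z hz
    rwa [show G (0, z) = g z from congrFun hG0 z] at this
  refine ⟨fun z => G (a, z), hGc.comp (contDiff_const.prodMk contDiff_id), hcl', hs, ?_⟩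
  intro z hz
  by_cases hzi : z ∈ ⋃ i ∈ I, Metric.ball i (u i)
  · obtain ⟨i, hi, hzi⟩ := mem_iUnion₂.1 hzi
    exact ha ⟨i, hi⟩ (Finset.mem_univ _) z (Metric.ball_subset_closedBall hzi)
  · exact hr z ⟨hz, hzi⟩

end KupkaSmale

section KupkaSmale

variable {E : Type*} [NormedAddCommGroup E] [InnerProductSpace ℝ E]

/-- Dilating the differentials along an orbit dilates the differential of the iterate. -/
theorem iterate_eq_and_fderiv_iterate_eq {g g' : E → E} (hg : ContDiff ℝ 1 g)
    (hg' : ContDiff ℝ 1 g') {t : ℝ} {z : E}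
    (h : ∀ i, g' (g^[i] z) = g (g^[i] z) ∧
      fderiv ℝ g' (g^[i] z) = t • fderiv ℝ g (g^[i] z)) (l : ℕ) :
    g'^[l] z = g^[l] z ∧ fderiv ℝ (g'^[l]) z = t ^ l • fderiv ℝ (g^[l]) z := by
  induction l with
  | zero => simp
  | succ l ih =>
    refine ⟨by rw [Function.iterate_succ_apply', Function.iterate_succ_apply', ih.1, (h l).1], ?_⟩
    have h1 := (hg'.differentiable (by norm_num)) (g'^[l] z)
    have h2 := ((contDiff_iterate hg' l).differentiable (by norm_num)) z
    have h3 := (hg.differentiable (by norm_num)) (g^[l] z)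
    have h4 := ((contDiff_iterate hg l).differentiable (by norm_num)) z
    rw [Function.iterate_succ', Function.iterate_succ', fderiv_comp z h1 h2, fderiv_comp z h3 h4,
      ih.1, (h l).2, ih.2]
    ext v
    simp [smul_smul, pow_succ, mul_comm]

variable [FiniteDimensional ℝ E]

/-- On a finite set one can prescribe a map that vanishes there, with given differentials. -/
theorem exists_contDiff_zero_fderiv_eq (S : Finset E) (D : E → E →L[ℝ] E) :
    ∃ q : E → E, ContDiff ℝ 1 q ∧ ∀ y ∈ S, q y = 0 ∧ fderiv ℝ q y = D y := by
  classical
  have hloc : ∀ y : E, ∃ χ : E → ℝ, ContDiff ℝ 1 χ ∧ χ =ᶠ[𝓝 y] 1 ∧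
      ∀ y' ∈ S, y' ≠ y → χ =ᶠ[𝓝 y'] 0 := by
    intro y
    have hmem : ((S.erase y : Finset E) : Set E)ᶜ ∈ 𝓝 y :=
      (S.erase y).finite_toSet.isClosed.isOpen_compl.mem_nhds (by simp)
    obtain ⟨ρ, hρ, hρS⟩ := Metric.nhds_basis_closedBall.mem_iff.1 hmem
    let χ : ContDiffBump y := ⟨ρ / 2, ρ, half_pos hρ, by linarith⟩
    refine ⟨χ, χ.contDiff, χ.eventuallyEq_one, fun y' hy' hne => ?_⟩
    rw [← notMem_tsupport_iff_eventuallyEq, χ.tsupport_eq]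
    intro hmem'
    exact hρS hmem' (Finset.mem_coe.2 (Finset.mem_erase.2 ⟨hne, hy'⟩))
  choose χ hχ hχ1 hχ0 using hloc
  refine ⟨fun w => ∑ y ∈ S, χ y w • D y (w - y), ?_, ?_⟩
  · refine ContDiff.sum fun y _ => (hχ y).smul ?_
    exact (D y).contDiff.comp (contDiff_id.sub contDiff_const)
  · intro y hy
    have he : (fun w => ∑ y ∈ S, χ y w • D y (w - y)) =ᶠ[𝓝 y] fun w => D y (w - y) := by
      have h1 : ∀ᶠ w in 𝓝 y, ∀ y' ∈ S, y' ≠ y → χ y' w = 0 := by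
        rw [Filter.eventually_all_finset]
        intro y' hy'
        by_cases hne : y' = y
        · simp [hne]
        · filter_upwards [hχ0 y' y hy (Ne.symm hne)] with w hw _ using hw
      filter_upwards [h1, hχ1 y] with w hw1 hw2
      rw [Finset.sum_eq_single y (fun y' hy' hne => by rw [hw1 y' hy' hne, zero_smul])
        (fun h => absurd hy h), hw2]
      simp
    refine ⟨?_, ?_⟩
    · rw [he.self_of_nhds]
      simp
    · rw [he.fderiv_eq]
      exact ((D y).hasFDerivAt.comp y ((hasFDerivAt_id y).sub_const y)).fderiv

/-- Second step: finitely many non-degenerate periodic orbits become strongly non-degenerate. -/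
theorem exists_perturbation_isStronglyNondegenerate {g : E → E} (hg : ContDiff ℝ 1 g) {K : Set E}
    (hK : IsCompact K) {l k : ℕ} (h : ∀ j ∈ Finset.Icc 1 k, IsStronglyNondegenerate g K l j)
    (hnd : ∀ z ∈ K, g^[k + 1] z = z →
      (ContinuousLinearMap.id ℝ E - fderiv ℝ (g^[k + 1]) z).det ≠ 0) {ε : ℝ} (hε : 0 < ε) :
    ∃ g' : E → E, ContDiff ℝ 1 g' ∧
      (∀ z ∈ K, ‖g' z - g z‖ < ε ∧ ‖fderiv ℝ g' z - fderiv ℝ g z‖ < ε) ∧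
      ∀ j ∈ Finset.Icc 1 (k + 1), IsStronglyNondegenerate g' K l j := by
  classical
  have hgk := contDiff_iterate hg (k + 1)
  have hsub : ContDiff ℝ 1 fun z => z - g^[k + 1] z := contDiff_id.sub hgk
  have hfd : ∀ z, fderiv ℝ (fun z => z - g^[k + 1] z) z =
      ContinuousLinearMap.id ℝ E - fderiv ℝ (g^[k + 1]) z := fun z =>
    ((hasFDerivAt_id z).sub ((hgk.differentiable (by norm_num)) z).hasFDerivAt).fderiv
  have hFfin : {z ∈ K | z - g^[k + 1] z = 0}.Finite := by
    refine hK.finite_zeros hsub.continuous.continuousOn fun z hz h0 => ?_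
    have := (hsub.contDiffAt (x := z)).eventually_ne_of_det_ne_zero (by
      rw [hfd]; exact hnd z hz (sub_eq_zero.1 h0).symm)
    filter_upwards [this] with w hw _
    rwa [h0] at hw
  set F := hFfin.toFinset with hF
  have hFmem : ∀ z, z ∈ F ↔ z ∈ K ∧ g^[k + 1] z = z := by
    intro z
    rw [hF, Set.Finite.mem_toFinset]
    exact and_congr_right fun _ => sub_eq_zero.trans eq_comm
  set S : Finset E := F.biUnion fun z => (Finset.range (k + 1)).image fun i => g^[i] z with hS
  have hSmem : ∀ z ∈ F, ∀ i, g^[i] z ∈ S := by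
    intro z hz i
    have hp : Function.IsPeriodicPt g (k + 1) z := ((hFmem z).1 hz).2
    rw [← hp.iterate_mod_apply i, hS, Finset.mem_biUnion]
    exact ⟨z, hz, Finset.mem_image_of_mem (fun i => g^[i] z)
      (Finset.mem_range.2 (Nat.mod_lt _ k.succ_pos))⟩
  -- Since `q` vanishes on the orbits and has the differential of `g` there, `g + s q` keeps these
  -- orbits and multiplies the differential by `1 + s` at each of their points.
  obtain ⟨q, hq, hqS⟩ := exists_contDiff_zero_fderiv_eq S fun y => fderiv ℝ g y
  set G : ℝ × E → E := fun x => g x.2 + x.1 • q x.2 with hG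
  have hGc : ContDiff ℝ 1 G := (hg.comp contDiff_snd).add (contDiff_fst.smul (hq.comp contDiff_snd))
  have hGs : ∀ s, ContDiff ℝ 1 fun z => G (s, z) := fun s =>
    hGc.comp (contDiff_const.prodMk contDiff_id)
  have hG0 : (fun z => G (0, z)) = g := by
    funext z
    simp [hG]
  have horb : ∀ s : ℝ, ∀ z ∈ F, ∀ m, (fun z => G (s, z))^[m] z = g^[m] z ∧
      fderiv ℝ ((fun z => G (s, z))^[m]) z = (1 + s) ^ m • fderiv ℝ (g^[m]) z := by
    intro s z hz m
    refine iterate_eq_and_fderiv_iterate_eq hg (hGs s) (fun i => ?_) m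
    obtain ⟨h1, h2⟩ := hqS _ (hSmem z hz i)
    refine ⟨by simp [hG, h1], ?_⟩
    have : HasFDerivAt (fun z => G (s, z)) (fderiv ℝ g (g^[i] z) + s • fderiv ℝ q (g^[i] z))
        (g^[i] z) :=
      (((hg.differentiable (by norm_num)) _).hasFDerivAt).add
        ((((hq.differentiable (by norm_num)) _).hasFDerivAt).const_smul s)
    rw [this.fderiv, h2, add_smul, one_smul]
  -- No new fixed points of the iterate appear: those in `F` persist and are locally unique by
  -- non-degeneracy, and elsewhere in `K` being a fixed point is a closed condition.
  have hfix : ∀ᶠ s in 𝓝 (0 : ℝ), ∀ z ∈ K, (fun z => G (s, z))^[k + 1] z = z → z ∈ F := by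
    refine hK.eventually_forall_of_forall_eventually fun z hz => ?_
    have hcd := contDiff_iterate_family hGc (k + 1)
    by_cases hzF : z ∈ F
    · have hH : ContDiff ℝ 1 fun x : ℝ × E => x.2 - (fun z => G (x.1, z))^[k + 1] x.2 :=
        contDiff_snd.sub hcd
      have hpt := ((hFmem z).1 hzF).2
      have := eventually_zero_eq_of_det_ne_zero hH (a₀ := (0 : ℝ)) (z := z)
        (fun s => by
          simp only
          rw [(horb s z hzF (k + 1)).1, hpt, sub_self])
        (by
          simp only [hG0]
          rw [hfd]
          exact hnd z hz hpt)
      filter_upwards [this] with x hx hx0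
      rw [hx (sub_eq_zero.2 hx0.symm)]
      exact hzF
    · have h1 : ∀ᶠ x : ℝ × E in 𝓝 (0, z), (fun z => G (x.1, z))^[k + 1] x.2 ≠ x.2 := by
        refine (isOpen_ne_fun hcd.continuous continuous_snd).mem_nhds ?_
        simp only [mem_ofPred_eq, hG0]
        exact fun he => hzF ((hFmem z).2 ⟨hz, he⟩)
      filter_upwards [h1] with x hx hx0 using absurd hx0 hx
  have hstr : ∀ᶠ s in 𝓝 (0 : ℝ), ∀ j ∈ Finset.Icc 1 k,
      IsStronglyNondegenerate (fun z => G (s, z)) K l j := by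
    rw [Filter.eventually_all_finset]
    intro j hj
    exact IsStronglyNondegenerate.eventually hGc hK (by rw [hG0]; exact h j hj)
  have hclose := eventually_close_family hGc hK (0 : ℝ) hε
  have hgen : ∀ᶠ s in 𝓝[>] (0 : ℝ), ∀ z ∈ F, ∀ m ∈ Finset.Icc 1 l,
      (ContinuousLinearMap.id ℝ E -
        (1 + s) ^ ((k + 1) * m) • fderiv ℝ (g^[(k + 1) * m]) z).det ≠ 0 := by
    rw [Filter.eventually_all_finset]
    intro z _
    rw [Filter.eventually_all_finset]
    intro m hm
    exact eventually_det_id_sub_pow_smul_ne_zero _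
      (Nat.mul_pos k.succ_pos (Finset.mem_Icc.1 hm).1)
  obtain ⟨s, hs, hs1, hs2, hs3⟩ := (hgen.and
    ((hfix.and (hstr.and hclose)).filter_mono nhdsWithin_le_nhds)).exists
  refine ⟨fun z => G (s, z), hGs s, fun z hz => ?_, fun j hj => ?_⟩
  · have := hs3 z hz
    rwa [show G (0, z) = g z from congrFun hG0 z, hG0] at this
  · rcases Nat.lt_or_ge k j with hjk | hjk
    · have hj' : j = k + 1 := le_antisymm (Finset.mem_Icc.1 hj).2 hjk
      subst hj'
      intro m hm z hz hzk
      have hzF := hs1 z hz hzk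
      rw [(horb s z hzF _).2]
      exact hs z hzF m hm
    · exact hs2 j (Finset.mem_Icc.2 ⟨(Finset.mem_Icc.1 hj).1, hjk⟩)

/-- Strong non-degeneracy is what makes the induction on the period run. It excludes degenerate
fixed points of `g^(k+1)` whose period `τ` is smaller, where `k + 1 = τ m` with `m ≤ l`; the
remaining ones have distinct orbit points and can be treated by a local translation. -/
theorem exists_perturbation_forall_isStronglyNondegenerate {g : E → E} (hg : ContDiff ℝ 1 g)
    {K : Set E} (hK : IsCompact K) {l : ℕ} {k : ℕ} (hkl : k ≤ l) {ε : ℝ} (hε : 0 < ε) :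
    ∃ g' : E → E, ContDiff ℝ 1 g' ∧
      (∀ z ∈ K, ‖g' z - g z‖ < ε ∧ ‖fderiv ℝ g' z - fderiv ℝ g z‖ < ε) ∧
      ∀ j ∈ Finset.Icc 1 k, IsStronglyNondegenerate g' K l j := by
  induction k generalizing ε with
  | zero => exact ⟨g, hg, fun z _ => by simpa using hε, by simp⟩
  | succ k ih =>
    have hε3 : 0 < ε / 3 := by positivity
    obtain ⟨g₁, hg₁, hc₁, hs₁⟩ := ih (by omega) hε3
    obtain ⟨g₂, hg₂, hc₂, hs₂, hn₂⟩ := exists_perturbation_nondegenerate hg₁ hK hkl hs₁ hε3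
    obtain ⟨g₃, hg₃, hc₃, hs₃⟩ := exists_perturbation_isStronglyNondegenerate hg₂ hK hs₂ hn₂ hε3
    refine ⟨g₃, hg₃, fun z hz => ?_, hs₃⟩
    obtain ⟨a₁, b₁⟩ := hc₁ z hz
    obtain ⟨a₂, b₂⟩ := hc₂ z hz
    obtain ⟨a₃, b₃⟩ := hc₃ z hz
    have key : ∀ {F : Type _} [NormedAddCommGroup F] (w x y v : F), ‖x - w‖ < ε / 3 →
        ‖y - x‖ < ε / 3 → ‖v - y‖ < ε / 3 → ‖v - w‖ < ε := by
      intro F _ w x y v h1 h2 h3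
      calc ‖v - w‖ = ‖(v - y) + (y - x) + (x - w)‖ := by congr 1; abel
        _ ≤ ‖v - y‖ + ‖y - x‖ + ‖x - w‖ := norm_add₃_le
        _ < ε := by linarith
    exact ⟨key _ _ _ _ a₁ a₂ a₃, key _ _ _ _ b₁ b₂ b₃⟩

/-- Every `C¹` map has `C¹`-small perturbations whose `κ`-periodic points in a given compact set are
non-degenerate. -/
theorem exists_perturbation_iterate_nondegenerate {g : E → E} (hg : ContDiff ℝ 1 g) {K : Set E}
    (hK : IsCompact K) {κ : ℕ} (hκ : 1 ≤ κ) {ε : ℝ} (hε : 0 < ε) :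
    ∃ g' : E → E, ContDiff ℝ 1 g' ∧
      (∀ z ∈ K, ‖g' z - g z‖ < ε ∧ ‖fderiv ℝ g' z - fderiv ℝ g z‖ < ε) ∧
      ∀ z ∈ K, g'^[κ] z = z →
        (ContinuousLinearMap.id ℝ E - fderiv ℝ (g'^[κ]) z).det ≠ 0 := by
  obtain ⟨g', hg', hc, hs⟩ := exists_perturbation_forall_isStronglyNondegenerate hg hK
    (le_refl κ) hε
  refine ⟨g', hg', hc, fun z hz hzk => ?_⟩
  have := hs κ (Finset.mem_Icc.2 ⟨hκ, le_rfl⟩) 1 (Finset.mem_Icc.2 ⟨le_rfl, hκ⟩) z hz hzk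
  rwa [mul_one] at this

end KupkaSmale

/-! ### Counting good orbits through the fixed points of iterates. -/

theorem LinearMap.charpoly_comp_comm {R V : Type*} [CommRing R] [AddCommGroup V] [Module R V]
    [Module.Finite R V] [Module.Free R V] (A B : V →ₗ[R] V) :
    (A ∘ₗ B).charpoly = (B ∘ₗ A).charpoly := by
  classical
  nontriviality R
  let b := Module.Free.chooseBasis R V
  rw [← LinearMap.charpoly_toMatrix _ b, ← LinearMap.charpoly_toMatrix _ b,
    LinearMap.toMatrix_comp b b b, LinearMap.toMatrix_comp b b b, Matrix.charpoly_mul_comm]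

namespace IteratedIndex

variable {n : ℕ} {g : Eu n → Eu n} {U : Set (Eu n)} {κ : ℕ}

/-- The sign of `det (1 - D(g^d))` at `z`. -/
noncomputable def fixedSign (g : Eu n → Eu n) (d : ℕ) (z : Eu n) : ℤ :=
  SignType.sign (ContinuousLinearMap.id ℝ (Eu n) - fderiv ℝ (g^[d]) z).det

theorem contDiffAt_iterate_of_forall_mem (hU : IsOpen U) (hg : ContDiffOn ℝ 1 g U) {d : ℕ}
    {z : Eu n} (hz : ∀ i < d, g^[i] z ∈ U) : ContDiffAt ℝ 1 (g^[d]) z := by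
  induction d with
  | zero => exact contDiffAt_id
  | succ d ih =>
    rw [Function.iterate_succ']
    exact (hg.contDiffAt (hU.mem_nhds (hz d d.lt_succ_self))).comp z
      (ih fun i hi => hz i (hi.trans d.lt_succ_self))

theorem det_id_sub_eq_zero_iff_hasEigenvalue (L : Eu n →L[ℝ] Eu n) :
    (ContinuousLinearMap.id ℝ (Eu n) - L).det = 0 ↔
      Module.End.HasEigenvalue L.toLinearMap 1 := by
  have e : (ContinuousLinearMap.id ℝ (Eu n) - L).det =
      (LinearMap.charpoly L.toLinearMap).eval 1 := by
    rw [LinearMap.eval_charpoly, ContinuousLinearMap.det]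
    congr 1
    ext x
    simp
  rw [e, Module.End.hasEigenvalue_iff_isRoot_charpoly, Polynomial.IsRoot.def]

theorem iterate_mem_periodicPts {z : Eu n} (hz : z ∈ periodicPts g U κ) (i : ℕ) :
    g^[i] z ∈ periodicPts g U κ :=
  ⟨Function.IsPeriodicPt.apply_iterate hz.1 i, fun j => by
    rw [← Function.iterate_add_apply]
    exact hz.2 _⟩

theorem periodicPts_subset_of_dvd {d : ℕ} (hd : d ∣ κ) :
    periodicPts g U d ⊆ periodicPts g U κ := fun _ hz =>
  ⟨Function.IsPeriodicPt.trans_dvd hz.1 hd, hz.2⟩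

/-- By the chain rule around the orbit, the two differentials are `A ∘ B` and `B ∘ A`. Hence index
and parity are constant along orbits. -/
theorem charpoly_fderiv_iterate_apply (hU : IsOpen U) (hg : ContDiffOn ℝ 1 g U) {d : ℕ}
    {z : Eu n} (hz : z ∈ periodicPts g U d) :
    LinearMap.charpoly (fderiv ℝ (g^[d]) (g z)).toLinearMap =
      LinearMap.charpoly (fderiv ℝ (g^[d]) z).toLinearMap := by
  rcases d with _ | d
  · simp
  have h1 : DifferentiableAt ℝ g z :=
    (hg.contDiffAt (hU.mem_nhds (hz.2 0))).differentiableAt (by norm_num)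
  have h2 : DifferentiableAt ℝ (g^[d]) (g z) :=
    (contDiffAt_iterate_of_forall_mem hU hg fun i _ => by
      rw [← Function.iterate_succ_apply]; exact hz.2 _).differentiableAt (by norm_num)
  have h3 : g^[d] (g z) = z := by rw [← Function.iterate_succ_apply]; exact hz.1
  have e1 : fderiv ℝ (g^[d + 1]) z = fderiv ℝ (g^[d]) (g z) ∘L fderiv ℝ g z := by
    rw [Function.iterate_succ, fderiv_comp z h2 h1]
  have e2 : fderiv ℝ (g^[d + 1]) (g z) = fderiv ℝ g z ∘L fderiv ℝ (g^[d]) (g z) := by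
    rw [Function.iterate_succ', fderiv_comp (g z) (by rwa [h3]) h2, h3]
  rw [e1, e2]
  exact LinearMap.charpoly_comp_comm (fderiv ℝ g z).toLinearMap
    (fderiv ℝ (g^[d]) (g z)).toLinearMap

theorem charpoly_fderiv_iterate_iterate (hU : IsOpen U) (hg : ContDiffOn ℝ 1 g U) {d : ℕ}
    {z : Eu n} (hz : z ∈ periodicPts g U d) (i : ℕ) :
    LinearMap.charpoly (fderiv ℝ (g^[d]) (g^[i] z)).toLinearMap =
      LinearMap.charpoly (fderiv ℝ (g^[d]) z).toLinearMap := by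
  induction i with
  | zero => rfl
  | succ i ih =>
    rw [Function.iterate_succ_apply', charpoly_fderiv_iterate_apply hU hg
      (iterate_mem_periodicPts hz i), ih]

theorem fixedSign_eq_charpoly (g : Eu n → Eu n) (d : ℕ) (z : Eu n) : fixedSign g d z =
    SignType.sign ((LinearMap.charpoly (fderiv ℝ (g^[d]) z).toLinearMap).eval 1) := by
  rw [LinearMap.eval_charpoly, fixedSign, ContinuousLinearMap.det]
  congr 3
  ext x
  simp

theorem fixedSign_iterate (hU : IsOpen U) (hg : ContDiffOn ℝ 1 g U) {d : ℕ}
    {z : Eu n} (hz : z ∈ periodicPts g U d) (i : ℕ) :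
    fixedSign g d (g^[i] z) = fixedSign g d z := by
  rw [fixedSign_eq_charpoly, fixedSign_eq_charpoly, charpoly_fderiv_iterate_iterate hU hg hz]

theorem minimalPeriod_iterate_of_mem (hκ : 1 ≤ κ) {z : Eu n} (hz : z ∈ periodicPts g U κ) (i : ℕ) :
    Function.minimalPeriod g (g^[i] z) = Function.minimalPeriod g z :=
  Function.minimalPeriod_apply_iterate (Function.mk_mem_periodicPts hκ hz.1) i

theorem mem_periodicPts_minimalPeriod {z : Eu n} (hz : z ∈ periodicPts g U κ) :
    z ∈ periodicPts g U (Function.minimalPeriod g z) :=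
  ⟨Function.isPeriodicPt_minimalPeriod g z, hz.2⟩

theorem isBadPt_iterate_iff (hU : IsOpen U) (hg : ContDiffOn ℝ 1 g U) (hκ : 1 ≤ κ)
    {z : Eu n} (hz : z ∈ periodicPts g U κ) (i : ℕ) :
    IsBadPt g κ (g^[i] z) ↔ IsBadPt g κ z := by
  unfold IsBadPt IsOddPt
  rw [minimalPeriod_iterate_of_mem hκ hz,
    charpoly_fderiv_iterate_iterate hU hg (mem_periodicPts_minimalPeriod hz)]

theorem fderiv_iterate_mul (hU : IsOpen U) (hg : ContDiffOn ℝ 1 g U) {τ : ℕ}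
    {z : Eu n} (hz : z ∈ periodicPts g U τ) (m : ℕ) :
    (fderiv ℝ (g^[τ * m]) z).toLinearMap = (fderiv ℝ (g^[τ]) z).toLinearMap ^ m := by
  have h : HasFDerivAt (g^[τ]) (fderiv ℝ (g^[τ]) z) z :=
    ((contDiffAt_iterate_of_forall_mem hU hg fun i _ => hz.2 i).differentiableAt
      (by norm_num)).hasFDerivAt
  rw [Function.iterate_mul, (h.iterate hz.1 m).fderiv]
  exact map_pow (ContinuousLinearMap.toLinearMapRingHom (R₁ := ℝ) (M₁ := Eu n)) _ m

/-- The number of divisors `m` of `M`, weighted by the totients of `M / m`. -/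
theorem sum_totient_div (M : ℕ) : ∑ m ∈ M.divisors, (M / m).totient = M := by
  rw [Nat.sum_div_divisors M (fun m => m.totient), Nat.sum_totient]

/-- The even divisors of `2N` are the `2m` with `m ∣ N`, and `2N / 2m = N / m`, which reduces this
to the full sum for `N`. -/
theorem sum_totient_div_even {M : ℕ} (hM : M ≠ 0) (he : Even M) :
    ∑ m ∈ M.divisors with Even m, (M / m).totient = M / 2 := by
  obtain ⟨N, rfl⟩ := he.two_dvd
  have hN : N ≠ 0 := by rintro rfl; simp at hM
  rw [Nat.mul_div_cancel_left _ two_pos]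
  conv_rhs => rw [← sum_totient_div N]
  symm
  refine Finset.sum_bij (fun m _ => 2 * m) ?_ ?_ ?_ ?_
  · intro m hm
    rw [Finset.mem_filter, Nat.mem_divisors]
    exact ⟨⟨Nat.mul_dvd_mul_left 2 (Nat.mem_divisors.1 hm).1, hM⟩, even_two_mul m⟩
  · intro a _ b _ h
    omega
  · intro b hb
    rw [Finset.mem_filter, Nat.mem_divisors] at hb
    obtain ⟨m, rfl⟩ := hb.2.two_dvd
    exact ⟨m, Nat.mem_divisors.2 ⟨Nat.dvd_of_mul_dvd_mul_left two_pos hb.1.1, hN⟩, rfl⟩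
  · intro m _
    rw [Nat.mul_div_mul_left _ _ two_pos]

/-- Averaging over the divisors of `κ` detects the good periodic points. -/
theorem sum_totient_mul_fixedSign (hU : IsOpen U) (hg : ContDiffOn ℝ 1 g U) (hκ : 1 ≤ κ)
    (hnd : IsNondegenerateOn g U κ) {z : Eu n} (hz : z ∈ periodicPts g U κ)
    [Decidable (IsBadPt g κ z)] :
    ∑ d ∈ κ.divisors with Function.minimalPeriod g z ∣ d, ((κ / d).totient : ℤ) * fixedSign g d z =
      (κ / Function.minimalPeriod g z : ℕ) * if IsBadPt g κ z then 0 else fixedSign g κ z := by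
  set τ := Function.minimalPeriod g z with hτ
  have hzτ : z ∈ periodicPts g U τ := mem_periodicPts_minimalPeriod hz
  have hτκ : τ ∣ κ := Function.IsPeriodicPt.minimalPeriod_dvd hz.1
  have hτ0 : 0 < τ := Nat.pos_of_dvd_of_pos hτκ hκ
  obtain ⟨M, hM⟩ := hτκ
  have hM0 : M ≠ 0 := by rintro rfl; omega
  have hκM : κ / τ = M := by rw [hM, Nat.mul_div_cancel_left _ hτ0]
  set A := (fderiv ℝ (g^[τ]) z).toLinearMap with hA
  have hsgn : ∀ m, fixedSign g (τ * m) z = SignType.sign (LinearMap.det (1 - A ^ m)) := by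
    intro m
    rw [fixedSign, ContinuousLinearMap.det, hA, ← fderiv_iterate_mul hU hg hzτ m]
    rfl
  have hdetM : LinearMap.det (1 - A ^ M) ≠ 0 := by
    intro h0
    refine hnd z hz ((det_id_sub_eq_zero_iff_hasEigenvalue _).1 ?_)
    rw [ContinuousLinearMap.det, hM]
    rw [hA, ← fderiv_iterate_mul hU hg hzτ M] at h0
    exact h0
  -- For `M = m k`, the determinant of `1 - A^m` is a factor of that of `1 - (A^m)^k`.
  have hdet : ∀ m ∈ M.divisors, LinearMap.det (1 - A ^ m) ≠ 0 := by
    intro m hm h0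
    obtain ⟨k, hk⟩ := (Nat.mem_divisors.1 hm).1
    have hk0 : 0 < k := Nat.pos_of_ne_zero (by rintro rfl; simp [hM0] at hk)
    obtain ⟨c, -, hc⟩ := LinearMap.exists_det_one_sub_pow_eq (A ^ m) hk0
    rw [← pow_mul, ← hk, h0] at hc
    exact hdetM (by rw [hc]; ring)
  have hsum : ∑ d ∈ κ.divisors with τ ∣ d, ((κ / d).totient : ℤ) * fixedSign g d z =
      ∑ m ∈ M.divisors, ((M / m).totient : ℤ) * SignType.sign (LinearMap.det (1 - A ^ m)) := by
    symm
    refine Finset.sum_bij (fun m _ => τ * m) ?_ ?_ ?_ ?_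
    · intro m hm
      rw [Finset.mem_filter, Nat.mem_divisors, hM]
      exact ⟨⟨Nat.mul_dvd_mul_left τ (Nat.mem_divisors.1 hm).1, by positivity⟩, dvd_mul_right _ _⟩
    · intro a _ b _ h
      exact Nat.eq_of_mul_eq_mul_left hτ0 h
    · intro b hb
      rw [Finset.mem_filter, Nat.mem_divisors, hM] at hb
      obtain ⟨m, rfl⟩ := hb.2
      exact ⟨m, Nat.mem_divisors.2 ⟨Nat.dvd_of_mul_dvd_mul_left hτ0 hb.1.1, hM0⟩, rfl⟩
    · intro m _
      rw [hsgn, hM, Nat.mul_div_mul_left _ _ hτ0]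
  rw [hsum, hκM]
  have hκs : fixedSign g κ z = SignType.sign (LinearMap.det (1 - A ^ M)) := by rw [hM, hsgn]
  set e₁ : ℤ := ((SignType.sign (LinearMap.det (1 - A)) : SignType) : ℤ) with he₁
  have hodd : ∀ m ∈ M.divisors, Odd m → (SignType.sign (LinearMap.det (1 - A ^ m)) : ℤ) = e₁ := by
    intro m hm ho
    rw [LinearMap.sign_det_one_sub_pow_of_odd A ho (hdet m hm)]
  have hMM : M ∈ M.divisors := Nat.mem_divisors_self M hM0
  by_cases hMe : Even M
  · obtain ⟨h1, -⟩ := LinearMap.sign_det_one_sub_pow_of_even A hMe hM0 hdetM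
    set e₂ : ℤ := ((SignType.sign (LinearMap.det (1 + A)) : SignType) : ℤ) with he₂
    have heven : ∀ m ∈ M.divisors, Even m →
        (SignType.sign (LinearMap.det (1 - A ^ m)) : ℤ) = e₁ * e₂ := by
      intro m hm he
      rw [(LinearMap.sign_det_one_sub_pow_of_even A he (Nat.pos_of_mem_divisors hm).ne'
        (hdet m hm)).2]
      exact map_mul SignType.castHom _ _
    have hE := sum_totient_div_even hM0 hMe
    have hT := sum_totient_div M
    rw [← Finset.sum_filter_add_sum_filter_not M.divisors Even, hE] at hT
    have hO : ∑ m ∈ M.divisors with ¬ Even m, (M / m).totient = M / 2 := by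
      have := Nat.two_mul_div_two_of_even hMe
      omega
    have hMc : (M : ℤ) = 2 * ((M / 2 : ℕ) : ℤ) := by
      exact_mod_cast (Nat.two_mul_div_two_of_even hMe).symm
    rw [← Finset.sum_filter_add_sum_filter_not M.divisors Even,
      Finset.sum_congr rfl (g := fun m => ((M / m).totient : ℤ) * (e₁ * e₂)) fun m hm => by
        rw [heven m (Finset.mem_filter.1 hm).1 (Finset.mem_filter.1 hm).2],
      Finset.sum_congr (s₁ := M.divisors.filter fun m => ¬ Even m) rfl
        (g := fun m => ((M / m).totient : ℤ) * e₁) fun m hm => by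
        rw [hodd m (Finset.mem_filter.1 hm).1 (Nat.not_even_iff_odd.1 (Finset.mem_filter.1 hm).2)],
      ← Finset.sum_mul, ← Finset.sum_mul, ← Nat.cast_sum, ← Nat.cast_sum, hE, hO, hκs,
      heven M hMM hMe]
    have he2 : e₂ = (-1) ^ ((LinearMap.charpoly A).roots.countP fun a => a < -1) := by
      rw [he₂, LinearMap.sign_det_one_add A h1]
      generalize ((LinearMap.charpoly A).roots.countP fun a => a < -1) = k
      induction k with
      | zero => rfl
      | succ k ih => rw [pow_succ, pow_succ, SignType.coe_mul, ih]; rfl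
    -- The weighted sum is now `(M/2) e₁ e₂ + (M/2) e₁`: it cancels if `e₂ = -1` and equals `M e₁`
    -- if `e₂ = 1`.
    by_cases hb : IsBadPt g κ z
    · rw [if_pos hb, he2, Odd.neg_one_pow hb.1]
      ring
    · have hb' : ¬ Odd ((LinearMap.charpoly A).roots.countP fun a => a < -1) := fun ho =>
        hb ⟨ho, by rw [← hτ, hκM]; exact hMe⟩
      rw [if_neg hb, he2, Even.neg_one_pow (Nat.not_odd_iff_even.1 hb'), hMc]
      ring
  · have hMo : Odd M := Nat.not_even_iff_odd.1 hMe
    have hb : ¬ IsBadPt g κ z := fun hb => hMe (by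
      have := hb.2
      rwa [← hτ, hκM] at this)
    rw [if_neg hb, hκs, hodd M hMM hMo,
      Finset.sum_congr rfl (g := fun m => ((M / m).totient : ℤ) * e₁) fun m hm => by
        rw [hodd m hm (hMo.of_dvd_nat (Nat.mem_divisors.1 hm).1)],
      ← Finset.sum_mul, ← Nat.cast_sum, sum_totient_div]

end IteratedIndex

namespace IteratedIndex

variable {n : ℕ} {g : Eu n → Eu n} {U : Set (Eu n)} {κ : ℕ}

theorem mem_orbit_self (g : Eu n → Eu n) (z : Eu n) : z ∈ orbit g z := ⟨0, rfl⟩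

theorem orbit_iterate_subset (g : Eu n → Eu n) (z : Eu n) (i : ℕ) :
    orbit g (g^[i] z) ⊆ orbit g z := by
  rintro _ ⟨j, rfl⟩
  exact ⟨j + i, Function.iterate_add_apply g j i z⟩

theorem orbit_iterate_eq (hκ : 1 ≤ κ) {z : Eu n} (hz : g^[κ] z = z) (i : ℕ) :
    orbit g (g^[i] z) = orbit g z := by
  refine (orbit_iterate_subset g z i).antisymm ?_
  -- Completing `i` to the multiple `κ * i` of the period returns to `z`.
  have h : g^[(κ - 1) * i] (g^[i] z) = z := by
    rw [← Function.iterate_add_apply]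
    have e : (κ - 1) * i + i = κ * i := by
      obtain ⟨k, rfl⟩ := Nat.exists_eq_add_of_le' hκ
      simp; ring
    rw [e, Function.iterate_mul]
    exact Function.iterate_fixed hz i
  conv_lhs => rw [← h]
  exact orbit_iterate_subset g _ _

/-- The index of a `κ`-periodic orbit is the sign of `det (1 - D(g^κ))` at any of its points. -/
theorem orbitIndex_eq_fixedSign (hn : 1 ≤ n) (hU : IsOpen U) (hg : ContDiffOn ℝ 1 g U)
    (hnd : IsNondegenerateOn g U κ) {z : Eu n} (hz : z ∈ periodicPts g U κ) :
    orbitIndex g κ (orbit g z) = fixedSign g κ z := by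
  have hne : (orbit g z).Nonempty := ⟨z, mem_orbit_self g z⟩
  rw [orbitIndex, dif_pos hne]
  obtain ⟨i, hi⟩ := hne.some_mem
  rw [← hi]
  have hw := iterate_mem_periodicPts hz i
  rw [← fixedSign_iterate hU hg hz i]
  refine (hasIndex_of_det_ne_zero hn hw.1
    (contDiffAt_iterate_of_forall_mem hU hg fun j _ => hw.2 j) ?_).fixedPointIndex_eq
  exact fun h0 => hnd _ hw ((det_id_sub_eq_zero_iff_hasEigenvalue _).1 h0)

/-- The sum of the indices of the good orbits in terms of the fixed points of the iterates. -/
theorem mul_goodOrbitSum (hn : 1 ≤ n) (hU : IsOpen U) (hg : ContDiffOn ℝ 1 g U) (hκ : 1 ≤ κ)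
    (hnd : IsNondegenerateOn g U κ) (hfin : (periodicPts g U κ).Finite) :
    (κ : ℤ) * goodOrbitSum g U κ = ∑ d ∈ κ.divisors,
      ((κ / d).totient : ℤ) * ∑ᶠ z ∈ periodicPts g U d, fixedSign g d z := by
  classical
  set P := hfin.toFinset with hP
  have hmem : ∀ z, z ∈ P ↔ z ∈ periodicPts g U κ := fun z => hfin.mem_toFinset
  have hR : ∀ d ∈ κ.divisors, ∑ᶠ z ∈ periodicPts g U d, fixedSign g d z =
      ∑ z ∈ P with Function.minimalPeriod g z ∣ d, fixedSign g d z := by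
    intro d hd
    rw [← finsum_mem_coe_finset]
    congr 1
    ext z
    have e : z ∈ periodicPts g U d ↔
        z ∈ ((P.filter fun z => Function.minimalPeriod g z ∣ d : Finset (Eu n)) : Set (Eu n)) := by
      rw [Finset.mem_coe, Finset.mem_filter, hmem]
      exact ⟨fun h => ⟨periodicPts_subset_of_dvd (Nat.dvd_of_mem_divisors hd) h,
        Function.IsPeriodicPt.minimalPeriod_dvd h.1⟩,
        fun h => ⟨Function.isPeriodicPt_iff_minimalPeriod_dvd.2 h.2, h.1.2⟩⟩
    simp only [e]
  have hRHS : ∑ d ∈ κ.divisors, ((κ / d).totient : ℤ) * ∑ᶠ z ∈ periodicPts g U d, fixedSign g d z =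
      ∑ z ∈ P with ¬ IsBadPt g κ z,
        ((κ / Function.minimalPeriod g z : ℕ) : ℤ) * fixedSign g κ z := by
    rw [Finset.sum_congr rfl fun d hd => by rw [hR d hd, Finset.mul_sum, Finset.sum_filter],
      Finset.sum_comm, Finset.sum_filter]
    refine Finset.sum_congr rfl fun z hz => ?_
    rw [← Finset.sum_filter, sum_totient_mul_fixedSign hU hg hκ hnd ((hmem z).1 hz)]
    split_ifs <;> simp
  have hgood : goodOrbits g U κ =
      (((P.filter fun z => ¬ IsBadPt g κ z).image (orbit g) : Finset (Set (Eu n))) :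
        Set (Set (Eu n))) := by
    ext O
    simp only [goodOrbits, Set.mem_ofPred_eq, Finset.coe_image, Set.mem_image, Finset.mem_coe,
      Finset.mem_filter, hmem]
    exact ⟨fun ⟨z, h1, h2, h3⟩ => ⟨z, ⟨h1, h2⟩, h3.symm⟩,
      fun ⟨z, ⟨h1, h2⟩, h3⟩ => ⟨z, h1, h2, h3.symm⟩⟩
  rw [hRHS, goodOrbitSum, hgood, finsum_mem_coe_finset, Finset.mul_sum]
  -- Group the good points by orbit. An orbit of minimal period `τ` has `τ` points, each of weight
  -- `κ / τ` and with the same sign, which gives `κ` times the orbit index.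
  refine Finset.sum_image' _ fun c hc => ?_
  rw [Finset.mem_filter, hmem] at hc
  obtain ⟨hc, hcg⟩ := hc
  have hcp : c ∈ Function.periodicPts g := Function.mk_mem_periodicPts hκ hc.1
  have hset : (P.filter fun z => ¬ IsBadPt g κ z).filter (fun z => orbit g z = orbit g c) =
      (Finset.range (Function.minimalPeriod g c)).image fun i => g^[i] c := by
    ext z
    simp only [Finset.mem_filter, Finset.mem_image, Finset.mem_range, hmem]
    constructor
    · rintro ⟨-, h⟩
      obtain ⟨i, hi⟩ : z ∈ orbit g c := h ▸ mem_orbit_self g z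
      exact ⟨i % Function.minimalPeriod g c,
        Nat.mod_lt _ (Function.minimalPeriod_pos_of_mem_periodicPts hcp),
        (Function.iterate_mod_minimalPeriod_eq).trans hi⟩
    · rintro ⟨i, -, rfl⟩
      exact ⟨⟨iterate_mem_periodicPts hc i, by rwa [isBadPt_iterate_iff hU hg hκ hc]⟩,
        orbit_iterate_eq hκ hc.1 i⟩
  rw [hset, Finset.sum_image (by
    intro i hi j hj h
    exact Function.iterate_injOn_Iio_minimalPeriod (by simpa using hi) (by simpa using hj) h),
    Finset.sum_congr rfl fun i _ => by
      rw [minimalPeriod_iterate_of_mem hκ hc, fixedSign_iterate hU hg hc],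
    Finset.sum_const, Finset.card_range, orbitIndex_eq_fixedSign hn hU hg hnd hc, nsmul_eq_mul,
    ← mul_assoc, ← Nat.cast_mul,
    Nat.mul_div_cancel' (Function.IsPeriodicPt.minimalPeriod_dvd hc.1)]

end IteratedIndex

/-! ### Confining periodic orbits of perturbations near an isolated fixed point. -/

section Shadowing

variable {E : Type*} [NormedAddCommGroup E] [ProperSpace E] {f : E → E} {p : E} {R : ℝ}

/-- Finite orbits of a small perturbation of `f` stay close to those of `f`. -/
theorem exists_forall_norm_iterate_sub_lt (hf : ContinuousOn f (Metric.closedBall p R)) (N : ℕ)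
    {η : ℝ} (hη : 0 < η) :
    ∃ ε > 0, ∀ (g : E → E) (B : Set E), B ⊆ Metric.closedBall p R →
      (∀ z ∈ B, ‖g z - f z‖ < ε) → ∀ z, ∀ i ≤ N, (∀ j < i, g^[j] z ∈ B) →
        (∀ j < i, f^[j] z ∈ Metric.closedBall p R) → ‖g^[i] z - f^[i] z‖ < η := by
  induction N generalizing η with
  | zero =>
    refine ⟨1, one_pos, fun g B _ _ z i hi _ _ => ?_⟩
    rw [Nat.le_zero.1 hi]
    simpa using hη
  | succ N ih =>
    have huc := (isCompact_closedBall p R).uniformContinuousOn_of_continuous hf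
    obtain ⟨δ, hδ, hδf⟩ := Metric.uniformContinuousOn_iff.1 huc (η / 2) (half_pos hη)
    obtain ⟨ε, hε, hεg⟩ := ih (lt_min hδ hη)
    refine ⟨min ε (η / 2), lt_min hε (half_pos hη), fun g B hB hg z i hi hgz hfz => ?_⟩
    have hg' : ∀ z ∈ B, ‖g z - f z‖ < ε := fun z hz => (hg z hz).trans_le (min_le_left _ _)
    rcases Nat.lt_or_ge N i with hlt | hle
    · obtain rfl : i = N + 1 := by omega
      have h1 := hεg g B hB hg' z N le_rfl (fun j hj => hgz j (hj.trans N.lt_succ_self))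
        fun j hj => hfz j (hj.trans N.lt_succ_self)
      have h2 := hg _ (hgz N N.lt_succ_self)
      have h3 := hδf _ (hB (hgz N N.lt_succ_self)) _ (hfz N N.lt_succ_self)
        (by rw [dist_eq_norm]; exact h1.trans_le (min_le_left _ _))
      rw [dist_eq_norm] at h3
      rw [Function.iterate_succ_apply', Function.iterate_succ_apply']
      calc ‖g (g^[N] z) - f (f^[N] z)‖
          ≤ ‖g (g^[N] z) - f (g^[N] z)‖ + ‖f (g^[N] z) - f (f^[N] z)‖ :=
            norm_sub_le_norm_sub_add_norm_sub _ _ _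
        _ < η / 2 + η / 2 := add_lt_add (h2.trans_le (min_le_right _ _)) h3
        _ = η := add_halves η
    · exact (hεg g B hB hg' z i hle hgz hfz).trans_le (min_le_right _ _)

end Shadowing

theorem eventually_forall_iterate_mem_ball {E : Type*} [PseudoMetricSpace E] {f : E → E} {p : E}
    {R : ℝ} (hf : ContinuousAt f p) (hfp : f p = p) (hR : 0 < R)
    (N : ℕ) : ∀ᶠ z in 𝓝 p, ∀ i ≤ N, f^[i] z ∈ Metric.ball p R := by
  have : ∀ i ∈ Finset.range (N + 1), ∀ᶠ z in 𝓝 p, f^[i] z ∈ Metric.ball p R := by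
    intro i _
    refine (ContinuousAt.iterate hf hfp i).eventually_mem ?_
    rw [Function.iterate_fixed hfp]
    exact Metric.ball_mem_nhds p hR
  filter_upwards [(Filter.eventually_all_finset _).2 this] with z hz i hi
  exact hz i (Finset.mem_range.2 (Nat.lt_succ_of_le hi))

/-- A property that holds near `p` holds on all small closed balls around `p`. -/
theorem Filter.Eventually.forall_closedBall {E : Type*} [PseudoMetricSpace E] {p : E}
    {P : E → Prop} (h : ∀ᶠ z in 𝓝 p, P z) :
    ∀ᶠ r in 𝓝[>] (0 : ℝ), ∀ z ∈ Metric.closedBall p r, P z := by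
  obtain ⟨r, hr, hP⟩ := Metric.nhds_basis_closedBall.eventually_iff.1 h
  filter_upwards [Ioc_mem_nhdsGT hr] with s hs z hz
  exact hP (Metric.closedBall_subset_closedBall hs.2 hz)

/-- The local degree of `h` at `p`: the signed count of zeros of perturbations on small balls. -/
def HasLocalDegree {n : ℕ} (h : Eu n → Eu n) (p : Eu n) (L : ℤ) : Prop :=
  ∀ᶠ r in 𝓝[>] (0 : ℝ), IsLocalDegree h p r L

/-- The degree on one ball with no other zero serves every smaller concentric ball, by excision. -/
theorem exists_hasLocalDegree {n : ℕ} {h : Eu n → Eu n} {p : Eu n}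
    (hc : ∀ᶠ z in 𝓝 p, ContinuousAt h z) (h0 : ∀ᶠ z in 𝓝 p, h z = 0 → z = p) :
    ∃ L, HasLocalDegree h p L := by
  obtain ⟨r, hr, hr0⟩ := (Filter.Eventually.and (hc.and h0).forall_closedBall
    self_mem_nhdsWithin).exists
  have hc' : ContinuousOn h (Metric.closedBall p r) := fun z hz => (hr z hz).1.continuousWithinAt
  have h0' : ∀ z ∈ Metric.closedBall p r, h z = 0 → z = p := fun z hz => (hr z hz).2
  obtain ⟨L, hL⟩ := exists_isLocalDegree hr0 hc' fun z hz hz0 => by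
    rw [h0' z hz hz0]; exact Metric.mem_ball_self hr0
  refine ⟨L, ?_⟩
  filter_upwards [Ioc_mem_nhdsGT hr0] with s hs
  exact IsLocalDegree.of_subset_ball hs.1 hs.2 hc' (fun z hz hz0 => by
    rw [h0' z hz hz0]; exact Metric.mem_ball_self hs.1) hL

namespace IteratedIndex

variable {n : ℕ} {f g : Eu n → Eu n} {U : Set (Eu n)} {p : Eu n} {κ : ℕ} {R : ℝ}

theorem contDiffAt_iterate_of_contDiffAt {d : ℕ} {z : Eu n}
    (hz : ∀ i < d, ContDiffAt ℝ 1 f (f^[i] z)) : ContDiffAt ℝ 1 (f^[d]) z := by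
  induction d with
  | zero => exact contDiffAt_id
  | succ d ih =>
    rw [Function.iterate_succ']
    exact (hz d d.lt_succ_self).comp z (ih fun i hi => hz i (hi.trans d.lt_succ_self))

theorem eventually_contDiffAt_iterate (hf : ContDiffAt ℝ 1 f p) (hfp : f p = p) (d : ℕ) :
    ∀ᶠ z in 𝓝 p, ContDiffAt ℝ 1 (f^[d]) z := by
  refine ContDiffAt.eventually ?_ (by simp)
  refine contDiffAt_iterate_of_contDiffAt fun i _ => ?_
  rwa [Function.iterate_fixed hfp]

theorem eventually_isolated_of_dvd {d : ℕ} (hd : d ∣ κ)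
    (hiso : ∀ᶠ z in 𝓝 p, f^[κ] z = z → z = p) : ∀ᶠ z in 𝓝 p, z - f^[d] z = 0 → z = p :=
  hiso.mono fun _ h hz => h (Function.IsPeriodicPt.trans_dvd (sub_eq_zero.1 hz).symm hd)

theorem exists_hasLocalDegree_iterate (hf : ContDiffAt ℝ 1 f p) (hfp : f p = p) {d : ℕ}
    (hd : d ∣ κ) (hiso : ∀ᶠ z in 𝓝 p, f^[κ] z = z → z = p) :
    ∃ L, HasLocalDegree (fun z => z - f^[d] z) p L :=
  exists_hasLocalDegree ((eventually_contDiffAt_iterate hf hfp d).mono fun _ h =>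
    continuousAt_id.sub h.continuousAt) (eventually_isolated_of_dvd hd hiso)

/-- Nondegeneracy of a `κ`-periodic point is inherited by the lower iterates fixing it. -/
theorem det_ne_zero_of_isNondegenerateOn (hU : IsOpen U) (hg : ContDiffOn ℝ 1 g U) (hκ : 1 ≤ κ)
    (hnd : IsNondegenerateOn g U κ) {d : ℕ} (hd : d ∣ κ) {z : Eu n} (hz : z ∈ periodicPts g U d) :
    (ContinuousLinearMap.id ℝ (Eu n) - fderiv ℝ (g^[d]) z).det ≠ 0 := by
  intro h0
  refine hnd z (periodicPts_subset_of_dvd hd hz) ((det_id_sub_eq_zero_iff_hasEigenvalue _).1 ?_)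
  obtain ⟨m, rfl⟩ := hd
  have hm : 0 < m := Nat.pos_of_ne_zero (by rintro rfl; simp at hκ)
  obtain ⟨c, -, hc⟩ := LinearMap.exists_det_one_sub_pow_eq (fderiv ℝ (g^[d]) z).toLinearMap hm
  have h0' : LinearMap.det (1 - (fderiv ℝ (g^[d]) z).toLinearMap) = 0 := h0
  rw [← fderiv_iterate_mul hU hg hz m, h0'] at hc
  exact hc.trans (by ring)

/-- Near an isolated fixed point of `f^κ`, the `κ`-periodic points of a small perturbation in a
ball all lie in a smaller ball. -/
theorem exists_forall_periodicPts_subset {r s : ℝ} (hs : 0 < s)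
    (hf : ∀ z ∈ Metric.closedBall p R, ContDiffAt ℝ 1 f z) (hrR : r ≤ R)
    (hfr : ∀ z ∈ Metric.closedBall p r, ∀ i ≤ κ, f^[i] z ∈ Metric.ball p R)
    (hiso : ∀ z ∈ Metric.closedBall p r, f^[κ] z = z → z = p) :
    ∃ ε > 0, ∀ g : Eu n → Eu n, (∀ z ∈ Metric.ball p r, ‖g z - f z‖ < ε) →
      periodicPts g (Metric.ball p r) κ ⊆ Metric.ball p s := by
  have hcont : ContinuousOn (fun z => z - f^[κ] z) (Metric.closedBall p r) := fun z hz =>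
    (continuousAt_id.sub (contDiffAt_iterate_of_contDiffAt fun i hi => hf _
      (Metric.ball_subset_closedBall (hfr z hz i hi.le))).continuousAt).continuousWithinAt
  -- A `κ`-periodic point `z` of `g` outside the smaller ball would satisfy `‖z - f^κ z‖ = ‖g^κ z -
  -- f^κ z‖ < m`.
  obtain ⟨m, hm, hmz⟩ := exists_pos_forall_le_norm
    ((isCompact_closedBall p r).diff Metric.isOpen_ball (t := Metric.ball p s))
    (hcont.mono sdiff_subset) (fun z hz h0 => hz.2 (by
      rw [hiso z hz.1 (sub_eq_zero.1 h0).symm]; exact Metric.mem_ball_self hs))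
  obtain ⟨ε, hε, hεg⟩ := exists_forall_norm_iterate_sub_lt
    (fun z hz => (hf z hz).continuousAt.continuousWithinAt) κ hm
  refine ⟨ε, hε, fun g hg z hz => by_contra fun hzs => ?_⟩
  have hzr : z ∈ Metric.closedBall p r := Metric.ball_subset_closedBall (hz.2 0)
  have h1 := hεg g _ (Metric.ball_subset_closedBall.trans (Metric.closedBall_subset_closedBall hrR))
    hg z κ le_rfl (fun j _ => hz.2 j)
    fun j hj => Metric.ball_subset_closedBall (hfr z hzr j hj.le)
  rw [hz.1] at h1
  exact absurd h1 (not_lt.2 (hmz z ⟨hzr, hzs⟩))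

/-- The good orbits of small nondegenerate perturbations are counted by the local degrees of
`1 - f^d` at the isolated fixed point, `d` running over the divisors of `κ`. -/
theorem eventually_mul_goodOrbitSum (hn : 1 ≤ n) (hκ : 1 ≤ κ) (hf : ContDiffAt ℝ 1 f p)
    (hfp : f p = p) (hiso : ∀ᶠ z in 𝓝 p, f^[κ] z = z → z = p) {L : ℕ → ℤ}
    (hL : ∀ d ∈ κ.divisors, HasLocalDegree (fun z => z - f^[d] z) p (L d)) :
    ∀ᶠ r in 𝓝[>] (0 : ℝ), ∃ ε > 0, ∀ g : Eu n → Eu n, IsNondegPerturbation f p κ r ε g →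
      (periodicPts g (Metric.ball p r) κ).Finite ∧
        (κ : ℤ) * goodOrbitSum g (Metric.ball p r) κ =
          ∑ d ∈ κ.divisors, ((κ / d).totient : ℤ) * L d := by
  obtain ⟨R, hR, hR0⟩ := (Filter.Eventually.and
    ((hf.eventually (by simp)).and hiso).forall_closedBall self_mem_nhdsWithin).exists
  replace hR0 : 0 < R := hR0
  filter_upwards [(eventually_forall_iterate_mem_ball hf.continuousAt hfp hR0 κ).forall_closedBall,
    Ioc_mem_nhdsGT hR0] with r hfr hr
  have hr0 : 0 < r := hr.1
  have hfR : ∀ z ∈ Metric.closedBall p R, ContDiffAt ℝ 1 f z := fun z hz => (hR z hz).1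
  -- Two radii are needed. Orbits are required to stay in the ball of radius `r`, while degrees
  -- count zeros in a ball of radius `s`, so small that `f`-orbits of length `κ` from it remain
  -- within `r/2`.
  obtain ⟨s, ⟨hfs, hLs⟩, hs⟩ := (Filter.Eventually.and (Filter.Eventually.and
    (eventually_forall_iterate_mem_ball hf.continuousAt hfp (half_pos hr0) κ).forall_closedBall
    ((Filter.eventually_all_finset _).2 hL)) (Ioc_mem_nhdsGT (half_pos hr0))).exists
  have hs0 : 0 < s := hs.1
  have hsr : s ≤ r := hs.2.trans (by linarith)
  obtain ⟨ε₁, hε₁, hconc⟩ := exists_forall_periodicPts_subset hs0 hfR hr.2 hfr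
    fun z hz => (hR z (Metric.closedBall_subset_closedBall hr.2 hz)).2
  choose! δ hδ hcount using hLs
  -- `η ≤ δ d` lets `1 - g^d` compute the degree of `1 - f^d`; `η ≤ r/2` keeps `g`-orbits in the
  -- ball of radius `r`.
  obtain ⟨η, hηδ, hη⟩ := (Filter.Eventually.and ((Filter.eventually_all_finset κ.divisors).2
    fun d hd => (Ioc_mem_nhdsGT (hδ d hd) : ∀ᶠ η in 𝓝[>] (0 : ℝ), η ∈ Ioc 0 (δ d)))
    (Ioc_mem_nhdsGT (half_pos hr0))).exists
  obtain ⟨ε₂, hε₂, hshad⟩ := exists_forall_norm_iterate_sub_lt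
    (fun z hz => (hfR z hz).continuousAt.continuousWithinAt) κ hη.1
  refine ⟨min ε₁ ε₂, lt_min hε₁ hε₂, fun g ⟨hg, hgf, hnd⟩ => ?_⟩
  set B := Metric.ball p r with hB
  have hsub := hconc g fun z hz => (hgf z hz).trans_le (min_le_left _ _)
  have hgf' : ∀ z ∈ B, ‖g z - f z‖ < ε₂ := fun z hz => (hgf z hz).trans_le (min_le_right _ _)
  have hfsR : ∀ z ∈ Metric.closedBall p s, ∀ i ≤ κ, f^[i] z ∈ Metric.closedBall p R :=
    fun z hz i hi => Metric.ball_subset_closedBall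
      (hfr z (Metric.closedBall_subset_closedBall hsr hz) i hi)
  have hBR : B ⊆ Metric.closedBall p R :=
    Metric.ball_subset_closedBall.trans (Metric.closedBall_subset_closedBall hr.2)
  have hgB : ∀ z ∈ Metric.closedBall p s, ∀ i ≤ κ, g^[i] z ∈ B := by
    intro z hz i
    -- Shadowing up to time `i` presupposes that the earlier points of the `g`-orbit lie in `B`.
    induction i using Nat.strong_induction_on with
    | _ i ih =>
      intro hi
      have h1 := hshad g B hBR hgf' z i hi (fun j hj => ih j hj (hj.le.trans hi))
        fun j hj => hfsR z hz j (hj.le.trans hi)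
      have h2 := hfs z hz i hi
      rw [Metric.mem_ball, dist_eq_norm] at h2 ⊢
      calc ‖g^[i] z - p‖ ≤ ‖g^[i] z - f^[i] z‖ + ‖f^[i] z - p‖ :=
            norm_sub_le_norm_sub_add_norm_sub _ _ _
        _ < r := by linarith [hη.2]
  have hclose : ∀ z ∈ Metric.closedBall p s, ∀ i ≤ κ, ‖g^[i] z - f^[i] z‖ < η :=
    fun z hz i hi => hshad g B hBR hgf' z i hi (fun j hj => hgB z hz j (hj.le.trans hi))
      fun j hj => hfsR z hz j (hj.le.trans hi)
  have hgd : ∀ d ≤ κ, ∀ z ∈ Metric.closedBall p s, ContDiffAt ℝ 1 (g^[d]) z := fun d hd z hz =>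
    contDiffAt_iterate_of_forall_mem Metric.isOpen_ball hg fun i hi => hgB z hz i (hi.le.trans hd)
  have hfd : ∀ d ≤ κ, ∀ z ∈ Metric.closedBall p s,
      fderiv ℝ (fun z => z - g^[d] z) z = ContinuousLinearMap.id ℝ (Eu n) - fderiv ℝ (g^[d]) z := by
    intro d hd z hz
    rw [fderiv_fun_sub differentiableAt_fun_id ((hgd d hd z hz).differentiableAt (by norm_num)),
      fderiv_fun_id]
  have hper : ∀ d ∈ κ.divisors, ∀ z ∈ Metric.closedBall p s, z - g^[d] z = 0 →
      z ∈ periodicPts g B d := by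
    intro d hd z hz h0
    have hp : g^[d] z = z := (sub_eq_zero.1 h0).symm
    refine ⟨hp, fun i => ?_⟩
    rw [← Function.IsPeriodicPt.iterate_mod_apply hp]
    exact hgB z hz _ ((Nat.mod_lt _ (Nat.pos_of_mem_divisors hd)).le.trans (Nat.divisor_le hd))
  -- The two radii meet here: a fixed point of `g^d` in the small ball has its whole orbit in `B`,
  -- and conversely `hsub` confines periodic points to the small ball.
  have hzero : ∀ d ∈ κ.divisors, {z ∈ Metric.ball p s | z - g^[d] z = 0} = periodicPts g B d :=
    fun d hd => Set.ext fun z => ⟨fun hz => hper d hd z (Metric.ball_subset_closedBall hz.1) hz.2,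
      fun hz => ⟨hsub (periodicPts_subset_of_dvd (Nat.dvd_of_mem_divisors hd) hz),
        sub_eq_zero.2 hz.1.symm⟩⟩
  have hdet : ∀ d ∈ κ.divisors, ∀ z ∈ Metric.closedBall p s, z - g^[d] z = 0 →
      (fderiv ℝ (fun z => z - g^[d] z) z).det ≠ 0 := by
    intro d hd z hz h0
    rw [hfd d (Nat.divisor_le hd) z hz]
    exact det_ne_zero_of_isNondegenerateOn Metric.isOpen_ball hg hκ hnd
      (Nat.dvd_of_mem_divisors hd) (hper d hd z hz h0)
  have hκκ : κ ∈ κ.divisors := Nat.mem_divisors_self κ (by omega)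
  have hsmooth : ∀ d ∈ κ.divisors, ∀ z ∈ Metric.closedBall p s,
      ContDiffAt ℝ 1 (fun z => z - g^[d] z) z := fun d hd z hz =>
    contDiffAt_id.sub (hgd d (Nat.divisor_le hd) z hz)
  have hfin : (periodicPts g B κ).Finite := by
    rw [← hzero κ hκκ]
    refine ((isCompact_closedBall p s).finite_zeros (h := fun z => z - g^[κ] z) (y := 0)
      (fun z hz => (hsmooth κ hκκ z hz).continuousAt.continuousWithinAt) ?_).subset
      fun z hz => ⟨Metric.ball_subset_closedBall hz.1, hz.2⟩
    intro z hz h0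
    filter_upwards [(hsmooth κ hκκ z hz).eventually_ne_of_det_ne_zero (hdet κ hκκ z hz h0)]
      with x hx _
    exact h0 ▸ hx
  refine ⟨hfin, ?_⟩
  rw [mul_goodOrbitSum hn Metric.isOpen_ball hg hκ hnd hfin]
  refine Finset.sum_congr rfl fun d hd => ?_
  have hdκ := Nat.divisor_le hd
  rw [← hcount d hd (fun z => z - g^[d] z) (hsmooth d hd)
    (fun z hz => by
      rw [sub_sub_sub_cancel_left, ← norm_neg, neg_sub]
      exact (hclose z hz d hdκ).trans_le (hηδ d hd).2) 
    (fun z hz => hdet d hd z (Metric.ball_subset_closedBall hz)), signedCount, hzero d hd]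
  congr 1
  refine finsum_mem_congr rfl fun z hz => ?_
  rw [fixedSign, hfd d hdκ z (Metric.ball_subset_closedBall
    (hsub (periodicPts_subset_of_dvd (Nat.dvd_of_mem_divisors hd) hz)))]

end IteratedIndex

/-! ### Existence and uniqueness of the iterated index in `ℝⁿ`. -/

namespace IteratedIndex

variable {n : ℕ} {f : Eu n → Eu n} {p : Eu n} {κ : ℕ}

/-- Nondegenerate perturbations arbitrarily `C¹`-close to a `C¹` germ exist on all small balls. -/
theorem eventually_exists_isC1NondegPerturbation (hκ : 1 ≤ κ) (hf : ContDiffAt ℝ 1 f p) :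
    ∀ᶠ r in 𝓝[>] (0 : ℝ), ∀ ε > 0, ∃ g : Eu n → Eu n, IsC1NondegPerturbation f p κ r ε g := by
  filter_upwards [(hf.eventually (by simp)).forall_closedBall, self_mem_nhdsWithin]
    with r hr hr0 ε hε
  obtain ⟨F, hF, hFf⟩ := exists_contDiff_eventuallyEq_of_closedBall (le_of_lt hr0) hr
  obtain ⟨g, hg, hgF, hnd⟩ := exists_perturbation_iterate_nondegenerate hF
    (isCompact_closedBall p r) hκ hε
  have hsub : Metric.ball p r ⊆ Metric.closedBall p r := Metric.ball_subset_closedBall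
  refine ⟨g, ⟨hg.contDiffOn, fun z hz => ?_, fun z hz hev => ?_⟩, fun z hz => ?_⟩
  · rw [← (hFf z (hsub hz)).self_of_nhds]
    exact (hgF z (hsub hz)).1
  · exact hnd z (hsub (hz.2 0)) hz.1 ((det_id_sub_eq_zero_iff_hasEigenvalue _).2 hev)
  · rw [← (hFf z (hsub hz)).fderiv_eq]
    exact (hgF z (hsub hz)).2

theorem isIteratedIndexAt_of_mul_eq (hn : 1 ≤ n) (hκ : 1 ≤ κ) (hf : ContDiffAt ℝ 1 f p)
    (hfp : f p = p) (hiso : ∀ᶠ z in 𝓝 p, f^[κ] z = z → z = p) {L : ℕ → ℤ}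
    (hL : ∀ d ∈ κ.divisors, HasLocalDegree (fun z => z - f^[d] z) p (L d)) {m : ℤ}
    (hm : (κ : ℤ) * m = ∑ d ∈ κ.divisors, ((κ / d).totient : ℤ) * L d) :
    IsIteratedIndexAt f p κ m := by
  filter_upwards [eventually_mul_goodOrbitSum hn hκ hf hfp hiso hL] with r ⟨ε, hε, H⟩
  refine ⟨ε, hε, fun g hg => ⟨(H g hg).1, ?_⟩⟩
  have := (H g hg).2
  rw [← hm] at this
  exact mul_left_cancel₀ (by exact_mod_cast (by omega : κ ≠ 0)) this

/-- The totient-weighted sum of the local degrees of the `1 - f^d` is divisible by `κ`. -/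
theorem exists_mul_eq_sum_totient_mul (hn : 1 ≤ n) (hκ : 1 ≤ κ) (hf : ContDiffAt ℝ 1 f p)
    (hfp : f p = p) (hiso : ∀ᶠ z in 𝓝 p, f^[κ] z = z → z = p) {L : ℕ → ℤ}
    (hL : ∀ d ∈ κ.divisors, HasLocalDegree (fun z => z - f^[d] z) p (L d)) :
    ∃ m : ℤ, (κ : ℤ) * m = ∑ d ∈ κ.divisors, ((κ / d).totient : ℤ) * L d := by
  obtain ⟨r, ⟨ε, hε, H⟩, hr⟩ := ((eventually_mul_goodOrbitSum hn hκ hf hfp hiso hL).and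
    (eventually_exists_isC1NondegPerturbation hκ hf)).exists
  obtain ⟨g, hg⟩ := hr ε hε
  exact ⟨_, (H g hg.1).2⟩

/-- A single perturbation, small enough for both integers on a common ball, computes both. -/
theorem IsIteratedIndexAt.unique (hκ : 1 ≤ κ) (hf : ContDiffAt ℝ 1 f p) {m m' : ℤ}
    (h : IsIteratedIndexAt f p κ m) (h' : IsIteratedIndexAt f p κ m') : m = m' := by
  obtain ⟨r, ⟨⟨ε, hε, H⟩, ε', hε', H'⟩, hr⟩ := ((h.and h').and
    (eventually_exists_isC1NondegPerturbation hκ hf)).exists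
  obtain ⟨g, hg⟩ := hr (min ε ε') (lt_min hε hε')
  have hmono : ∀ {e}, min ε ε' ≤ e → IsNondegPerturbation f p κ r e g := fun he =>
    ⟨hg.1.1, fun z hz => (hg.1.2.1 z hz).trans_le he, hg.1.2.2⟩
  rw [← (H g (hmono (min_le_left _ _))).2, (H' g (hmono (min_le_right _ _))).2]

end IteratedIndex

/-! ### Constancy of local degrees in continuous families. -/

/-- In a family of maps with a common fixed point the iterates are jointly continuous near it. -/
theorem eventually_continuousAt_iterate_family {S X : Type*} [TopologicalSpace S]
    [TopologicalSpace X] {f : S → X → X} {p : X} {s : S} (hfp : f s p = p)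
    (hf : ∀ᶠ q in 𝓝 (s, p), ContinuousAt (fun q : S × X => f q.1 q.2) q) (d : ℕ) :
    ∀ᶠ q in 𝓝 (s, p), ContinuousAt (fun q : S × X => (f q.1)^[d] q.2) q := by
  induction d with
  | zero => exact Eventually.of_forall fun q => continuousAt_snd
  | succ d ih =>
    have ht : Tendsto (fun q : S × X => (q.1, (f q.1)^[d] q.2)) (𝓝 (s, p)) (𝓝 (s, p)) := by
      have := (continuousAt_fst (p := (s, p))).prodMk ih.self_of_nhds
      rw [ContinuousAt] at this
      simpa only [Function.iterate_fixed hfp] using this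
    filter_upwards [ih, ht.eventually hf] with q h1 h2
    have := ContinuousAt.comp (f := fun q : S × X => (q.1, (f q.1)^[d] q.2)) h2
      (continuousAt_fst.prodMk h1)
    simpa only [Function.iterate_succ_apply', Function.comp_def] using this

/-- The local degree at a uniformly isolated zero is constant in a connected compact family. -/
theorem exists_forall_hasLocalDegree {n : ℕ} {S : Type*} [TopologicalSpace S] [CompactSpace S]
    [PreconnectedSpace S] {H : S → Eu n → Eu n} {p : Eu n}
    (hc : ∀ s, ∀ᶠ q in 𝓝 (s, p), ContinuousAt (fun q : S × Eu n => H q.1 q.2) q)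
    (h0 : ∀ᶠ z in 𝓝 p, ∀ s, H s z = 0 → z = p) : ∃ L, ∀ s, HasLocalDegree (H s) p L := by
  -- Compactness of the parameter space provides one ball that works for all parameters.
  have hc' : ∀ᶠ z in 𝓝 p, ∀ s ∈ (univ : Set S),
      ContinuousAt (fun q : S × Eu n => H q.1 q.2) (s, z) := by
    refine isCompact_univ.eventually_forall_of_forall_eventually fun s _ => ?_
    have := hc s
    rw [nhds_prod_eq] at this ⊢
    exact eventually_swap_iff.1 this
  obtain ⟨r, hr, hr0⟩ := (Filter.Eventually.and (hc'.and h0).forall_closedBall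
    self_mem_nhdsWithin).exists
  replace hr0 : 0 < r := hr0
  have hcr : ∀ s, ∀ z ∈ Metric.closedBall p r,
      ContinuousAt (fun q : S × Eu n => H q.1 q.2) (s, z) := fun s z hz => (hr z hz).1 s trivial
  have hcs : ∀ s, ContinuousOn (H s) (Metric.closedBall p r) := fun s z hz =>
    (ContinuousAt.comp (f := fun z => (s, z)) (hcr s z hz)
      (by fun_prop)).continuousWithinAt
  have h0b : ∀ {t}, 0 < t → ∀ s, ∀ z ∈ Metric.closedBall p r, H s z = 0 → z ∈ Metric.ball p t :=
    fun ht s z hz h => by rw [(hr z hz).2 s h]; exact Metric.mem_ball_self ht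
  choose L hL using fun s => exists_isLocalDegree hr0 (hcs s) (h0b hr0 s)
  -- On that fixed ball, nearby parameters give uniformly close maps, hence equal degrees.
  have hloc : IsLocallyConstant L := by
    rw [IsLocallyConstant.iff_eventually_eq]
    intro s
    obtain ⟨δ, hδ, hclose⟩ := (hL s).exists_forall_of_close
    have : ∀ᶠ s' in 𝓝 s, ∀ z ∈ Metric.closedBall p r, ‖H s' z - H s z‖ < δ := by
      refine (isCompact_closedBall p r).eventually_forall_of_forall_eventually fun z hz => ?_
      have h1 : ContinuousAt (fun q : S × Eu n => H q.1 q.2) (s, z) := hcr s z hz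
      have h2 : ContinuousAt (fun q : S × Eu n => H s q.2) (s, z) :=
        ContinuousAt.comp (f := fun q : S × Eu n => (s, q.2)) (x := (s, z)) (hcr s z hz)
          (by fun_prop)
      refine (h1.sub h2).norm.eventually_lt continuousAt_const ?_
      simpa using hδ
    filter_upwards [this] with s' hs'
    exact (hL s').unique (hcs s') (hclose _ hs')
  rcases isEmpty_or_nonempty S with hS | ⟨⟨s₀⟩⟩
  · exact ⟨0, fun s => isEmptyElim s⟩
  refine ⟨L s₀, fun s => ?_⟩
  filter_upwards [Ioc_mem_nhdsGT hr0] with t ht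
  rw [hloc.apply_eq_of_preconnectedSpace s₀ s]
  exact IsLocalDegree.of_subset_ball ht.1 ht.2 (hcs s) (h0b ht.1 s) (hL s)

/-! ### Passage to charts of a manifold. -/

namespace IteratedIndex

variable {n : ℕ} {M : Type*} [TopologicalSpace M] {x : M} {κ : ℕ}

section Chart

variable {φ ψ : OpenPartialHomeomorph M (Eu n)} {F : M → M}

theorem inChart_apply (F : M → M) {y : M} (hy : y ∈ φ.source) :
    inChart φ F (φ y) = φ (F y) := by
  rw [inChart, φ.left_inv hy]

theorem iterate_inChart_apply {y : M} {i : ℕ} (hy : ∀ j ≤ i, F^[j] y ∈ φ.source) :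
    (inChart φ F)^[i] (φ y) = φ (F^[i] y) := by
  induction i with
  | zero => rfl
  | succ i ih =>
    rw [Function.iterate_succ_apply', ih fun j hj => hy j (hj.trans i.le_succ),
      inChart_apply F (hy i i.le_succ), Function.iterate_succ_apply']

theorem eventually_forall_iterate_mem_source (hF : ContinuousAt F x) (hFx : F x = x)
    (hx : x ∈ φ.source) (N : ℕ) : ∀ᶠ y in 𝓝 x, ∀ i ≤ N, F^[i] y ∈ φ.source := by
  have : ∀ i ∈ Finset.range (N + 1), ∀ᶠ y in 𝓝 x, F^[i] y ∈ φ.source := by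
    intro i _
    refine (ContinuousAt.iterate hF hFx i).eventually_mem ?_
    rw [Function.iterate_fixed hFx]
    exact φ.open_source.mem_nhds hx
  filter_upwards [(Filter.eventually_all_finset _).2 this] with z hz i hi
  exact hz i (Finset.mem_range.2 (Nat.lt_succ_of_le hi))

theorem eq_of_iterate_inChart_eq {z : Eu n} (hz : z ∈ φ.target)
    (hF : ∀ i ≤ κ, F^[i] (φ.symm z) ∈ φ.source)
    (hiso : F^[κ] (φ.symm z) = φ.symm z → φ.symm z = x)
    (h : (inChart φ F)^[κ] z = z) : z = φ x := by
  rw [← φ.right_inv hz, iterate_inChart_apply hF] at h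
  rw [← hiso (φ.injOn (hF κ le_rfl) (hF 0 κ.zero_le) h), φ.right_inv hz]

theorem eventually_isolated_inChart (hF : ContinuousAt F x) (hFx : F x = x) (hx : x ∈ φ.source)
    (hiso : ∀ᶠ y in 𝓝 x, F^[κ] y = y → y = x) :
    ∀ᶠ z in 𝓝 (φ x), (inChart φ F)^[κ] z = z → z = φ x := by
  filter_upwards [(φ.tendsto_symm hx).eventually
    ((eventually_forall_iterate_mem_source hF hFx hx κ).and hiso),
    φ.open_target.mem_nhds (φ.map_source hx)] with z hz hzt
  exact eq_of_iterate_inChart_eq hzt hz.1 hz.2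

variable [ChartedSpace (Eu n) M]

theorem contDiffAt_inChart (hφ : IsChartAround φ x) (hF : IsC1Germ n F x) :
    ContDiffAt ℝ 1 (inChart φ F) (φ x) := by
  rw [← contMDiffAt_iff_contDiffAt]
  have h1 : ContMDiffAt 𝓘(ℝ, Eu n) 𝓘(ℝ, Eu n) 1 φ.symm (φ x) :=
    contMDiffAt_symm_of_mem_maximalAtlas hφ.1 (φ.map_source hφ.2)
  have h2 : ContMDiffAt 𝓘(ℝ, Eu n) 𝓘(ℝ, Eu n) 1 F (φ.symm (φ x)) := by
    rw [φ.left_inv hφ.2]; exact hF.2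
  have h3 : ContMDiffAt 𝓘(ℝ, Eu n) 𝓘(ℝ, Eu n) 1 φ (F (φ.symm (φ x))) := by
    rw [φ.left_inv hφ.2, hF.1]; exact contMDiffAt_of_mem_maximalAtlas hφ.1 hφ.2
  exact (h3.comp _ h2).comp _ h1

theorem contDiffAt_transition (hφ : φ ∈ IsManifold.maximalAtlas 𝓘(ℝ, Eu n) 1 M)
    (hψ : ψ ∈ IsManifold.maximalAtlas 𝓘(ℝ, Eu n) 1 M) {z : Eu n}
    (hz : z ∈ (φ.symm.trans ψ).source) : ContDiffAt ℝ 1 (φ.symm.trans ψ) z := by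
  rw [OpenPartialHomeomorph.trans_source] at hz
  rw [← contMDiffAt_iff_contDiffAt]
  exact (contMDiffAt_of_mem_maximalAtlas hψ hz.2).comp _
    (contMDiffAt_symm_of_mem_maximalAtlas hφ hz.1)

/-- The local degree of `1 - F^d`, read in a chart, does not depend on the chart. -/
theorem hasLocalDegree_inChart_of_chart (hφ : IsChartAround φ x) (hψ : IsChartAround ψ x)
    (hF : IsC1Germ n F x) {d : ℕ} (hiso : ∀ᶠ y in 𝓝 x, F^[d] y = y → y = x) {L : ℤ}
    (hL : HasLocalDegree (fun z => z - (inChart φ F)^[d] z) (φ x) L) :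
    HasLocalDegree (fun z => z - (inChart ψ F)^[d] z) (ψ x) L := by
  have key : ∀ {χ : OpenPartialHomeomorph M (Eu n)}, IsChartAround χ x →
      ∀ᶠ r in 𝓝[>] (0 : ℝ), ∀ z ∈ Metric.closedBall (χ x) r,
        ContDiffAt ℝ 1 ((inChart χ F)^[d]) z ∧ ((inChart χ F)^[d] z = z → z = χ x) := fun hχ =>
    ((eventually_contDiffAt_iterate (contDiffAt_inChart hχ hF)
      (by rw [inChart_apply F hχ.2, hF.1]) d).and
      (eventually_isolated_inChart hF.2.continuousAt hF.1 hχ.2 hiso)).forall_closedBall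
  obtain ⟨r, ⟨hr, hLr⟩, hr0⟩ := (Filter.Eventually.and ((key hφ).and hL) self_mem_nhdsWithin).exists
  filter_upwards [key hψ, self_mem_nhdsWithin] with r' hr' hr0'
  set θ := φ.symm.trans ψ with hθ
  have hθx : θ (φ x) = ψ x := by
    rw [hθ, OpenPartialHomeomorph.coe_trans, Function.comp_apply, φ.left_inv hφ.2]
  have hsrc := eventually_forall_iterate_mem_source hF.2.continuousAt hF.1 hφ.2 d
  have hsrc' := eventually_forall_iterate_mem_source hF.2.continuousAt hF.1 hψ.2 d
  -- The transition map conjugates the iterates only where the first `d` points of the orbit lie in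
  -- both chart domains, which holds near `x`.
  have hab : ∀ᶠ w in 𝓝 (ψ x), (inChart ψ F)^[d] w = θ ((inChart φ F)^[d] (θ.symm w)) := by
    filter_upwards [(ψ.tendsto_symm hψ.2).eventually (hsrc.and hsrc'),
      ψ.open_target.mem_nhds (ψ.map_source hψ.2)] with w hw hwt
    have e : θ.symm w = φ (ψ.symm w) := rfl
    rw [e, iterate_inChart_apply hw.1]
    conv_lhs => rw [← ψ.right_inv hwt]
    rw [iterate_inChart_apply hw.2, hθ, OpenPartialHomeomorph.coe_trans, Function.comp_apply,
      φ.left_inv (hw.1 d le_rfl)]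
  have := IsLocalDegree.conj (b := (inChart ψ F)^[d]) hr0 hr0'
    (fun z hz => (hr z hz).1.continuousAt.continuousWithinAt)
    (Function.iterate_fixed (by rw [inChart_apply F hφ.2, hF.1]) d) (fun z hz => (hr z hz).2) θ
    (by
      rw [hθ, OpenPartialHomeomorph.trans_source]
      refine ⟨φ.map_source hφ.2, ?_⟩
      rw [mem_preimage, φ.left_inv hφ.2]
      exact hψ.2)
    (fun z hz => contDiffAt_transition hφ.1 hψ.1 hz)
    (fun z hz => contDiffAt_transition hψ.1 hφ.1 hz)
    (by rw [hθx]; exact fun z hz => (hr' z hz).1.continuousAt.continuousWithinAt)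
    (by rw [hθx]; exact fun z hz => (hr' z hz).2) (by rw [hθx]; exact hab) hLr
  rwa [hθx] at this

/-- The local degrees are the same in all charts, so the integer found in one chart is the index in
every chart. -/
theorem isIteratedIndex_of_mul_eq (hn : 1 ≤ n) (hκ : 1 ≤ κ) (hφ : IsChartAround φ x)
    (hF : IsC1Germ n F x) (hiso : ∀ᶠ y in 𝓝 x, F^[κ] y = y → y = x) {L : ℕ → ℤ}
    (hL : ∀ d ∈ κ.divisors, HasLocalDegree (fun z => z - (inChart φ F)^[d] z) (φ x) (L d)) {m : ℤ}
    (hm : (κ : ℤ) * m = ∑ d ∈ κ.divisors, ((κ / d).totient : ℤ) * L d) :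
    IsIteratedIndex (n := n) F x κ m := fun ψ hψ =>
  isIteratedIndexAt_of_mul_eq hn hκ (contDiffAt_inChart hψ hF)
    (by rw [inChart_apply F hψ.2, hF.1])
    (eventually_isolated_inChart hF.2.continuousAt hF.1 hψ.2 hiso)
    (fun d hd => hasLocalDegree_inChart_of_chart hφ hψ hF
      (hiso.mono fun _ h hy => h (Function.IsPeriodicPt.trans_dvd hy (Nat.dvd_of_mem_divisors hd)))
      (hL d hd)) hm

variable [IsManifold 𝓘(ℝ, Eu n) 1 M]

theorem isChartAround_chartAt (x : M) : IsChartAround (chartAt (Eu n) x) x :=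
  ⟨IsManifold.chart_mem_maximalAtlas x, mem_chart_source _ x⟩

theorem existsUnique_isIteratedIndex (hn : 1 ≤ n) (hκ : 1 ≤ κ) (hF : IsC1Germ n F x)
    (hiso : ∀ᶠ y in 𝓝 x, F^[κ] y = y → y = x) :
    ∃! m : ℤ, IsIteratedIndex (n := n) F x κ m := by
  have hφ := isChartAround_chartAt (n := n) x
  have hf := contDiffAt_inChart hφ hF
  have hfp : inChart (chartAt (Eu n) x) F (chartAt (Eu n) x x) = chartAt (Eu n) x x := by
    rw [inChart_apply F hφ.2, hF.1]
  have hiso' := eventually_isolated_inChart hF.2.continuousAt hF.1 hφ.2 hiso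
  have hdeg : ∀ d ∈ κ.divisors, ∃ L, HasLocalDegree
      (fun z => z - (inChart (chartAt (Eu n) x) F)^[d] z) (chartAt (Eu n) x x) L := fun d hd =>
    exists_hasLocalDegree_iterate hf hfp (Nat.dvd_of_mem_divisors hd) hiso'
  choose! L hL using hdeg
  obtain ⟨m, hm⟩ := exists_mul_eq_sum_totient_mul hn hκ hf hfp hiso' hL
  exact ⟨m, isIteratedIndex_of_mul_eq hn hκ hφ hF hiso hL hm, fun m' hm' =>
    (hm' _ hφ).unique hκ hf (isIteratedIndex_of_mul_eq hn hκ hφ hF hiso hL hm _ hφ)⟩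

end Chart

section Homotopy

variable [ChartedSpace (Eu n) M] [IsManifold 𝓘(ℝ, Eu n) 1 M]

/-- The index is determined by the local degrees of `1 - F_s^d`, which are constant along a
uniformly isolated continuous family. The differentials need not vary continuously with `s`. -/
theorem exists_forall_isIteratedIndex {S : Type*} [TopologicalSpace S] [CompactSpace S]
    [PreconnectedSpace S] (hn : 1 ≤ n) (hκ : 1 ≤ κ) {F : S → M → M}
    (hF : ∀ s, IsC1Germ n (F s) x) {U : Set M} (hU : U ∈ 𝓝 x)
    (hc : ContinuousOn (fun q : S × M => F q.1 q.2) (univ ×ˢ U))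
    (hiso : ∀ s, ∀ y ∈ U, (F s)^[κ] y = y → y = x) :
    ∃ m : ℤ, ∀ s, IsIteratedIndex (n := n) (F s) x κ m := by
  have hφ := isChartAround_chartAt (n := n) x
  set φ := chartAt (Eu n) x
  have hFc : ∀ s, ∀ᶠ q in 𝓝 (s, x), ContinuousAt (fun q : S × M => F q.1 q.2) q := by
    intro s
    have : ∀ᶠ q : S × M in 𝓝 (s, x), univ ×ˢ U ∈ 𝓝 q :=
      eventually_mem_nhds_iff.2 (prod_mem_nhds univ_mem hU)
    filter_upwards [this] with q hq
    exact hc.continuousAt hq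
  have hsymm : ∀ s : S, Tendsto (fun q : S × Eu n => (q.1, φ.symm q.2)) (𝓝 (s, φ x))
      (𝓝 (s, x)) := fun s => by
    have := (tendsto_id (x := 𝓝 s)).prodMap (φ.tendsto_symm hφ.2)
    rwa [← nhds_prod_eq, ← nhds_prod_eq] at this
  have htarget : ∀ s : S, ∀ᶠ q : S × Eu n in 𝓝 (s, φ x), q.2 ∈ φ.target := fun s =>
    continuousAt_snd.eventually_mem (φ.open_target.mem_nhds (φ.map_source hφ.2))
  have hmem : ∀ s (i : ℕ), ∀ᶠ q : S × M in 𝓝 (s, x), (F q.1)^[i] q.2 ∈ φ.source := by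
    intro s i
    refine (eventually_continuousAt_iterate_family (hF s).1
      (hFc s) i).self_of_nhds.eventually_mem (φ.open_source.mem_nhds ?_)
    rw [Function.iterate_fixed (hF s).1]
    exact hφ.2
  have hfc : ∀ s, ∀ᶠ q in 𝓝 (s, φ x),
      ContinuousAt (fun q : S × Eu n => inChart φ (F q.1) q.2) q := by
    intro s
    filter_upwards [(hsymm s).eventually ((hFc s).and (hmem s 1)), htarget s] with q hq hqt
    have h1 : ContinuousAt (fun q : S × Eu n => (q.1, φ.symm q.2)) q :=
      continuousAt_fst.prodMk ((φ.symm.continuousAt hqt).comp continuousAt_snd)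
    have h2 : ContinuousAt (fun q : S × Eu n => F q.1 (φ.symm q.2)) q :=
      ContinuousAt.comp (f := fun q : S × Eu n => (q.1, φ.symm q.2)) hq.1 h1
    exact ContinuousAt.comp (f := fun q : S × Eu n => F q.1 (φ.symm q.2)) (φ.continuousAt hq.2) h2
  have hfx : ∀ s, inChart φ (F s) (φ x) = φ x := fun s => by
    rw [inChart_apply _ hφ.2, (hF s).1]
  -- Uniform isolation passes to the chart only where orbits of length `κ` stay in its domain;
  -- compactness of `S` makes this neighbourhood independent of `s`.
  have hfiso : ∀ᶠ z in 𝓝 (φ x), ∀ s ∈ (univ : Set S), (inChart φ (F s))^[κ] z = z → z = φ x := by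
    refine isCompact_univ.eventually_forall_of_forall_eventually fun s _ => ?_
    have hall : ∀ᶠ q : S × M in 𝓝 (s, x), ∀ i ∈ Finset.range (κ + 1),
        (F q.1)^[i] q.2 ∈ φ.source := (Filter.eventually_all_finset _).2 fun i _ => hmem s i
    have hUq : ∀ᶠ q : S × M in 𝓝 (s, x), q.2 ∈ U := continuousAt_snd.eventually_mem hU
    have : ∀ᶠ q : S × Eu n in 𝓝 (s, φ x), (inChart φ (F q.1))^[κ] q.2 = q.2 → q.2 = φ x := by
      filter_upwards [(hsymm s).eventually (hall.and hUq), htarget s] with q hq hqt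
      exact eq_of_iterate_inChart_eq hqt
        (fun i hi => hq.1 i (Finset.mem_range.2 (Nat.lt_succ_of_le hi))) (hiso q.1 _ hq.2)
    rw [nhds_prod_eq] at this ⊢
    exact eventually_swap_iff.1 this
  have hdeg : ∀ d ∈ κ.divisors, ∃ L, ∀ s,
      HasLocalDegree (fun z => z - (inChart φ (F s))^[d] z) (φ x) L := by
    intro d hd
    refine exists_forall_hasLocalDegree (fun s => ?_) ?_
    · filter_upwards [eventually_continuousAt_iterate_family
        (f := fun s => inChart φ (F s)) (hfx s) (hfc s) d] with q hq
      exact continuousAt_snd.sub hq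
    · filter_upwards [hfiso] with z hz s h
      exact hz s trivial
        (Function.IsPeriodicPt.trans_dvd (sub_eq_zero.1 h).symm (Nat.dvd_of_mem_divisors hd))
  choose! L hL using hdeg
  rcases isEmpty_or_nonempty S with hS | ⟨⟨s₀⟩⟩
  · exact ⟨0, fun s => isEmptyElim s⟩
  obtain ⟨m, hm⟩ := exists_mul_eq_sum_totient_mul hn hκ (contDiffAt_inChart hφ (hF s₀)) (hfx s₀)
    (hfiso.mono fun z hz => hz s₀ trivial) fun d hd => hL d hd s₀
  refine ⟨m, fun s => isIteratedIndex_of_mul_eq hn hκ hφ (hF s) ?_ (fun d hd => hL d hd s) hm⟩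
  filter_upwards [hU] with y hy
  exact hiso s y hy

end Homotopy

end IteratedIndex

theorem corollary2p6 (n : ℕ) (hn : 1 ≤ n) {M : Type*} [TopologicalSpace M]
    [ChartedSpace (Eu n) M] [IsManifold 𝓘(ℝ, Eu n) 1 M] (x : M) (κ : ℕ) (hκ : 1 ≤ κ) :
    -- the iterated index is well defined
    (∀ F : M → M, IteratedIndex.IsC1Germ n F x → (∀ᶠ y in 𝓝[≠] x, F^[κ] y ≠ y) →
      (∀ φ : OpenPartialHomeomorph M (Eu n), IteratedIndex.IsChartAround φ x →
        ∀ᶠ r in 𝓝[>] (0 : ℝ), ∀ ε > 0, ∃ g : Eu n → Eu n,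
          IteratedIndex.IsC1NondegPerturbation (IteratedIndex.inChart φ F) (φ x) κ r ε g) ∧
      ∃! m : ℤ, IteratedIndex.IsIteratedIndex (n := n) F x κ m) ∧
    -- the iterated index is homotopy invariant
    (∀ F : unitInterval → M → M, (∀ s, IteratedIndex.IsC1Germ n (F s) x) →
      (∃ U ∈ 𝓝 x,
        ContinuousOn (fun q : unitInterval × M => F q.1 q.2) (Set.univ ×ˢ U) ∧
        ∀ s, ∀ y ∈ U, (F s)^[κ] y = y → y = x) →
      ∃ m : ℤ, ∀ s, IteratedIndex.IsIteratedIndex (n := n) (F s) x κ m) := by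
  refine ⟨fun F hF hiso => ⟨fun φ hφ => ?_, ?_⟩, fun F hF ⟨U, hU, hc, hiso⟩ => ?_⟩
  · exact IteratedIndex.eventually_exists_isC1NondegPerturbation hκ
      (IteratedIndex.contDiffAt_inChart hφ hF)
  · refine IteratedIndex.existsUnique_isIteratedIndex hn hκ hF ?_
    filter_upwards [eventually_nhdsWithin_iff.1 hiso] with y hy h
    exact by_contra fun hne => hy hne h
  · exact IteratedIndex.exists_forall_isIteratedIndex hn hκ hF hU hc hiso
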